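/- **Setting.** Let $\mathfrak g$ be a finite-dimensional complex simple Lie algebra with simple roots $\alpha_i$ ($i\in I$), Cartan matrix $C_{ij}=2(\alpha_i,\alpha_j)/(\alpha_i,\alpha_i)$, and $r_i=r(\alpha_i,\alpha_i)/2$, where long roots have squared length $2$ and $r$ is the lacing number; let $D=\mathrm{diag}(r_i)$ and $B=DC$. Let $K=\mathbb C[[h,\beta]]$, $q=e^{h}$, $t=e^{h\beta}$, $\mathcal S=\mathbb C^*q^{\mathbb Z}t^{\mathbb Z}$, $[n]_q=\frac{q^n-q^{-n}}{q-q^{-1}}$, $C_{ij}(q,t)=(q^{r_i}t^{-1}+q^{-r_i}t)\delta_{ij}-[2\delta_{ij}-C_{ij}]_q$ and $B_{ij}(q,t)=[r_i]_qC_{ij}(q,t)$. Let $x_i[n]$ ($i\in I$, $n\neq0$) generate the Heisenberg algebra $[x_i[n],x_j[m]]=n\frac{t^n-t^{-n}}{q^n-q^{-n}}B_{ij}(q^n,t^n)\delta_{n,-m}$, put $a_i[n]=\frac{q^n-q^{-n}}{n}x_i[n]$, define $y_i[n]$ by $a_j[n]=\sum_iC_{ij}(q^n,t^n)y_i[n]$,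 and let all of them act on the Fock modules $\pi_\mu$, $\mu\in\mathbb C[\beta]\otimes\mathfrak h^*$, which are free over the $x_i[n]$, $n<0$, on a vector $v_\mu$ killed by the $x_i[n]$, $n>0$; moreover $q^{\xi y_i[0]}$ acts on $\pi_\mu$ by $q^{\xi(\mu,\omega_i)}$, and $e^{\gamma Q_i}$ ($\gamma\in\beta^{-1}\mathbb C[\beta]$) maps $\pi_\mu$ to $\pi_{\mu+\gamma\beta r\alpha_i}$, sends $v_\mu$ to $v_{\mu+\gamma\beta r\alpha_i}$ and commutes with the $x_j[n]$. Put $$Y_i(z)=t^{2(\rho^\vee,\omega_i)}q^{-2r(\rho,\omega_i)+2y_i[0]}\exp\Big(\sum_{n\ne0}y_i[n]z^{-n}\Big).$$ A *monomial* is a normally ordered product $M={:}\prod Y_i(za)^{d_{i,a}(M)}{:}$ with $a\in\mathcal S$ and finitely many nonzero exponents $d_{i,a}(M)\in\mathbb Z$; products of monomials are normally ordered. Put $$A_i(z)=Y_i(zq^{r_i}t^{-1})Y_i(zq^{-r_i}t)\prod_{j\ne i}\ \prod_{s=0}^{-C_{ji}-1}Y_j(zq^{-C_{ji}-1-2s})^{-1}.$$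 Let $S_i^+$ and $S_i^-$ be the coefficients of $w^{-1}$ in $$e^{-Q_i/r_i}{:}\exp\Big(\sum_{n\neq0}\tfrac{a_i[n]}{q^{nr_i}-q^{-nr_i}}w^{-n}\Big){:}\qquad\text{and}\qquad e^{Q_i/\beta}{:}\exp\Big(-\sum_{n\neq0}\tfrac{a_i[n]}{t^n-t^{-n}}w^{-n}\Big){:}\,,$$ regarded as maps out of $\pi_0$ (after inverting the denominators). Let $\mathbf W_{q,t}(\mathfrak g)$ be the space of $K$-linear combinations of monomials that are fields (on each vector only finitely many negative powers of $z$ contribute) and all of whose coefficients $\Phi_n$ satisfy $\Phi_nS_i^\pm=S_i^\pm\Phi_n$ on $\pi_0$ for all $i\in I$. **The algorithm.** A monomial $M$ is *dominant* if all $d_{i,a}(M)\ge0$; *generic* if all $d_{i,a}(M)\in\{-1,0,1\}$; *regular* if for all $i,a$: $d_{i,a}(M)>0$ implies $d_{i,aq^{-2r_i}}(M),d_{i,at^2}(M)\ge0$; and if $d_{i,a}(M),d_{i,aq^{-2r_i}t^2}(M)$ are both $>0$ (resp. both $<0$), then $d_{i,aq^{-2r_i}}(M),d_{i,at^2}(M)$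 are both $>0$ (resp. both $<0$). $Y_i(za)$ is *admissible* in $M$ if $d_{i,a}(M)>0$ and $d_{i,aq^{-2r_i}}(M)=d_{i,at^2}(M)=0$. Start with the list consisting of a dominant regular generic monomial $m$, with coefficient $1$. At each step, the algorithm fails if some monomial in the list is not regular or not generic; otherwise, for each $M$ in the list and each $Y_j(za)$ admissible in $M$, add to the list $M'=MA_j(zaq^{-r_j}t)^{-1}$, an arrow $M\to M'$. If $M=Y_j(za)\prod_sY_j(zb_s)\prod_uY_j(zc_u)^{-1}N$ with $N$ a monomial in the $Y_i(zd)$, $i\neq j$, the arrow gives $M'$ the coefficient $$\lambda_{M'}=\lambda_M\prod_s\frac{(1-q^{-2r_j}ab_s^{-1})(1-t^2ab_s^{-1})}{(1-ab_s^{-1})(1-q^{-2r_j}t^2ab_s^{-1})}\prod_u\frac{(1-ac_u^{-1})(1-q^{-2r_j}t^2ac_u^{-1})}{(1-q^{-2r_j}ac_u^{-1})(1-t^2ac_u^{-1})}.$$ The algorithm *works* if it never fails and after finitely many steps creates no new monomial; then $T(m)=\sum_M\lambda_M M$ over all created monomials. **Theorem.** Let $m$ be a dominant regular generic monomial. (a)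 Suppose that all monomials in the list after $n$ steps are regular and generic. Then for each monomial $M$ in this list, the denominators in the formula are nonzero for every $Y_j(za)$ admissible in $M$, and all paths of arrows from $m$ to $M$ give $M$ the same coefficient $\lambda_M$, which is a nonzero element of $K$. (b) If the algorithm works, then $T(m)\in\mathbf W_{q,t}(\mathfrak g)$, that is, it is a field that commutes with all the screening operators $S_i^\pm$; its unique dominant monomial is $m$, with coefficient $1$. -/

import Mathlib

noncomputable section

namespace DeformedW

open scoped Polynomial

/-! ### The base ring and the parameters -/

/-- The ring `K = ℂ⟦h, β⟧`, presented as power series in `h` over `ℂ⟦β⟧`. -/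
abbrev K : Type := PowerSeries (PowerSeries ℂ)

/-- The field of fractions of `K`. All operators act on Fock spaces over this field, in which the
denominators of the screening currents are invertible. -/
abbrev F : Type := FractionRing K

/-- `q^ξ = exp (h ξ)` for `ξ ∈ ℂ⟦β⟧`; in particular `t^γ = q^(β γ)`. -/
def qpow (ξ : PowerSeries ℂ) : K :=
  PowerSeries.rescale ξ (PowerSeries.exp (PowerSeries ℂ))

/-- The group `ℂˣ q^ℤ t^ℤ` of spectral parameters; `(c, k, l)` stands for `c q^k t^l`. -/
abbrev Spec : Type := ℂˣ × Multiplicative ℤ × Multiplicative ℤ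

/-- The spectral parameter `q^k t^l`. -/
def qt (k l : ℤ) : Spec := (1, Multiplicative.ofAdd k, Multiplicative.ofAdd l)

/-- The element `c q^k t^l = c exp (h (k + l β))` of `K`. -/
def val (a : Spec) : K :=
  PowerSeries.C (PowerSeries.C (a.1 : ℂ)) *
    qpow (PowerSeries.C ((Multiplicative.toAdd a.2.1 : ℤ) : ℂ) +
      PowerSeries.C ((Multiplicative.toAdd a.2.2 : ℤ) : ℂ) * PowerSeries.X)

/-- Distinct triples are distinct elements of `K`. -/
theorem val_injective : Function.Injective val := by
  rintro ⟨c, k, l⟩ ⟨c', k', l'⟩ h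
  have h0 := congrArg (PowerSeries.coeff 0) h
  have h1 := congrArg (PowerSeries.coeff 1) h
  simp only [val, qpow, PowerSeries.coeff_C_mul, PowerSeries.coeff_rescale,
    PowerSeries.coeff_exp] at h0 h1
  have hc : (c : ℂ) = c' := by
    have := congrArg (PowerSeries.coeff 0) h0
    simpa using this
  rw [← hc] at h1
  have e0 := congrArg (PowerSeries.coeff 0) h1
  have e1 := congrArg (PowerSeries.coeff 1) h1
  simp only [pow_one, Nat.factorial_one, Nat.cast_one, div_one, map_one, mul_one,
    PowerSeries.coeff_C_mul, map_add, PowerSeries.coeff_C, PowerSeries.coeff_X] at e0 e1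
  have hcc : (c : ℂ) ≠ 0 := c.ne_zero
  have hk : k = k' := by simpa [hcc] using e0
  have hl : l = l' := by simpa [hcc] using e1
  rw [Units.ext hc, hk, hl]

/-- The element `q^k t^l` of the field of fractions. -/
def Q (k l : ℤ) : F := algebraMap K F (val (qt k l))

/-! ### Cartan data and deformed Cartan matrices -/

/-- A Cartan matrix `C` together with the integers `r_i`. -/
structure CartanData (I : Type*) where
  C : Matrix I I ℤ
  r : I → ℕ

section Lie

variable {L : Type*} [LieRing L] [LieAlgebra ℂ L] [FiniteDimensional ℂ L] [LieAlgebra.IsSimple ℂ L]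
  {H : LieSubalgebra ℂ L} [H.IsCartanSubalgebra]

/-- The squared length of a simple root, for the canonical invariant form (which is a multiple of
the normalized one). -/
def sqLength (b : (LieAlgebra.IsKilling.rootSystem H).Base) (i : b.support) : ℕ :=
  (((LieAlgebra.IsKilling.rootSystem H).posRootForm ℤ).rootLength i).toNat

/-- The Cartan data of a simple Lie algebra with chosen simple roots `α_i`. The Cartan matrix is
`C_ij = 2 (α_i, α_j) / (α_i, α_i)`. When the long roots have squared length `2` and `r` is the
lacing number, the short roots have squared length `2 / r`, so that `r_i = r (α_i, α_i) / 2` is the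
ratio of the squared length of `α_i` to the smallest squared length of a simple root. -/
def cartanData (b : (LieAlgebra.IsKilling.rootSystem H).Base) : CartanData b.support where
  C := b.cartanMatrix.transpose
  r i := sqLength b i / ⨅ j, sqLength b j

end Lie

variable {I : Type*} [Fintype I] [DecidableEq I] (g : CartanData I)

/-- The quantum integer `[n]_q` at `q = q^m`. -/
def qint (n m : ℤ) : F := (Q (m * n) 0 - Q (-(m * n)) 0) / (Q m 0 - Q (-m) 0)

/-- The deformed Cartan matrix `C(q^m, t^m)`. -/
def cartanQT (m : ℤ) : Matrix I I F := fun i j =>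
  (if i = j then Q (g.r i * m) (-m) + Q (-(g.r i * m)) m else 0) -
    qint ((if i = j then 2 else 0) - g.C i j) m

/-- The matrix `B(q^m, t^m) = D(q^m, t^m) C(q^m, t^m)`. -/
def symQT (m : ℤ) : Matrix I I F :=
  Matrix.diagonal (fun i => qint (g.r i) m) * cartanQT g m

/-! ### Fock representations -/

/-- The underlying space of each `π_μ`: polynomials in `x_i[-n]`, `n > 0`, the variable `(i, n)`
standing for `x_i[-n]`. -/
abbrev FockPoly (I : Type*) : Type _ := MvPolynomial (I × ℕ+) F

/-- The space `P = ℂ[β] ⊗ 𝔥^*`; the tuple `ν` stands for the weight `μ = ∑ ν_i r α_i`, so that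
`(μ, ω_j) = ν_j r_j`. -/
abbrev Weight (I : Type*) : Type _ := I → ℂ[X]

/-- The sum of the Fock representations `π_μ`, `μ ∈ P`. -/
abbrev Fock (I : Type*) : Type _ := Weight I →₀ FockPoly I

/-- The structure constant `n (t^n - t^(-n)) / (q^n - q^(-n)) B_ij(q^n, t^n)`. -/
def kappa (i j : I) (n : ℤ) : F :=
  (n : F) * ((Q 0 n - Q 0 (-n)) / (Q n 0 - Q (-n) 0)) * symQT g n i j

/-- The partial derivative with respect to a variable, as an operator. -/
def dOp {I : Type*} (p : I × ℕ+) : Module.End F (FockPoly I) := (MvPolynomial.pderiv p).toLinearMap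

/-- The action of the Heisenberg generator `x_i[n]` on each `π_μ`: multiplication by the variable
for `n < 0`, and for `n > 0` the derivation with
`[x_i[n], x_j[-n]] = n (t^n - t^(-n)) / (q^n - q^(-n)) B_ij(q^n, t^n)`. -/
def xOp (i : I) (n : ℤ) : Module.End F (FockPoly I) :=
  if hn : 0 < n then
    ∑ j, kappa g i j n • dOp (j, (⟨n.toNat, by omega⟩ : ℕ+))
  else if hn' : n < 0 then
    LinearMap.mulLeft F (MvPolynomial.X (i, (⟨(-n).toNat, by omega⟩ : ℕ+)))
  else 0

/-- The combination `∑ c_i x_i[n]`. -/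
def mode (c : I → F) (n : ℤ) : Module.End F (FockPoly I) := ∑ i, c i • xOp g i n

/-- The coefficients of `a_i[n] = (q^n - q^(-n)) / n x_i[n]` in the `x_j[n]`. -/
def aVec (i : I) (n : ℤ) : I → F := Pi.single i ((Q n 0 - Q (-n) 0) / (n : F))

/-- The coefficients of `y_i[n]` in the `x_j[n]`, where `a_j[n] = ∑_i C_ij(q^n, t^n) y_i[n]`. -/
def yVec (i : I) (n : ℤ) : I → F := ∑ j, (cartanQT g n)⁻¹ j i • aVec j n

/-- The coefficients of `s_i^+[n] = a_i[n] / (q^(n r_i) - q^(-n r_i))`. -/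
def sPlusVec (i : I) (n : ℤ) : I → F := (Q (n * g.r i) 0 - Q (-(n * g.r i)) 0)⁻¹ • aVec i n

/-- The coefficients of `s_i^-[n] = a_i[n] / (t^n - t^(-n))`. -/
def sMinusVec (i : I) (n : ℤ) : I → F := (Q 0 n - Q 0 (-n))⁻¹ • aVec i n

/-! ### Normally ordered exponentials -/

/-- The coefficient of degree `l` of `exp f = ∑ f^j / j!`, for `f` without constant term. -/
def expCoeff {A : Type*} [Ring A] [Algebra F A] (f : PowerSeries A) (l : ℕ) : A :=
  ∑ j ∈ Finset.range (l + 1), ((j.factorial : F))⁻¹ • PowerSeries.coeff l (f ^ j)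

/-- The coefficient of `z^p` in `exp (∑_{n < 0} (∑_i c_{n,i} x_i[n]) z^(-n))`. -/
def creation (c : ℤ → I → F) (p : ℕ) : Module.End F (FockPoly I) :=
  expCoeff (PowerSeries.mk fun n : ℕ => mode g (c (-n)) (-n)) p

/-- The coefficient of `z^(-l)` in `exp (∑_{n > 0} (∑_i c_{n,i} x_i[n]) z^(-n))`. -/
def annihilation (c : ℤ → I → F) (l : ℕ) : Module.End F (FockPoly I) :=
  expCoeff (PowerSeries.mk fun n : ℕ => mode g (c n) n) l

/-- Polynomials whose monomials have weight `< d`, the variable `x_i[-n]` having weight `n`. -/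
def lowWeight (I : Type*) (d : ℕ) : Submodule F (FockPoly I) where
  carrier := {f | ∀ s ∈ f.support, Finsupp.weight (fun p : I × ℕ+ => (p.2 : ℕ)) s < d}
  zero_mem' := by simp
  add_mem' := by
    classical
    intro f f' hf hf' s hs
    rcases Finset.mem_union.1 (MvPolynomial.support_add hs) with h | h
    exacts [hf s h, hf' s h]
  smul_mem' := fun c f hf s hs => hf s (MvPolynomial.support_smul hs)

theorem exists_mem_lowWeight {I : Type*} (f : FockPoly I) : ∃ d, f ∈ lowWeight I d :=
  ⟨f.support.sup (Finsupp.weight (fun p : I × ℕ+ => (p.2 : ℕ))) + 1, fun _ hs =>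
    Nat.lt_succ_of_le (Finset.le_sup (f := Finsupp.weight (fun p : I × ℕ+ => (p.2 : ℕ))) hs)⟩

theorem eq_zero_of_mem_lowWeight_zero {I : Type*} {f : FockPoly I} (hf : f ∈ lowWeight I 0) :
    f = 0 := by
  by_contra h
  obtain ⟨s, hs⟩ := MvPolynomial.support_nonempty.2 h
  exact Nat.not_lt_zero _ (hf s hs)

theorem pderiv_mem_lowWeight {I : Type*} {d : ℕ} {f : FockPoly I} (hf : f ∈ lowWeight I d)
    (p : I × ℕ+) : MvPolynomial.pderiv p f ∈ lowWeight I (d - (p.2 : ℕ)) := by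
  classical
  rw [f.as_sum, map_sum]
  refine Submodule.sum_mem _ fun s hs => ?_
  rw [MvPolynomial.pderiv_monomial]
  by_cases h0 : s p = 0
  · simp [h0]
  · intro u hu
    have hu' : u = s - Finsupp.single p 1 := by
      have := MvPolynomial.support_monomial_subset hu
      simpa using this
    have hle : Finsupp.single p 1 ≤ s := by
      rw [Finsupp.single_le_iff]; omega
    have hw : Finsupp.weight (fun p : I × ℕ+ => (p.2 : ℕ)) u + (p.2 : ℕ) =
        Finsupp.weight (fun p : I × ℕ+ => (p.2 : ℕ)) s := by
      conv_rhs => rw [← tsub_add_cancel_of_le hle, map_add]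
      rw [← hu']
      simp [Finsupp.weight_single]
    have := hf s hs
    omega

theorem mode_mem_lowWeight (c : I → F) (n d : ℕ) {f : FockPoly I} (hf : f ∈ lowWeight I d) :
    mode g c n f ∈ lowWeight I (d - n) := by
  rw [mode, LinearMap.sum_apply]
  refine Submodule.sum_mem _ fun i _ => ?_
  rw [LinearMap.smul_apply]
  refine Submodule.smul_mem _ _ ?_
  by_cases hn : 0 < (n : ℤ)
  · rw [xOp, dif_pos hn, LinearMap.sum_apply]
    refine Submodule.sum_mem _ fun j _ => ?_
    rw [LinearMap.smul_apply]
    refine Submodule.smul_mem _ _ ?_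
    exact pderiv_mem_lowWeight hf (j, (⟨(n : ℤ).toNat, by omega⟩ : ℕ+))
  · rw [xOp, dif_neg hn, dif_neg (by omega)]
    simp

theorem annihilation_mem_lowWeight (c : ℤ → I → F) (l d : ℕ) {f : FockPoly I}
    (hf : f ∈ lowWeight I d) : annihilation g c l f ∈ lowWeight I (d - l) := by
  have key : ∀ (j l d : ℕ) (f : FockPoly I), f ∈ lowWeight I d →
      PowerSeries.coeff l ((PowerSeries.mk fun n : ℕ => mode g (c n) n) ^ j) f ∈
        lowWeight I (d - l) := by
    intro j
    induction j with
    | zero =>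
      intro l d f hf
      rw [pow_zero, PowerSeries.coeff_one]
      split_ifs with h
      · subst h; simpa using hf
      · simp
    | succ j ih =>
      intro l d f hf
      rw [pow_succ, PowerSeries.coeff_mul, LinearMap.sum_apply]
      refine Submodule.sum_mem _ fun x hx => ?_
      have hx' : x.1 + x.2 = l := Finset.HasAntidiagonal.mem_antidiagonal.1 hx
      rw [PowerSeries.coeff_mk, Module.End.mul_apply]
      have := ih x.1 _ _ (mode_mem_lowWeight g (c x.2) x.2 d hf)
      rwa [show d - l = d - x.2 - x.1 by omega]
  simp only [annihilation, expCoeff, LinearMap.sum_apply, LinearMap.smul_apply]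
  exact Submodule.sum_mem _ fun j _ => Submodule.smul_mem _ _ (key j l d f hf)

theorem finite_support_annihilation (c : ℤ → I → F) (k : ℤ) (f : FockPoly I) :
    (Function.support fun l : ℕ =>
      if 0 ≤ k + l then creation g c (k + l).toNat (annihilation g c l f) else 0).Finite := by
  obtain ⟨d, hd⟩ := exists_mem_lowWeight f
  refine (Set.finite_lt_nat d).subset fun l hl => ?_
  by_contra hld
  have hld' : d ≤ l := by simpa using hld
  apply hl
  have := annihilation_mem_lowWeight g c l d hd
  rw [Nat.sub_eq_zero_of_le hld'] at this
  simp [eq_zero_of_mem_lowWeight_zero this]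

/-- The coefficient of `z^k` in the normally ordered exponential
`:exp (∑_{n ≠ 0} (∑_i c_{n,i} x_i[n]) z^(-n)):`, that is, in
`exp (∑_{n < 0} (∑_i c_{n,i} x_i[n]) z^(-n)) exp (∑_{n > 0} (∑_i c_{n,i} x_i[n]) z^(-n))`. -/
def vertexCoeff (c : ℤ → I → F) (k : ℤ) : Module.End F (FockPoly I) where
  toFun f := ∑ᶠ l : ℕ,
    if 0 ≤ k + l then creation g c (k + l).toNat (annihilation g c l f) else 0
  map_add' f f' := by
    rw [← finsum_add_distrib (finite_support_annihilation g c k f)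
      (finite_support_annihilation g c k f')]
    refine finsum_congr fun l => ?_
    split_ifs <;> simp
  map_smul' a f := by
    rw [RingHom.id_apply, smul_finsum' a (finite_support_annihilation g c k f)]
    refine finsum_congr fun l => ?_
    split_ifs <;> simp

/-! ### Monomials in the `Y_i(za)` and their fields -/

/-- Monomials in the `Y_i(za)^{±1}` for the normally ordered product; `M (i, a)` is the degree
`d_{i,a}(M)` of `M` in `Y_i(za)`, and the normally ordered product is `+`. -/
abbrev Mono (I : Type*) : Type _ := (I × Spec) →₀ ℤ

/-- Formal series `∑_k Φ_k z^k` in `z^{±1}` with operator coefficients. -/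
abbrev Series (I : Type*) : Type _ := ℤ → Module.End F (Fock I)

/-- `(ρ^∨, ω_i)`, from `(ρ^∨, α_k) = 1` and `ω_i = ∑_k (C⁻¹)_{ki} α_k`. -/
def rhoCheckOmega (i : I) : ℂ := ∑ k, (g.C.map (Int.cast : ℤ → ℂ))⁻¹ k i

/-- `r (ρ, ω_i)`, from `r (ρ, α_k) = r_k` and `ω_i = ∑_k (C⁻¹)_{ki} α_k`. -/
def rhoOmega (i : I) : ℂ := ∑ k, (g.C.map (Int.cast : ℤ → ℂ))⁻¹ k i * g.r k

/-- The exponent of `q` by which the factor `t^(2(ρ^∨,ω_i)) q^(-2r(ρ,ω_i) + 2 y_i[0])` of `Y_i(z)`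
acts on `π_μ`. -/
def zeroMode (i : I) (ν : Weight I) : ℂ[X] :=
  Polynomial.C (2 * rhoCheckOmega g i) * Polynomial.X - Polynomial.C (2 * rhoOmega g i) +
    2 * (ν i * (g.r i : ℂ[X]))

/-- The field `:∏ Y_i(za)^{M(i,a)}:`, where
`Y_i(z) = t^(2(ρ^∨,ω_i)) q^(-2r(ρ,ω_i) + 2 y_i[0]) exp (∑_{n ≠ 0} y_i[n] z^(-n))`. -/
def monoField (M : Mono I) : Series I := fun k =>
  Finsupp.lsum F fun ν : Weight I =>
    Finsupp.lsingle ν ∘ₗ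
      (algebraMap K F (qpow ((M.sum fun p e => e • zeroMode g p.1 ν : ℂ[X]) : PowerSeries ℂ)) •
        vertexCoeff g (fun n => M.sum fun p e =>
          ((e : F) * algebraMap K F (val (p.2 ^ (-n)))) • yVec g p.1 n) k)

/-- The field with a given expansion in the monomials. -/
def realize (T : Mono I →₀ K) : Series I := T.sum fun M c => c • monoField g M

/-- Fields: only finitely many negative powers of `z` contribute on each vector. -/
def IsField (Φ : Series I) : Prop := ∀ x : Fock I, ∃ N : ℤ, ∀ n ≤ N, Φ n x = 0

/-- The space `𝐇_{q,t}(𝔤)` spanned over `K` by the monomials in the `Y_i(za)^{±1}`. -/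
def chiralSpace : Submodule K (Series I) := Submodule.span K (Set.range (monoField g))

/-! ### Screening operators and the deformed W-algebra -/

/-- The screening operator `S_i^+`, the coefficient of `w^(-1)` in
`e^(-Q_i / r_i) :exp (∑_{n ≠ 0} s_i^+[n] w^(-n)):`, where `e^(γ Q_i) v_μ = v_{μ + γ β r α_i}`. -/
def screenPlus (i : I) : Module.End F (Fock I) :=
  Finsupp.lsum F fun ν : Weight I =>
    Finsupp.lsingle (ν + Pi.single i (Polynomial.C (-(g.r i : ℂ)⁻¹) * Polynomial.X)) ∘ₗ
      vertexCoeff g (sPlusVec g i) (-1)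

/-- The screening operator `S_i^-`, the coefficient of `w^(-1)` in
`e^(Q_i / β) :exp (-∑_{n ≠ 0} s_i^-[n] w^(-n)):`, where `e^(γ Q_i) v_μ = v_{μ + γ β r α_i}`. -/
def screenMinus (i : I) : Module.End F (Fock I) :=
  Finsupp.lsum F fun ν : Weight I =>
    Finsupp.lsingle (ν + Pi.single i 1) ∘ₗ vertexCoeff g (fun n => -sMinusVec i n) (-1)

/-- `Φ` commutes with the operator `S`, regarded as a map out of `π_0`. -/
def CommutesWith (Φ : Series I) (S : Module.End F (Fock I)) : Prop :=
  ∀ (n : ℤ) (f : FockPoly I),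
    Φ n (S (Finsupp.single 0 f)) = S (Φ n (Finsupp.single 0 f))

/-- The deformed W-algebra `𝐖_{q,t}(𝔤)`: the fields in `𝐇_{q,t}(𝔤)` commuting with all the screening
operators `S_i^±`, regarded as maps out of `π_0`. -/
def WAlgebra : Submodule K (Series I) where
  carrier := {Φ | Φ ∈ chiralSpace g ∧ IsField Φ ∧
    ∀ i, CommutesWith Φ (screenPlus g i) ∧ CommutesWith Φ (screenMinus g i)}
  zero_mem' := ⟨Submodule.zero_mem _, fun _ => ⟨0, fun _ _ => rfl⟩,
    fun i => ⟨fun _ _ => by simp, fun _ _ => by simp⟩⟩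
  add_mem' := by
    rintro Φ Ψ ⟨h1, h2, h3⟩ ⟨k1, k2, k3⟩
    refine ⟨Submodule.add_mem _ h1 k1, fun x => ?_, fun i => ⟨fun n f => ?_, fun n f => ?_⟩⟩
    · obtain ⟨N, hN⟩ := h2 x
      obtain ⟨N', hN'⟩ := k2 x
      refine ⟨min N N', fun n hn => ?_⟩
      simp [hN n (by omega), hN' n (by omega)]
    · simp [(h3 i).1 n f, (k3 i).1 n f]
    · simp [(h3 i).2 n f, (k3 i).2 n f]
  smul_mem' := by
    rintro c Φ ⟨h1, h2, h3⟩
    refine ⟨Submodule.smul_mem _ _ h1, fun x => ?_, fun i => ⟨fun n f => ?_, fun n f => ?_⟩⟩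
    · obtain ⟨N, hN⟩ := h2 x
      exact ⟨N, fun n hn => by simp [hN n hn]⟩
    · simp only [Pi.smul_apply, LinearMap.smul_apply, (h3 i).1 n f, LinearMap.map_smul_of_tower]
    · simp only [Pi.smul_apply, LinearMap.smul_apply, (h3 i).2 n f, LinearMap.map_smul_of_tower]

/-! ### The algorithm -/

/-- The monomial `A_j(za)`: as `a_j[n] = ∑_i C_ij(q^n, t^n) y_i[n]`, it is
`:Y_j(za q^{r_j} t^{-1}) Y_j(za q^{-r_j} t) ∏_{i ≠ j} ∏_s Y_i(za q^{-C_ij - 1 - 2s})^{-1}:`,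
with `s` ranging over `0 ≤ s < -C_ij`. -/
def rootMono (j : I) (a : Spec) : Mono I :=
  Finsupp.single (j, a * qt (g.r j) (-1)) 1 + Finsupp.single (j, a * qt (-(g.r j)) 1) 1 -
    ∑ i ∈ Finset.univ.erase j, ∑ s ∈ Finset.range (-g.C i j).toNat,
      Finsupp.single (i, a * qt (-g.C i j - 1 - 2 * s) 0) 1

/-- Dominant monomials. -/
def Dominant {I : Type*} (M : Mono I) : Prop := ∀ i a, 0 ≤ M (i, a)

/-- Generic monomials. -/
def Generic {I : Type*} (M : Mono I) : Prop := ∀ i a, M (i, a) = -1 ∨ M (i, a) = 0 ∨ M (i, a) = 1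

/-- Regular monomials. -/
def Regular {I : Type*} (g : CartanData I) (M : Mono I) : Prop := ∀ i a,
  (0 < M (i, a) → 0 ≤ M (i, a * qt (-2 * g.r i) 0) ∧ 0 ≤ M (i, a * qt 0 2)) ∧
  (0 < M (i, a) → 0 < M (i, a * qt (-2 * g.r i) 2) →
    0 < M (i, a * qt (-2 * g.r i) 0) ∧ 0 < M (i, a * qt 0 2)) ∧
  (M (i, a) < 0 → M (i, a * qt (-2 * g.r i) 2) < 0 →
    M (i, a * qt (-2 * g.r i) 0) < 0 ∧ M (i, a * qt 0 2) < 0)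

/-- `Y_j(za)` is admissible in `M`. -/
def Admissible {I : Type*} (g : CartanData I) (M : Mono I) (j : I) (a : Spec) : Prop :=
  0 < M (j, a) ∧ M (j, a * qt (-2 * g.r j) 0) = 0 ∧ M (j, a * qt 0 2) = 0

/-- The monomial `:M A_j(za q^{-r_j} t)^{-1}:`. -/
def expand (M : Mono I) (j : I) (a : Spec) : Mono I := M - rootMono g j (a * qt (-(g.r j)) 1)

/-- `(1 - q^{-2r} x) (1 - t^2 x)`. -/
def blockNum (r : ℕ) (x : Spec) : K := (1 - val (qt (-2 * r) 0 * x)) * (1 - val (qt 0 2 * x))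

/-- `(1 - x) (1 - q^{-2r} t^2 x)`. -/
def blockDen (r : ℕ) (x : Spec) : K := (1 - val x) * (1 - val (qt (-2 * r) 2 * x))

open scoped Classical in
/-- For `M = Y_j(za) Y_j(zb_1) ⋯ Y_j(zb_k) Y_j(zc_1)^{-1} ⋯ Y_j(zc_l)^{-1} N`, with `N` a monomial in
the `Y_i(zd)`, `i ≠ j`, the numerator
`∏_s (1 - q^{-2r_j} a/b_s)(1 - t^2 a/b_s) ∏_u (1 - a/c_u)(1 - q^{-2r_j} t^2 a/c_u)`. -/
def stepNum {I : Type*} (g : CartanData I) (M : Mono I) (j : I) (a : Spec) : K :=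
  (∏ p ∈ M.support with p.1 = j ∧ p.2 ≠ a ∧ 0 < M p, blockNum (g.r j) (a / p.2)) *
    ∏ p ∈ M.support with p.1 = j ∧ M p < 0, blockDen (g.r j) (a / p.2)

open scoped Classical in
/-- The corresponding denominator
`∏_s (1 - a/b_s)(1 - q^{-2r_j} t^2 a/b_s) ∏_u (1 - q^{-2r_j} a/c_u)(1 - t^2 a/c_u)`. -/
def stepDen {I : Type*} (g : CartanData I) (M : Mono I) (j : I) (a : Spec) : K :=
  (∏ p ∈ M.support with p.1 = j ∧ p.2 ≠ a ∧ 0 < M p, blockDen (g.r j) (a / p.2)) *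
    ∏ p ∈ M.support with p.1 = j ∧ M p < 0, blockNum (g.r j) (a / p.2)

/-- The monomials on the list after `n` steps of the algorithm started at `m`. -/
def created (m : Mono I) : ℕ → Set (Mono I)
  | 0 => {m}
  | n + 1 => created m n ∪
      {M' | ∃ M ∈ created m n, ∃ j a, Admissible g M j a ∧ M' = expand g M j a}

/-- The algorithm started at `m` has not failed at its list after `n` steps. -/
def NotFailed (m : Mono I) (n : ℕ) : Prop := ∀ M ∈ created g m n, Regular g M ∧ Generic M

/-- The algorithm works: it never fails and after finitely many steps creates nothing new. -/
def Works (m : Mono I) : Prop :=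
  (∀ n, NotFailed g m n) ∧ ∃ n, created g m (n + 1) = created g m n

/-- `IsPathCoeff g m M c`: along some path from `m` to `M`, where the edges lead from `M₁` to
`:M₁ A_j(za q^{-r_j} t)^{-1}:` with `Y_j(za)` admissible in `M₁`, the recursion starting with the
coefficient `1` of `m` gives `M` the coefficient `c`. -/
inductive IsPathCoeff (m : Mono I) : Mono I → F → Prop
  | start : IsPathCoeff m m 1
  | step {M : Mono I} {c : F} {j : I} {a : Spec} :
      IsPathCoeff m M c → Admissible g M j a →
        IsPathCoeff m (expand g M j a)
          (c * (algebraMap K F (stepNum g M j a) / algebraMap K F (stepDen g M j a)))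

open scoped Classical in
/-- The coefficient of `M` found by the algorithm (along any path giving a coefficient in `K`). -/
def algCoeff (m M : Mono I) : K :=
  if h : ∃ c : K, IsPathCoeff g m M (algebraMap K F c) then h.choose else 0

/-- The output `T(m)` of the algorithm, as a combination of monomials. -/
def algOutput (m : Mono I) : Mono I →₀ K :=
  ∑ᶠ M ∈ ⋃ n, created g m n, Finsupp.single M (algCoeff g m M)

end DeformedW

end

set_option linter.unusedSectionVars false

noncomputable section

namespace DeformedW

/-- The properties of the Cartan data of a simple Lie algebra that are used: `n = -C_ij` and
`n' = -C_ji` are `0`, or one of them is `1` and the other one is the ratio of `r_i` and `r_j`. -/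
structure CartanData.IsFinite {I : Type*} [Fintype I] [DecidableEq I] (g : CartanData I) :
    Prop where
  r_pos : ∀ i, 0 < g.r i
  diag : ∀ i, g.C i i = 2
  cases : ∀ i j, i ≠ j → (g.C i j = 0 ∧ g.C j i = 0) ∨
    (g.C i j = -1 ∧ g.C j i = -1 ∧ g.r i = g.r j) ∨
    (g.C i j = -1 ∧ g.C j i = -(g.r i : ℤ) ∧ g.r j = 1) ∨
    (g.C j i = -1 ∧ g.C i j = -(g.r j : ℤ) ∧ g.r i = 1)
  det_ne_zero : g.C.det ≠ 0

section Lie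

open LieAlgebra.IsKilling RootPairing

variable {L : Type*} [LieRing L] [LieAlgebra ℂ L] [FiniteDimensional ℂ L] [LieAlgebra.IsSimple ℂ L]
  {H : LieSubalgebra ℂ L} [H.IsCartanSubalgebra]

theorem rootLength_ratio (b : (rootSystem H).Base) (i j : b.support) :
    sqLength b i = sqLength b j ∨ sqLength b i = 2 * sqLength b j ∨
    sqLength b i = 3 * sqLength b j ∨ sqLength b j = 2 * sqLength b i ∨
    sqLength b j = 3 * sqLength b i := by
  have h := InvariantForm.apply_eq_or ((rootSystem H).posRootForm ℤ).toInvariantForm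
    (i : H.root) (j : H.root)
  simp only [RootPositiveForm.toInvariantForm_form, ← RootPositiveForm.algebraMap_rootLength] at h
  have hi := ((rootSystem H).posRootForm ℤ).rootLength_pos i
  have hj := ((rootSystem H).posRootForm ℤ).rootLength_pos j
  simp only [eq_intCast] at h
  norm_cast at h
  simp only [sqLength]
  omega

theorem sqLength_pos (b : (rootSystem H).Base) (i : b.support) : 0 < sqLength b i := by
  have hi := ((rootSystem H).posRootForm ℤ).rootLength_pos i
  simp only [sqLength]
  omega

theorem cartanMatrix_mul_sqLength (b : (rootSystem H).Base) (i j : b.support) :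
    b.cartanMatrix j i * (sqLength b i : ℤ) = b.cartanMatrix i j * (sqLength b j : ℤ) := by
  have h := ((rootSystem H).posRootForm ℤ).pairingIn_mul_eq_pairingIn_mul_swap
    (i : H.root) (j : H.root)
  have hi := ((rootSystem H).posRootForm ℤ).rootLength_pos i
  have hj := ((rootSystem H).posRootForm ℤ).rootLength_pos j
  simp only [sqLength, Int.toNat_of_nonneg hi.le, Int.toNat_of_nonneg hj.le]
  exact h

theorem cartanMatrix_pair (b : (rootSystem H).Base) {i j : b.support} (hij : i ≠ j) :
    (b.cartanMatrix i j, b.cartanMatrix j i) ∈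
      ({(0, 0), (-1, -1), (-1, -2), (-2, -1), (-1, -3), (-3, -1)} : Set (ℤ × ℤ)) := by
  have h1 := b.cartanMatrix_le_zero_of_ne i j hij
  have hne : (i : H.root) ≠ j := fun h => hij (Subtype.ext h)
  have hli := b.linearIndependent_pair_of_ne hij
  have h2 := (rootSystem H).pairingIn_pairingIn_mem_set_of_isCrystal_of_isRed' i j
    (fun h => hne ((rootSystem H).root.injective h)) (fun h => by
      have := LinearIndependent.pair_iff.1 hli 1 1 (by simp [h])
      simp at this)
  change (b.cartanMatrix i j, b.cartanMatrix j i) ∈ _ at h2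
  simp only [Set.mem_insert_iff, Set.mem_singleton_iff, Prod.mk.injEq] at h2 ⊢
  omega

theorem cartanData_isFinite (b : (rootSystem H).Base) [DecidableEq b.support] :
    (cartanData b).IsFinite := by
  have hdet : b.cartanMatrix.det ≠ 0 :=
    Matrix.nondegenerate_iff_det_ne_zero.1 b.cartanMatrix_nondegenerate
  have hr : ∀ i, ((cartanData b).r i = 1 ∨ (cartanData b).r i = 2 ∨ (cartanData b).r i = 3) ∧
      sqLength b i = (cartanData b).r i * ⨅ j, sqLength b j := by
    intro i
    have : Nonempty b.support := ⟨i⟩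
    obtain ⟨j0, hj0⟩ : ∃ j0, sqLength b j0 = ⨅ j, sqLength b j :=
      Nat.sInf_mem (Set.range_nonempty (sqLength b))
    have hle : sqLength b j0 ≤ sqLength b i := by
      rw [hj0]; exact ciInf_le (OrderBot.bddBelow _) i
    have hp := sqLength_pos b j0
    have hrat := rootLength_ratio b i j0
    simp only [cartanData, ← hj0]
    have : sqLength b i = 1 * sqLength b j0 ∨ sqLength b i = 2 * sqLength b j0 ∨
      sqLength b i = 3 * sqLength b j0 := by omega
    rcases this with h | h | h <;> rw [h, Nat.mul_div_cancel _ hp] <;> simp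
  have hpos : ∀ i : b.support, 0 < ⨅ j, sqLength b j := by
    intro i
    have h1 := (hr i).2
    have h2 := sqLength_pos b i
    by_contra h0
    have h0' : (⨅ j, sqLength b j) = 0 := by omega
    rw [h0', mul_zero] at h1
    omega
  refine ⟨fun i => ?_, fun i => b.cartanMatrix_apply_same i, fun i j hij => ?_, ?_⟩
  · have := (hr i).1
    omega
  · have h1 := cartanMatrix_mul_sqLength b i j
    rw [(hr i).2, (hr j).2] at h1
    have hl := hpos i
    have h2 : b.cartanMatrix j i * ((cartanData b).r i : ℤ) =
        b.cartanMatrix i j * ((cartanData b).r j : ℤ) := by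
      have h3 : ((⨅ j, sqLength b j : ℕ) : ℤ) ≠ 0 := by exact_mod_cast hl.ne'
      apply mul_right_cancel₀ h3
      push_cast at h1
      linarith
    have h3 := cartanMatrix_pair b hij
    have h4 := (hr i).1
    have h5 := (hr j).1
    change (b.cartanMatrix j i = 0 ∧ b.cartanMatrix i j = 0) ∨
      (b.cartanMatrix j i = -1 ∧ b.cartanMatrix i j = -1 ∧ _) ∨
      (b.cartanMatrix j i = -1 ∧ b.cartanMatrix i j = _ ∧ _) ∨
      (b.cartanMatrix i j = -1 ∧ b.cartanMatrix j i = _ ∧ _)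
    simp only [Set.mem_insert_iff, Set.mem_singleton_iff, Prod.mk.injEq] at h3
    rcases h3 with h | h | h | h | h | h <;> rw [h.1, h.2] at h2 ⊢ <;> omega
  · change b.cartanMatrix.transpose.det ≠ 0
    rw [Matrix.det_transpose]
    convert hdet

end Lie

end DeformedW

end

noncomputable section

namespace DeformedW

variable {I : Type*} [Fintype I] [DecidableEq I] (g : CartanData I)

theorem qt_mul (k l k' l' : ℤ) : qt k l * qt k' l' = qt (k + k') (l + l') := by
  simp [qt, ofAdd_add]

theorem qt_zero : qt 0 0 = 1 := rfl

theorem qt_zpow (k l n : ℤ) : qt k l ^ n = qt (n * k) (n * l) := by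
  have h : ∀ x : ℤ, Multiplicative.ofAdd x ^ n = Multiplicative.ofAdd (n * x) := fun x => by
    rw [← smul_eq_mul]; rfl
  exact Prod.ext (one_zpow n) (Prod.ext (h k) (h l))

theorem qt_inv (k l : ℤ) : (qt k l)⁻¹ = qt (-k) (-l) := by
  simp [qt]

theorem qt_inj {k l k' l' : ℤ} : qt k l = qt k' l' ↔ k = k' ∧ l = l' := by
  simp [qt]

theorem mul_qt_inj {a : Spec} {k l k' l' : ℤ} :
    a * qt k l = a * qt k' l' ↔ k = k' ∧ l = l' := by
  rw [mul_right_inj, qt_inj]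

/-- The monomial `A_j(za q^{-r_j} t)` dividing out which expands `Y_j(za)`. -/
def root (j : I) (a : Spec) : Mono I := rootMono g j (a * qt (-(g.r j)) 1)

theorem root_apply_same (j : I) (a x : Spec) :
    root g j a (j, x) = (if a = x then 1 else 0) +
      (if a * qt (-2 * g.r j) 2 = x then 1 else 0) := by
  rw [root, rootMono, Finsupp.sub_apply, Finsupp.add_apply, Finsupp.finsetSum_apply,
    Finset.sum_eq_zero, sub_zero, Finsupp.single_apply, Finsupp.single_apply]
  · have h1 : a * qt (-(g.r j)) 1 * qt (g.r j) (-1) = a := by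
      rw [mul_assoc, qt_mul, neg_add_cancel, show (1 : ℤ) + -1 = 0 by norm_num, qt_zero, mul_one]
    have h2 : a * qt (-(g.r j)) 1 * qt (-(g.r j)) 1 = a * qt (-2 * g.r j) 2 := by
      rw [mul_assoc, qt_mul]
      congr 2 <;> ring
    rw [h1, h2]
    simp only [Prod.mk.injEq, true_and]
  · intro i hi
    rw [Finsupp.finsetSum_apply]
    refine Finset.sum_eq_zero fun s _ => ?_
    rw [Finsupp.single_apply, if_neg]
    intro h
    exact (Finset.mem_erase.1 hi).1 (Prod.ext_iff.1 h).1

theorem root_apply_ne {i j : I} (hij : i ≠ j) (a x : Spec) :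
    root g j a (i, x) = -∑ s ∈ Finset.range (-g.C i j).toNat,
      if a * qt (-(g.r j) - g.C i j - 1 - 2 * s) 1 = x then 1 else 0 := by
  rw [root, rootMono, Finsupp.sub_apply, Finsupp.add_apply, Finsupp.finsetSum_apply,
    Finsupp.single_apply, Finsupp.single_apply, if_neg (fun h => hij (Prod.ext_iff.1 h).1.symm),
    if_neg (fun h => hij (Prod.ext_iff.1 h).1.symm), add_zero, zero_sub,
    Finset.sum_eq_single i]
  · rw [Finsupp.finsetSum_apply]
    congr 1
    refine Finset.sum_congr rfl fun s _ => ?_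
    rw [Finsupp.single_apply, mul_assoc, qt_mul]
    simp only [Prod.mk.injEq, true_and]
    congr 4
    ring
  · intro k _ hk
    rw [Finsupp.finsetSum_apply]
    refine Finset.sum_eq_zero fun s _ => ?_
    rw [Finsupp.single_apply, if_neg (fun h => hk (Prod.ext_iff.1 h).1)]
  · intro h
    exact absurd (Finset.mem_erase.2 ⟨hij, Finset.mem_univ _⟩) h

theorem exists_of_root_apply_ne_zero {i j : I} {a x : Spec} (h : root g j a (i, x) ≠ 0) :
    ∃ k l, x = a * qt k l := by
  by_cases hij : i = j
  · subst hij
    rw [root_apply_same] at h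
    by_cases h1 : a = x
    · exact ⟨0, 0, by rw [qt_zero, mul_one, h1]⟩
    · by_cases h2 : a * qt (-2 * g.r i) 2 = x
      · exact ⟨_, _, h2.symm⟩
      · exact absurd (by rw [if_neg h1, if_neg h2]; rfl) h
  · rw [root_apply_ne g hij] at h
    by_contra hx
    apply h
    rw [Finset.sum_eq_zero, neg_zero]
    intro s _
    rw [if_neg]
    intro h'
    exact hx ⟨_, _, h'.symm⟩

/-- The degree of `M` in `Y_i(zc q^k t^l)`. -/
def cell (c : Spec) (M : Mono I) (i : I) (k l : ℤ) : ℤ := M (i, c * qt k l)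

variable (c : Spec) (M : Mono I)

theorem cell_root_same (j : I) (k0 l0 k l : ℤ) :
    cell c (root g j (c * qt k0 l0)) j k l = (if k = k0 ∧ l = l0 then 1 else 0) +
      (if k = k0 - 2 * g.r j ∧ l = l0 + 2 then 1 else 0) := by
  rw [cell, root_apply_same]
  simp only [mul_assoc, qt_mul, mul_qt_inj]
  split_ifs <;> omega

theorem cell_root_ne {i j : I} (hij : i ≠ j) (k0 l0 k l : ℤ) :
    cell c (root g j (c * qt k0 l0)) i k l =
      -(if l = l0 + 1 ∧ g.r j + 1 + g.C i j ≤ k0 - k ∧ k0 - k ≤ g.r j - 1 - g.C i j ∧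
        (k0 - k - g.r j - 1 - g.C i j) % 2 = 0 then 1 else 0) := by
  rw [cell, root_apply_ne g hij, neg_inj]
  simp only [mul_assoc, qt_mul, mul_qt_inj]
  split_ifs with h
  · rw [Finset.sum_eq_single ((k0 - k - g.r j - 1 - g.C i j) / 2).toNat]
    · rw [if_pos]; omega
    · intro s _ hs
      rw [if_neg]; omega
    · intro h'
      rw [Finset.mem_range] at h'
      omega
  · refine Finset.sum_eq_zero fun s hs => ?_
    rw [Finset.mem_range] at hs
    rw [if_neg]; omega

theorem cell_add_same (j : I) (k0 l0 k l : ℤ) :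
    cell c (M + root g j (c * qt k0 l0)) j k l = cell c M j k l +
      ((if k = k0 ∧ l = l0 then 1 else 0) +
      (if k = k0 - 2 * g.r j ∧ l = l0 + 2 then 1 else 0)) := by
  rw [← cell_root_same]; rfl

theorem cell_sub_same (j : I) (k0 l0 k l : ℤ) :
    cell c (M - root g j (c * qt k0 l0)) j k l = cell c M j k l -
      ((if k = k0 ∧ l = l0 then 1 else 0) +
      (if k = k0 - 2 * g.r j ∧ l = l0 + 2 then 1 else 0)) := by
  rw [← cell_root_same]; rfl

theorem cell_add_ne {i j : I} (hij : i ≠ j) (k0 l0 k l : ℤ) :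
    cell c (M + root g j (c * qt k0 l0)) i k l = cell c M i k l -
      (if l = l0 + 1 ∧ g.r j + 1 + g.C i j ≤ k0 - k ∧ k0 - k ≤ g.r j - 1 - g.C i j ∧
        (k0 - k - g.r j - 1 - g.C i j) % 2 = 0 then 1 else 0) := by
  rw [sub_eq_add_neg, ← cell_root_ne g c hij]; rfl

theorem cell_sub_ne {i j : I} (hij : i ≠ j) (k0 l0 k l : ℤ) :
    cell c (M - root g j (c * qt k0 l0)) i k l = cell c M i k l +
      (if l = l0 + 1 ∧ g.r j + 1 + g.C i j ≤ k0 - k ∧ k0 - k ≤ g.r j - 1 - g.C i j ∧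
        (k0 - k - g.r j - 1 - g.C i j) % 2 = 0 then 1 else 0) := by
  rw [← sub_neg_eq_add, ← cell_root_ne g c hij]; rfl

variable {g M} {i j : I} {k0 l0 k l : ℤ}

theorem cell_add_same_on (hr : 0 < g.r j)
    (h : k = k0 ∧ l = l0 ∨ k = k0 - 2 * g.r j ∧ l = l0 + 2) :
    cell c (M + root g j (c * qt k0 l0)) j k l = cell c M j k l + 1 := by
  rw [cell_add_same]; omega

theorem cell_add_same_off (h : ¬(k = k0 ∧ l = l0)) (h' : ¬(k = k0 - 2 * g.r j ∧ l = l0 + 2)) :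
    cell c (M + root g j (c * qt k0 l0)) j k l = cell c M j k l := by
  rw [cell_add_same, if_neg h, if_neg h']; ring

theorem cell_sub_same_on (hr : 0 < g.r j)
    (h : k = k0 ∧ l = l0 ∨ k = k0 - 2 * g.r j ∧ l = l0 + 2) :
    cell c (M - root g j (c * qt k0 l0)) j k l = cell c M j k l - 1 := by
  rw [cell_sub_same]; omega

theorem cell_sub_same_off (h : ¬(k = k0 ∧ l = l0)) (h' : ¬(k = k0 - 2 * g.r j ∧ l = l0 + 2)) :
    cell c (M - root g j (c * qt k0 l0)) j k l = cell c M j k l := by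
  rw [cell_sub_same, if_neg h, if_neg h']; ring

variable (g) in
/-- Expanding `Y_j(zc q^{k0} t^{l0})` raises the degree in `Y_i(zc q^k t^l)`. -/
def Hits (j i : I) (k0 l0 k l : ℤ) : Prop :=
  l = l0 + 1 ∧ g.r j + 1 + g.C i j ≤ k0 - k ∧ k0 - k ≤ g.r j - 1 - g.C i j ∧
    (k0 - k - g.r j - 1 - g.C i j) % 2 = 0

theorem cell_add_ne_on (hij : i ≠ j) (h : Hits g j i k0 l0 k l) :
    cell c (M + root g j (c * qt k0 l0)) i k l = cell c M i k l - 1 := by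
  unfold Hits at h
  rw [cell_add_ne g c M hij, if_pos h]

theorem cell_add_ne_off (hij : i ≠ j) (h : ¬Hits g j i k0 l0 k l) :
    cell c (M + root g j (c * qt k0 l0)) i k l = cell c M i k l := by
  unfold Hits at h
  rw [cell_add_ne g c M hij, if_neg h, sub_zero]

theorem cell_sub_ne_on (hij : i ≠ j) (h : Hits g j i k0 l0 k l) :
    cell c (M - root g j (c * qt k0 l0)) i k l = cell c M i k l + 1 := by
  unfold Hits at h
  rw [cell_sub_ne g c M hij, if_pos h]

theorem cell_sub_ne_off (hij : i ≠ j) (h : ¬Hits g j i k0 l0 k l) :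
    cell c (M - root g j (c * qt k0 l0)) i k l = cell c M i k l := by
  unfold Hits at h
  rw [cell_sub_ne g c M hij, if_neg h, add_zero]

theorem Generic.cell (h : Generic M) (i : I) (k l : ℤ) :
    -1 ≤ cell c M i k l ∧ cell c M i k l ≤ 1 := by
  have := h i (c * qt k l)
  simp only [DeformedW.cell]
  omega

theorem Regular.cell (h : Regular g M) (i : I) {k k' l l' : ℤ} (hk : k' = k - 2 * g.r i)
    (hl : l' = l + 2) :
    (0 < cell c M i k l → 0 ≤ cell c M i k' l ∧ 0 ≤ cell c M i k l') ∧
    (0 < cell c M i k l → 0 < cell c M i k' l' → 0 < cell c M i k' l ∧ 0 < cell c M i k l') ∧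
    (cell c M i k l < 0 → cell c M i k' l' < 0 → cell c M i k' l < 0 ∧ cell c M i k l' < 0) := by
  have := h i (c * qt k l)
  simp only [mul_assoc, qt_mul, add_zero] at this
  rwa [show k + -2 * (g.r i : ℤ) = k' by rw [hk]; ring, ← hl] at this

theorem admissible_iff {j : I} {k k' l l' : ℤ} (hk : k' = k - 2 * g.r j) (hl : l' = l + 2) :
    Admissible g M j (c * qt k l) ↔
      0 < cell c M j k l ∧ cell c M j k' l = 0 ∧ cell c M j k l' = 0 := by
  simp only [Admissible, mul_assoc, qt_mul, add_zero]
  rw [show k + -2 * (g.r j : ℤ) = k' by rw [hk]; ring, ← hl]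
  rfl

variable (g M) in
/-- The factor `Y_j(zc q^{-2r_j} t^2)^{-1}` of `M` can be undone, the reverse of admissibility. -/
def Reversible (j : I) (c : Spec) : Prop :=
  M (j, c * qt (-2 * g.r j) 2) = -1 ∧ M (j, c * qt 0 2) = 0 ∧ M (j, c * qt (-2 * g.r j) 0) = 0

theorem reversible_iff {j : I} {k k' l l' : ℤ} (hk : k' = k - 2 * g.r j) (hl : l' = l + 2) :
    Reversible g M j (c * qt k l) ↔
      cell c M j k' l' = -1 ∧ cell c M j k l' = 0 ∧ cell c M j k' l = 0 := by
  simp only [Reversible, mul_assoc, qt_mul, add_zero]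
  rw [show k + -2 * (g.r j : ℤ) = k' by rw [hk]; ring, ← hl]
  rfl

theorem exists_cell_eq_zero {i : I} (M : Mono I) (f : ℕ → ℤ × ℤ) (hf : Function.Injective f) :
    ∃ n, cell c M i (f n).1 (f n).2 = 0 := by
  have hinj : Function.Injective fun n => (i, c * qt (f n).1 (f n).2) := by
    intro a b hab
    have := (Prod.ext_iff.1 hab).2
    rw [mul_qt_inj] at this
    exact hf (Prod.ext this.1 this.2)
  obtain ⟨n, hn⟩ := Infinite.exists_notMem_finset (M.support.preimage _ hinj.injOn)
  rw [Finset.mem_preimage] at hn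
  exact ⟨n, Finsupp.notMem_support_iff.1 hn⟩

theorem row_end (hr : 0 < g.r j) (hM : Regular g M) (hM' : Generic M) {k l l' : ℤ}
    (hl : l' = l + 2) (h1 : cell c M j k l' = -1) (h2 : cell c M j k l = 0) :
    ∃ n : ℕ, Reversible g M j (c * qt (k + 2 * g.r j * (n + 1)) l) ∧
      ∀ i ≤ n, cell c M j (k + 2 * g.r j * i) l' = -1 ∧ cell c M j (k + 2 * g.r j * i) l = 0 := by
  classical
  have hex : ∃ n : ℕ, cell c M j (k + 2 * g.r j * n) l' ≠ -1 := by
    obtain ⟨n, hn⟩ := exists_cell_eq_zero (i := j) c M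
      (fun n : ℕ => (k + 2 * g.r j * n, l')) (by
        intro a b hab
        have h3 := (Prod.ext_iff.1 hab).1
        have h4 : (2 * (g.r j : ℤ)) ≠ 0 := by omega
        simp only [add_right_inj, mul_eq_mul_left_iff, h4, or_false] at h3
        exact_mod_cast h3)
    exact ⟨n, by simp only at hn; omega⟩
  have hfind := Nat.find_spec hex
  have hmin := fun {k} => Nat.find_min hex (m := k)
  set n := Nat.find hex with hn
  have hzero : ∀ i < n, cell c M j (k + 2 * g.r j * i) l = 0 := by
    intro i
    induction i with
    | zero => intro _; simpa using h2
    | succ i ih =>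
      intro hi
      have e1 := ih (by omega)
      have e2 := hmin hi
      have e3 := hmin (k := i) (by omega)
      have e4 := hM.cell c j (k := k + 2 * g.r j * (i + 1 : ℕ)) (k' := k + 2 * g.r j * i)
        (l := l) (by push_cast; ring) hl
      have e5 := hM'.cell c j (k + 2 * g.r j * (i + 1 : ℕ)) l
      omega
  have hn0 : n ≠ 0 := by
    intro h0
    rw [h0] at hfind
    simp [h1] at hfind
  obtain ⟨i, hi⟩ := Nat.exists_eq_succ_of_ne_zero hn0
  refine ⟨i, ?_, fun k hk => ⟨not_ne_iff.1 (hmin (by omega)), hzero k (by omega)⟩⟩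
  rw [reversible_iff c (k' := k + 2 * g.r j * i) (by ring) hl]
  have e1 := hmin (k := i) (by omega)
  have e2 := hzero i (by omega)
  have e3 := hM.cell c j (k := k + 2 * g.r j * (i + 1)) (k' := k + 2 * g.r j * i)
    (l := l') (by ring) rfl
  have e4 := hM'.cell c j (k + 2 * g.r j * (i + 1)) l'
  rw [hi] at hfind
  push_cast at hfind
  omega

theorem col_end (hM : Regular g M) (hM' : Generic M) {k k' l : ℤ}
    (hk : k' = k - 2 * g.r j) (h1 : cell c M j k' l = -1) (h2 : cell c M j k l = 0) :
    ∃ n : ℕ, Reversible g M j (c * qt k (l - 2 * (n + 1))) := by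
  classical
  have hex : ∃ n : ℕ, cell c M j k' (l - 2 * n) ≠ -1 := by
    obtain ⟨n, hn⟩ := exists_cell_eq_zero (i := j) c M
      (fun n : ℕ => (k', l - 2 * n)) (by
        intro a b hab
        have h3 := (Prod.ext_iff.1 hab).2
        simp only at h3
        omega)
    exact ⟨n, by simp only at hn; omega⟩
  have hfind := Nat.find_spec hex
  have hmin := fun {k} => Nat.find_min hex (m := k)
  set n := Nat.find hex with hn
  have hzero : ∀ i < n, cell c M j k (l - 2 * i) = 0 := by
    intro i
    induction i with
    | zero => intro _; simpa using h2
    | succ i ih =>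
      intro hi
      have e1 := ih (by omega)
      have e2 := hmin hi
      have e3 := hmin (k := i) (by omega)
      have e4 := hM.cell c j (l := l - 2 * (i + 1 : ℕ)) (l' := l - 2 * i)
        hk (by push_cast; ring)
      have e5 := hM'.cell c j k (l - 2 * (i + 1 : ℕ))
      omega
  have hn0 : n ≠ 0 := by
    intro h0
    rw [h0] at hfind
    simp [h1] at hfind
  obtain ⟨i, hi⟩ := Nat.exists_eq_succ_of_ne_zero hn0
  refine ⟨i, ?_⟩
  rw [reversible_iff c (l' := l - 2 * i) hk (by ring)]
  have e1 := hmin (k := i) (by omega)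
  have e2 := hzero i (by omega)
  have e3 := hM.cell c j (l := l - 2 * (i + 1)) (l' := l - 2 * i) (k := k')
    rfl (by ring)
  have e4 := hM'.cell c j k' (l - 2 * (i + 1))
  rw [hi] at hfind
  push_cast at hfind
  omega

variable (g) in
/-- `M` is obtained from `m` by `n` steps of the algorithm. -/
inductive Reach (m : Mono I) : ℕ → Mono I → Prop
  | start : Reach m 0 m
  | step {n : ℕ} {M : Mono I} {j : I} {a : Spec} :
      Reach m n M → Admissible g M j a → Reach m (n + 1) (M - root g j a)

theorem mem_created_iff {m : Mono I} {n : ℕ} :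
    M ∈ created g m n ↔ ∃ k ≤ n, Reach g m k M := by
  induction n generalizing M with
  | zero =>
    constructor
    · rintro rfl
      exact ⟨0, le_rfl, .start⟩
    · rintro ⟨k, hk, h⟩
      obtain rfl : k = 0 := by omega
      cases h
      rfl
  | succ n ih =>
    constructor
    · rintro (h | ⟨M', hM', j, a, hadm, rfl⟩)
      · obtain ⟨k, hk, h'⟩ := ih.1 h
        exact ⟨k, by omega, h'⟩
      · obtain ⟨k, hk, h'⟩ := ih.1 hM'
        exact ⟨k + 1, by omega, .step h' hadm⟩
    · rintro ⟨k, hk, h⟩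
      cases h with
      | start => exact .inl (ih.2 ⟨0, by omega, .start⟩)
      | step h' hadm => exact .inr ⟨_, ih.2 ⟨_, by omega, h'⟩, _, _, hadm, rfl⟩

end DeformedW

end

noncomputable section

namespace DeformedW

variable {I : Type*} [Fintype I] [DecidableEq I] {g : CartanData I}

variable (g) in
/-- All monomials created from `m` are regular and generic. -/
def NeverFails (m : Mono I) : Prop := ∀ n M, Reach g m n M → Regular g M ∧ Generic M

variable (g) in
/-- Reversible factors of the monomials at distance `n` from `m` come from a step. -/
def Contracts (m : Mono I) (n : ℕ) : Prop := ∀ M j c, Reach g m n M → Reversible g M j c →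
  ∃ n', n = n' + 1 ∧ Reach g m n' (M + root g j c)

variable {m P : Mono I} {c : Spec} {i j : I} {N : ℕ} {kv lv p : ℤ}

theorem Reversible.cell_eq_zero (hm : NeverFails g m) (hP : Reach g m N P) {k l : ℤ}
    (h : Reversible g P j (c * qt k l)) : cell c P j k l = 0 := by
  obtain ⟨hr, hg⟩ := hm _ _ hP
  have h1 := (reversible_iff c (k' := k - 2 * g.r j) (l' := l + 2) rfl rfl).1 h
  have h2 := hr.cell c j (k := k) (k' := k - 2 * g.r j) (l := l) (l' := l + 2) rfl rfl
  have h3 := hg.cell c j k l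
  by_contra h0
  have hadm : Admissible g P j (c * qt k l) := by
    rw [admissible_iff c (k' := k - 2 * g.r j) (l' := l + 2) rfl rfl]
    omega
  have h4 := (hm _ _ (hP.step hadm)).2.cell c j (k - 2 * g.r j) (l + 2)
  rw [cell_sub_same] at h4
  omega

/-- If some contraction of `P` commutes with both the step from `P` and the contraction looked
for, then the latter is available after the step. -/
theorem Reach.contract_of_commute {iw : I} {a w b : Spec} (hN : ∀ n ≤ N, Contracts g m n)
    (hP : Reach g m N P) (h1 : Reversible g P iw w) (h2 : Admissible g (P + root g iw w) i a)
    (h3 : Reversible g (P - root g i a + root g iw w) j b)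
    (h4 : Admissible g (P - root g i a + root g iw w + root g j b) iw w) :
    Reach g m N (P - root g i a + root g j b) := by
  obtain ⟨n, rfl, hn⟩ := hN N le_rfl _ _ _ hP h1
  have e1 := hn.step h2
  rw [add_sub_right_comm] at e1
  obtain ⟨k, hk, hk'⟩ := hN _ le_rfl _ _ _ e1 h3
  have e2 := hk'.step h4
  rwa [add_right_comm, add_sub_cancel_right, ← hk] at e2

theorem Admissible.add_root {k0 l0 : ℤ} (hij : i ≠ j)
    (hadm : Admissible g P i (c * qt kv lv)) (hr : Regular g (P + root g j (c * qt k0 l0)))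
    (hH : ¬Hits g j i k0 l0 kv lv) :
    Admissible g (P + root g j (c * qt k0 l0)) i (c * qt kv lv) := by
  have e1 := (hr.cell c i (k := kv) (l := lv) rfl rfl).1
  rw [admissible_iff c rfl rfl] at hadm ⊢
  rw [cell_add_ne_off c hij hH] at e1 ⊢
  by_cases hH1 : Hits g j i k0 l0 (kv - 2 * g.r i) lv
  · rw [cell_add_ne_on c hij hH1] at e1
    omega
  by_cases hH2 : Hits g j i k0 l0 kv (lv + 2)
  · rw [cell_add_ne_on c hij hH2] at e1
    omega
  rwa [cell_add_ne_off c hij hH1, cell_add_ne_off c hij hH2]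

theorem contract_of_lower (hg : g.IsFinite) (hm : NeverFails g m)
    (hN : ∀ n ≤ N, Contracts g m n) (hP : Reach g m N P) (hij : i ≠ j)
    (hadm : Admissible g P i (c * qt kv 1))
    (hrev : Reversible g (P - root g i (c * qt kv 1)) j (c * qt 0 0)) {l : ℤ} (hl : l ≤ -3)
    (hw : Reversible g P i (c * qt kv l)) :
    Reach g m N (P - root g i (c * qt kv 1) + root g j (c * qt 0 0)) := by
  have hri := hg.r_pos i
  obtain ⟨kp, hkp⟩ : ∃ kp, kp = kv - 2 * (g.r i : ℤ) := ⟨_, rfl⟩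
  have hw0 := hw.cell_eq_zero hm hP
  apply hP.contract_of_commute hN hw
  · rw [admissible_iff c hkp rfl] at hadm ⊢
    rwa [cell_add_same_off c (by omega) (by omega),
      cell_add_same_off c (by omega) (by omega), cell_add_same_off c (by omega) (by omega)]
  · rw [reversible_iff c rfl rfl] at hrev ⊢
    rwa [cell_add_ne_off c hij.symm (by simp only [Hits]; omega),
      cell_add_ne_off c hij.symm (by simp only [Hits]; omega),
      cell_add_ne_off c hij.symm (by simp only [Hits]; omega)]
  · rw [reversible_iff c hkp rfl] at hw
    rw [admissible_iff c hkp rfl, cell_add_ne_off c hij (by simp only [Hits]; omega),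
      cell_add_ne_off c hij (by simp only [Hits]; omega),
      cell_add_ne_off c hij (by simp only [Hits]; omega),
      cell_add_same_on c hri (by omega),
      cell_add_same_off c (by omega) (by omega), cell_add_same_off c (by omega) (by omega),
      cell_sub_same_off c (by omega) (by omega), cell_sub_same_off c (by omega) (by omega),
      cell_sub_same_off c (by omega) (by omega)]
    omega

theorem contract_of_disjoint (hg : g.IsFinite) (hm : NeverFails g m)
    (hN : ∀ n ≤ N, Contracts g m n) (hP : Reach g m N P) (hij : i ≠ j)
    (hadm : Admissible g P i (c * qt kv lv))
    (hrev : Reversible g (P - root g i (c * qt kv lv)) j (c * qt 0 0)) (hp : p = 0 - 2 * g.r j)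
    (h1 : ¬Hits g i j kv lv p 0) (h2 : ¬Hits g i j kv lv 0 2) :
    Reach g m N (P - root g i (c * qt kv lv) + root g j (c * qt 0 0)) := by
  obtain ⟨hr, hgen⟩ := hm _ _ hP
  have hri := hg.r_pos i
  have hrj := hg.r_pos j
  obtain ⟨kp, hkp⟩ : ∃ kp, kp = kv - 2 * (g.r i : ℤ) := ⟨_, rfl⟩
  have hadm' := (admissible_iff c hkp rfl).1 hadm
  have hv1 := hgen.cell c i kv lv
  have h3 : ¬Hits g i j kv lv p 2 := by
    intro h
    have e1 := hgen.cell c j p 2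
    rw [reversible_iff c hp rfl, zero_add, cell_sub_ne_on c hij.symm h] at hrev
    omega
  have hrevP : Reversible g P j (c * qt 0 0) := by
    rw [reversible_iff c hp rfl, zero_add] at hrev ⊢
    rwa [cell_sub_ne_off c hij.symm h3, cell_sub_ne_off c hij.symm h1,
      cell_sub_ne_off c hij.symm h2] at hrev
  have hrevP' := (reversible_iff c hp rfl).1 hrevP
  rw [zero_add] at hrevP'
  obtain ⟨n, rfl, hn⟩ := hN N le_rfl _ _ _ hP hrevP
  obtain ⟨hr1, hg1⟩ := hm _ _ hn
  by_cases hH : ¬Hits g j i 0 0 kv lv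
  · have := hn.step (hadm.add_root hij hr1 hH)
    rwa [add_sub_right_comm] at this
  rw [not_not] at hH
  have key : lv = 1 ∧ g.r i = 1 ∧ kv ≤ -1 ∧ 2 - 2 * (g.r j : ℤ) < kv ∧
      g.C j i = -1 ∧ g.C i j = -(g.r j : ℤ) ∧ (kv + 1) % 2 = 0 := by
    clear hadm' hv1 hrevP'
    simp only [Hits] at h3 hH
    rcases hg.cases j i hij.symm with h | h | h | h
    · omega
    · clear h1 h2; omega
    · clear h1 h2; omega
    · clear h1 h2; omega
  clear h1 h2 h3
  obtain ⟨rfl, hi1, hk1, hk2, hC1, hC2, hk3⟩ := key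
  have hc0 : cell c (P + root g j (c * qt 0 0)) i kv 1 = 0 := by
    rw [cell_add_ne_on c hij hH]; omega
  have hc1 : cell c (P + root g j (c * qt 0 0)) i kp 1 = -1 := by
    rw [cell_add_ne_on c hij (by simp only [Hits]; omega)]; omega
  have low : ∀ k l : ℤ, l ≠ 1 →
      cell c (P + root g j (c * qt 0 0)) i k l = cell c P i k l := fun k l hl => by
    rw [cell_add_ne_off c hij (by simp only [Hits]; omega)]
  obtain ⟨k, hk⟩ := col_end c hr1 hg1 hkp hc1 hc0
  rcases Nat.eq_zero_or_pos k with rfl | hk0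
  · exfalso
    simp only [Nat.cast_zero, zero_add, mul_one, Int.reduceSub] at hk
    obtain ⟨n', rfl, hn'⟩ := hN n (by omega) _ _ _ hn hk
    rw [reversible_iff c hkp (l' := 1) (by norm_num)] at hk
    have hadm2 : Admissible g (P + root g j (c * qt 0 0) + root g i (c * qt kv (-1))) j
        (c * qt 0 0) := by
      have e0 := hrevP.cell_eq_zero hm hP
      rw [admissible_iff c hp rfl, zero_add]
      rw [cell_add_ne_off c hij.symm (by simp only [Hits]; omega),
        cell_add_ne_off c hij.symm (by simp only [Hits]; omega),
        cell_add_ne_off c hij.symm (by simp only [Hits]; omega),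
        cell_add_same_on c hrj (by omega), cell_add_same_off c (by omega) (by omega),
        cell_add_same_off c (by omega) (by omega)]
      omega
    have hn2 := hn'.step hadm2
    have e4 := ((hm _ _ hn2).1.cell c i hkp (l := -1) (l' := 1) (by norm_num)).2.1
    have f1 := ((reversible_iff c hkp (l' := 1) (by norm_num)).2 hk).cell_eq_zero hm hn
    rw [cell_sub_ne_off c hij (by simp only [Hits]; omega),
      cell_sub_ne_on c hij (by simp only [Hits]; omega),
      cell_sub_ne_off c hij (by simp only [Hits]; omega), cell_add_same_on c hri (by omega),
      cell_add_same_on c hri (by omega), cell_add_same_off c (by omega) (by omega)] at e4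
    omega
  · rw [reversible_iff c hkp rfl] at hk
    rw [low _ _ (by omega), low _ _ (by omega), low _ _ (by omega)] at hk
    exact contract_of_lower hg hm hN hP hij hadm hrev (l := 1 - 2 * (k + 1)) (by omega)
      ((reversible_iff c hkp rfl).2 hk)

end DeformedW

end

noncomputable section

namespace DeformedW

variable {I : Type*} [Fintype I] [DecidableEq I] {g : CartanData I}

variable {m P : Mono I} {c : Spec} {i j : I} {N : ℕ} {kv lv p : ℤ}

theorem Reach.fill_row (hm : NeverFails g m) (hrj : g.r j = 1) (hij : i ≠ j)
    (hC : g.C i j = -1) (n : ℕ) :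
    ∀ {N : ℕ} {P : Mono I}, (∀ n ≤ N, Contracts g m n) → Reach g m N P →
      (∀ k : ℤ, 0 ≤ k → k ≤ n → cell c P j (2 * k - 2) 2 = -1 ∧ cell c P j (2 * k - 2) 0 = 0) →
      cell c P j (2 * n) 2 = 0 →
      ∃ N' P', N = N' + (n + 1) ∧ Reach g m N' P' ∧
        (∀ k : ℤ, 0 ≤ k → k ≤ n → cell c P' j (2 * k) 0 = 1 ∧ cell c P' j (2 * k) 2 = 0) ∧
        (∀ k : ℤ, 0 ≤ k → k ≤ n → cell c P' i (2 * k - 1) 1 = cell c P i (2 * k - 1) 1 - 1) ∧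
        (∀ k : ℤ, n < k → cell c P' j (2 * k) 0 = cell c P j (2 * k) 0 ∧
          cell c P' j (2 * k) 2 = cell c P j (2 * k) 2 ∧
          cell c P' i (2 * k - 1) 1 = cell c P i (2 * k - 1) 1) ∧
        ∀ k l : ℤ, l ≠ 1 → cell c P' i k l = cell c P i k l := by
  have hrj' : 0 < g.r j := by omega
  induction n with
  | zero =>
    intro N P hN hP h1 h2
    have hrev : Reversible g P j (c * qt 0 0) := by
      rw [reversible_iff c (k' := -2) (l' := 2) (by omega) (by omega)]
      have := h1 0 le_rfl le_rfl
      norm_num at this h2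
      omega
    obtain ⟨N', rfl, hN'⟩ := hN N le_rfl _ _ _ hP hrev
    have h0 := hrev.cell_eq_zero hm hP
    refine ⟨N', _, rfl, hN', fun k hk hk' => ?_, fun k hk hk' => ?_, fun k hk => ?_,
      fun k l hl => ?_⟩
    · obtain rfl : k = 0 := by push_cast at hk'; omega
      norm_num at h2 ⊢
      rw [cell_add_same_on c hrj' (by omega), cell_add_same_off c (by omega) (by omega)]
      omega
    · rw [cell_add_ne_on c hij (by simp only [Hits]; push_cast at hk'; omega)]
    · push_cast at hk
      rw [cell_add_same_off c (by omega) (by omega), cell_add_same_off c (by omega) (by omega),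
        cell_add_ne_off c hij (by simp only [Hits]; omega)]
      exact ⟨rfl, rfl, rfl⟩
    · rw [cell_add_ne_off c hij (by simp only [Hits]; omega)]
  | succ n ih =>
    intro N P hN hP h1 h2
    have hrev : Reversible g P j (c * qt (2 * (n + 1 : ℕ)) 0) := by
      rw [reversible_iff c (k' := 2 * (n + 1 : ℕ) - 2) (l' := 2) (by omega) (by omega)]
      have := h1 (n + 1 : ℕ) (by omega) le_rfl
      omega
    obtain ⟨N', rfl, hN'⟩ := hN N le_rfl _ _ _ hP hrev
    have h0 := hrev.cell_eq_zero hm hP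
    obtain ⟨N'', P', rfl, hP', f1, f2, f3, f4⟩ := ih (fun k hk => hN k (by omega)) hN'
      (fun k hk hk' => by
        rw [cell_add_same_off c (by omega) (by omega),
          cell_add_same_off c (by omega) (by omega)]
        exact h1 k hk (by push_cast; omega)) (by
        rw [cell_add_same_on c hrj' (by omega)]
        have := (h1 (n + 1 : ℕ) (by omega) le_rfl).1
        rw [show 2 * ((n + 1 : ℕ) : ℤ) - 2 = 2 * n by push_cast; ring] at this
        omega)
    refine ⟨N'', P', by ring, hP', fun k hk hk' => ?_, fun k hk hk' => ?_, fun k hk => ?_,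
      fun k l hl => ?_⟩
    · rcases lt_or_ge (n : ℤ) k with h | h
      · obtain rfl : k = (n + 1 : ℕ) := by omega
        rw [(f3 _ h).1, (f3 _ h).2.1, cell_add_same_on c hrj' (by omega),
          cell_add_same_off c (by omega) (by omega)]
        omega
      · exact f1 k hk h
    · rcases lt_or_ge (n : ℤ) k with h | h
      · obtain rfl : k = (n + 1 : ℕ) := by omega
        rw [(f3 _ h).2.2, cell_add_ne_on c hij (by simp only [Hits]; omega)]
      · rw [f2 k hk h, cell_add_ne_off c hij (by simp only [Hits]; omega)]
    · push_cast at hk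
      rw [(f3 k (by omega)).1, (f3 k (by omega)).2.1, (f3 k (by omega)).2.2,
        cell_add_same_off c (by omega) (by omega), cell_add_same_off c (by omega) (by omega),
        cell_add_ne_off c hij (by simp only [Hits]; omega)]
      exact ⟨rfl, rfl, rfl⟩
    · rw [f4 k l hl, cell_add_ne_off c hij (by simp only [Hits]; omega)]

theorem contract_of_hits_above (hg : g.IsFinite) (hm : NeverFails g m)
    (hN : ∀ n ≤ N, Contracts g m n) (hP : Reach g m N P) (hij : i ≠ j)
    (hadm : Admissible g P i (c * qt kv lv))
    (hrev : Reversible g (P - root g i (c * qt kv lv)) j (c * qt 0 0)) (hp : p = 0 - 2 * g.r j)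
    (h2 : Hits g i j kv lv 0 2) :
    Reach g m N (P - root g i (c * qt kv lv) + root g j (c * qt 0 0)) := by
  obtain ⟨hr, hgen⟩ := hm _ _ hP
  have hri := hg.r_pos i
  have hrj := hg.r_pos j
  obtain ⟨kp, hkp⟩ : ∃ kp, kp = kv - 2 * (g.r i : ℤ) := ⟨_, rfl⟩
  have hadm' := (admissible_iff c hkp rfl).1 hadm
  have hv1 := hgen.cell c i kv lv
  have hrev' := (reversible_iff c hp (l' := 2) (by norm_num)).1 hrev
  have h3 : ¬Hits g i j kv lv p 2 := by
    intro h
    have e1 := hgen.cell c j p 2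
    rw [cell_sub_ne_on c hij.symm h] at hrev'
    omega
  obtain rfl : lv = 1 := by have := h2.1; omega
  have hv3 : cell c P i kv 3 = 0 := hadm'.2.2
  have hM0 := hrev.cell_eq_zero hm (hP.step hadm)
  rw [cell_sub_ne_off c hij.symm (by simp only [Hits]; omega)] at hM0
  rw [cell_sub_ne_off c hij.symm h3, cell_sub_ne_on c hij.symm h2,
    cell_sub_ne_off c hij.symm (by simp only [Hits]; omega)] at hrev'
  obtain ⟨n, hw, hrun⟩ := row_end c hrj hr hgen (l' := 2) (by norm_num) (by omega) hM0
  obtain ⟨K, hK⟩ : ∃ K, K = 0 + 2 * (g.r j : ℤ) * (n + 1) := ⟨_, rfl⟩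
  rw [← hK] at hw
  have hK1 : g.r j = 1 → K = 2 * (n + 1) := fun h => by rw [hK, h]; ring
  have hK2 : n = 0 → K = 2 * g.r j := fun h => by rw [hK, h]; push_cast; ring
  have hK3 : n ≠ 0 → 4 * g.r j ≤ K := fun h => by
    have : 1 ≤ (n : ℤ) := by omega
    rw [hK]; nlinarith
  clear hK
  have hw0 := hw.cell_eq_zero hm hP
  obtain ⟨N', rfl, hP1⟩ := hN N le_rfl _ _ _ hP hw
  obtain ⟨hr1, hg1⟩ := hm _ _ hP1
  obtain ⟨Kp, hKp⟩ : ∃ Kp, Kp = K - 2 * (g.r j : ℤ) := ⟨_, rfl⟩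
  have hw' := (reversible_iff c hKp (l' := 2) (by norm_num)).1 hw
  -- the two shapes of the pair of colours
  have key : kv = g.r i - 1 - g.C j i ∧ ((g.C j i = -1 ∧ (g.C i j = -1 ∧ g.r i = g.r j ∨
      g.C i j = -(g.r j : ℤ) ∧ g.r i = 1)) ∨
      (g.C j i = -(g.r i : ℤ) ∧ g.C i j = -1 ∧ g.r j = 1 ∧ 2 ≤ g.r i)) := by
    clear hadm' hv1 hrev' hw' hM0 hw0 hK1 hK2 hK3
    simp only [Hits] at h2 h3
    rcases hg.cases j i hij.symm with h | h | h | h <;> omega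
  obtain ⟨hkv, key⟩ := key
  by_cases hb1 : Hits g i j kv 1 K 2
  · exfalso
    have hH : ¬Hits g j i K 0 kv 1 := by
      simp only [Hits] at hb1 ⊢
      omega
    have e1 := ((hm _ _ (hP1.step (hadm.add_root hij hr1 hH))).1.cell c j hKp
      (l := 0) (l' := 2) (by norm_num)).2.1
    rw [cell_sub_ne_off c hij.symm (by simp only [Hits]; omega),
      cell_sub_ne_on c hij.symm (by simp only [Hits] at hb1 ⊢; omega),
      cell_sub_ne_off c hij.symm (by simp only [Hits]; omega),
      cell_add_same_on c hrj (by omega), cell_add_same_on c hrj (by omega),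
      cell_add_same_off c (by omega) (by omega)] at e1
    omega
  by_cases hb2 : ¬Hits g j i K 0 kv 1
  · have hn0 : n ≠ 0 := by
      intro h0
      simp only [Hits] at hb1 hb2
      have := hK2 h0
      clear hK1 hK2 hK3 hw' hadm' hrev' hv1 hw0 hM0 h2 h3
      omega
    have hK4 := hK3 hn0
    clear hK1 hK2 hK3
    apply hP.contract_of_commute hN hw (hadm.add_root hij hr1 hb2)
    · rw [reversible_iff c hp (l' := 2) (by norm_num),
        cell_add_same_off c (by omega) (by omega), cell_add_same_off c (by omega) (by omega),
        cell_add_same_off c (by omega) (by omega), cell_sub_ne_off c hij.symm h3,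
        cell_sub_ne_on c hij.symm h2, cell_sub_ne_off c hij.symm (by simp only [Hits]; omega)]
      exact hrev'
    · rw [admissible_iff c hKp (l' := 2) (by norm_num),
        cell_add_same_off c (by omega) (by omega), cell_add_same_on c hrj (by omega),
        cell_add_same_off c (by omega) (by omega), cell_add_same_off c (by omega) (by omega),
        cell_add_same_off c (by omega) (by omega), cell_add_same_off c (by omega) (by omega),
        cell_sub_ne_off c hij.symm hb1, cell_sub_ne_off c hij.symm (by simp only [Hits]; omega),
        cell_sub_ne_off c hij.symm (by simp only [Hits]; omega)]
      omega
  rw [not_not] at hb2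
  rcases key with ⟨hC1, hC2⟩ | ⟨hC1, hC2, hj1, hi2⟩
  · have hn0 : n = 0 := by
      by_contra h0
      have := hK3 h0
      simp only [Hits] at hb2
      clear hK1 hK2 hK3 hw' hadm' hrev' hv1 hw0 hM0 h2 h3
      omega
    have hK4 := hK2 hn0
    clear hK1 hK2 hK3
    have hrev1 : Reversible g (P + root g j (c * qt K 0)) j (c * qt 0 0) := by
      rw [reversible_iff c hp (l' := 2) (by norm_num),
        cell_add_same_off c (by omega) (by omega), cell_add_same_on c hrj (by omega),
        cell_add_same_off c (by omega) (by omega)]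
      omega
    obtain ⟨N'', rfl, hP2⟩ := hN _ (by omega) _ _ _ hP1 hrev1
    obtain ⟨hr2, hg2⟩ := hm _ _ hP2
    have hH0 : ¬Hits g j i 0 0 kv 1 := by simp only [Hits]; omega
    have hH1 : Hits g j i 0 0 kp 1 := by simp only [Hits]; omega
    have hHK : ¬Hits g j i K 0 kp 1 := by simp only [Hits]; omega
    have low : ∀ k l : ℤ, l ≠ 1 → cell c (P + root g j (c * qt K 0) + root g j (c * qt 0 0)) i k l
        = cell c P i k l := fun k l hl => by
      rw [cell_add_ne_off c hij (by simp only [Hits]; omega),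
        cell_add_ne_off c hij (by simp only [Hits]; omega)]
    have f0 : cell c (P + root g j (c * qt K 0) + root g j (c * qt 0 0)) i kv 1 = 0 := by
      rw [cell_add_ne_off c hij hH0, cell_add_ne_on c hij hb2]
      omega
    have f1 : cell c (P + root g j (c * qt K 0) + root g j (c * qt 0 0)) i kp 1 = -1 := by
      rw [cell_add_ne_on c hij hH1, cell_add_ne_off c hij hHK]
      omega
    obtain ⟨k, hk⟩ := col_end c hr2 hg2 hkp f1 f0
    have hx0 := hk.cell_eq_zero hm hP2
    have hk' := (reversible_iff c hkp rfl).1 hk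
    rcases Nat.eq_zero_or_pos k with rfl | hk0
    · simp only [Nat.cast_zero, zero_add, mul_one, Int.reduceSub] at hk hx0
      obtain ⟨N3, rfl, hP3⟩ := hN _ (by omega) _ _ _ hP2 hk
      have hk' := (reversible_iff c hkp (l' := 1) (by norm_num)).1 hk
      have e1 := hP3.step (j := j) (a := c * qt K 0) (by
        rw [admissible_iff c hKp (l' := 2) (by norm_num),
          cell_add_ne_off c hij.symm (by simp only [Hits]; omega),
          cell_add_ne_on c hij.symm (by simp only [Hits]; omega),
          cell_add_ne_off c hij.symm (by simp only [Hits]; omega),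
          cell_add_same_off c (by omega) (by omega), cell_add_same_on c hrj (by omega),
          cell_add_same_on c hrj (by omega), cell_add_same_off c (by omega) (by omega),
          cell_add_same_off c (by omega) (by omega), cell_add_same_off c (by omega) (by omega),
          show Kp = 0 by omega]
        omega)
      have e2 := e1.step (j := i) (a := c * qt kv 1) (by
        rw [admissible_iff c hkp (l' := 3) (by norm_num), cell_sub_ne_on c hij hb2,
          cell_sub_ne_off c hij hHK, cell_sub_ne_off c hij (by simp only [Hits]; omega),
          cell_add_same_off c (by omega) (by omega), cell_add_same_on c hri (by omega),
          cell_add_same_off c (by omega) (by omega), low kv 3 (by omega)]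
        omega)
      have e3 := e2.step (j := i) (a := c * qt kv (-1)) (by
        rw [admissible_iff c hkp (l' := 1) (by norm_num),
          cell_sub_same_off c (by omega) (by omega), cell_sub_same_off c (by omega) (by omega),
          cell_sub_same_on c hri (by omega),
          cell_sub_ne_off c hij (by simp only [Hits]; omega),
          cell_sub_ne_off c hij (by simp only [Hits]; omega), cell_sub_ne_on c hij hb2,
          cell_add_same_on c hri (by omega), cell_add_same_off c (by omega) (by omega),
          cell_add_same_off c (by omega) (by omega)]
        omega)
      convert e3 using 1
      abel
    · rw [low _ _ (by omega), low _ _ (by omega), low _ _ (by omega)] at hk'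
      exact contract_of_lower hg hm hN hP hij hadm hrev (l := 1 - 2 * (k + 1)) (by omega)
        ((reversible_iff c hkp rfl).2 hk')
  · have hK4 := hK1 hj1
    clear hK1 hK2 hK3
    have hn : (g.r i : ℤ) = n + 1 := by
      simp only [Hits] at hb2
      omega
    obtain ⟨N2, P', hN2, hP', f1, f2, -, low⟩ := Reach.fill_row (c := c) (i := i) hm hj1 hij hC2 (n + 1) hN hP
      (fun k hk hk' => by
        rcases eq_or_lt_of_le hk with rfl | hk0
        · rw [show (2 * 0 - 2 : ℤ) = p by omega]
          omega
        · have := hrun (k - 1).toNat (by omega)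
          rwa [hj1, show (0 + 2 * ((1 : ℕ) : ℤ) * ((k - 1).toNat : ℤ)) = 2 * k - 2 by omega] at this)
      (by rw [show (2 * ((n + 1 : ℕ) : ℤ)) = K by omega]; omega)
    obtain ⟨hr1, hg1⟩ := hm _ _ hP'
    have g0 : cell c P' i kv 1 = 0 := by
      have := f2 (n + 1 : ℕ) (by omega) le_rfl
      rw [show 2 * ((n + 1 : ℕ) : ℤ) - 1 = kv by omega] at this
      omega
    have g1 : cell c P' i kp 1 = -1 := by
      have := f2 0 le_rfl (by omega)
      rw [show 2 * (0 : ℤ) - 1 = kp by omega] at this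
      omega
    obtain ⟨k, hk⟩ := col_end c hr1 hg1 hkp g1 g0
    rcases Nat.eq_zero_or_pos k with rfl | hk0
    · exfalso
      simp only [Nat.cast_zero, zero_add, mul_one, Int.reduceSub] at hk
      have hx0 := hk.cell_eq_zero hm hP'
      obtain ⟨N3, rfl, hP3⟩ := hN _ (by omega) _ _ _ hP' hk
      have hk' := (reversible_iff c hkp (l' := 1) (by norm_num)).1 hk
      have k1 := f1 (n + 1 : ℕ) (by omega) le_rfl
      have k2 := f1 n (by omega) (by omega)
      have k3 := f1 (n - 1) (by omega) (by omega)
      have v3 := low kv 3 (by omega)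
      rw [show 2 * ((n + 1 : ℕ) : ℤ) = K by omega] at k1
      obtain ⟨K1, hK1⟩ : ∃ K1, K1 = K - 2 := ⟨_, rfl⟩
      obtain ⟨K2, hK2⟩ : ∃ K2, K2 = K1 - 2 := ⟨_, rfl⟩
      rw [show 2 * (n : ℤ) = K1 by omega] at k2
      rw [show 2 * ((n : ℤ) - 1) = K2 by omega] at k3
      have e1 := hP3.step (j := j) (a := c * qt K 0) (by
        rw [admissible_iff c (k' := K1) (l' := 2) (by omega) (by norm_num),
          cell_add_ne_off c hij.symm (by simp only [Hits]; omega),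
          cell_add_ne_on c hij.symm (by simp only [Hits]; omega),
          cell_add_ne_off c hij.symm (by simp only [Hits]; omega)]
        omega)
      have e2 := e1.step (j := i) (a := c * qt kv 1) (by
        rw [admissible_iff c hkp (l' := 3) (by norm_num), cell_sub_ne_on c hij hb2,
          cell_sub_ne_off c hij (by simp only [Hits]; omega),
          cell_sub_ne_off c hij (by simp only [Hits]; omega),
          cell_add_same_off c (by omega) (by omega), cell_add_same_on c hri (by omega),
          cell_add_same_off c (by omega) (by omega)]
        omega)
      have e3 := e2.step (j := i) (a := c * qt kv (-1)) (by
        rw [admissible_iff c hkp (l' := 1) (by norm_num),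
          cell_sub_same_off c (by omega) (by omega), cell_sub_same_off c (by omega) (by omega),
          cell_sub_same_on c hri (by omega),
          cell_sub_ne_off c hij (by simp only [Hits]; omega),
          cell_sub_ne_off c hij (by simp only [Hits]; omega), cell_sub_ne_on c hij hb2,
          cell_add_same_on c hri (by omega), cell_add_same_off c (by omega) (by omega),
          cell_add_same_off c (by omega) (by omega)]
        omega)
      have e4 := ((hm _ _ e3).1.cell c j (k := K1) (k' := K2) (l := 0) (l' := 2) (by omega)
        (by norm_num)).2.1
      rw [cell_sub_ne_on c hij.symm (k := K1) (l := 0) (by simp only [Hits]; omega),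
        cell_sub_ne_off c hij.symm (k := K1) (l := 0) (by simp only [Hits]; omega),
        cell_sub_same_off c (k := K1) (l := 0) (by omega) (by omega),
        cell_add_ne_on c hij.symm (k := K1) (l := 0) (by simp only [Hits]; omega),
        cell_sub_ne_off c hij.symm (k := K2) (l := 2) (by simp only [Hits]; omega),
        cell_sub_ne_on c hij.symm (k := K2) (l := 2) (by simp only [Hits]; omega),
        cell_sub_same_off c (k := K2) (l := 2) (by omega) (by omega),
        cell_add_ne_off c hij.symm (k := K2) (l := 2) (by simp only [Hits]; omega),
        cell_sub_ne_off c hij.symm (k := K1) (l := 2) (by simp only [Hits]; omega),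
        cell_sub_ne_on c hij.symm (k := K1) (l := 2) (by simp only [Hits]; omega),
        cell_sub_same_on c hrj (k := K1) (l := 2) (by omega),
        cell_add_ne_off c hij.symm (k := K1) (l := 2) (by simp only [Hits]; omega)] at e4
      omega
    · rw [reversible_iff c hkp rfl] at hk
      rw [low _ _ (by omega), low _ _ (by omega), low _ _ (by omega)] at hk
      exact contract_of_lower hg hm hN hP hij hadm hrev (l := 1 - 2 * (k + 1)) (by omega)
        ((reversible_iff c hkp rfl).2 hk)

end DeformedW

end

noncomputable section

namespace DeformedW

variable {I : Type*} [Fintype I] [DecidableEq I] {g : CartanData I}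

variable {m P : Mono I} {c : Spec} {i j : I} {N : ℕ} {kv lv p : ℤ}

theorem contract_of_hits_right (hg : g.IsFinite) (hm : NeverFails g m)
    (hN : ∀ n ≤ N, Contracts g m n) (hP : Reach g m N P) (hij : i ≠ j)
    (hadm : Admissible g P i (c * qt kv lv))
    (hrev : Reversible g (P - root g i (c * qt kv lv)) j (c * qt 0 0)) (hp : p = 0 - 2 * g.r j)
    (h1 : Hits g i j kv lv p 0) :
    Reach g m N (P - root g i (c * qt kv lv) + root g j (c * qt 0 0)) := by
  obtain ⟨hr, hgen⟩ := hm _ _ hP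
  have hri := hg.r_pos i
  have hrj := hg.r_pos j
  obtain ⟨kp, hkp⟩ : ∃ kp, kp = kv - 2 * (g.r i : ℤ) := ⟨_, rfl⟩
  obtain rfl : lv = -1 := by have := h1.1; omega
  have hadm' := (admissible_iff c hkp (l' := 1) (by norm_num)).1 hadm
  have hv1 := hgen.cell c i kv (-1)
  have hrev' := (reversible_iff c hp (l' := 2) (by norm_num)).1 hrev
  have hM0 := hrev.cell_eq_zero hm (hP.step hadm)
  rw [cell_sub_ne_off c hij.symm (by simp only [Hits]; omega),
    cell_sub_ne_off c hij.symm (by simp only [Hits]; omega), cell_sub_ne_on c hij.symm h1] at hrev'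
  have h3 : ¬Hits g i j kv (-1) 0 0 := by
    intro h
    rw [cell_sub_ne_on c hij.symm h] at hM0
    have := (hr.cell c j hp (l := 0) (l' := 2) (by norm_num)).2.2
    omega
  rw [cell_sub_ne_off c hij.symm h3] at hM0
  have key : kv = p + g.r i + 1 + g.C j i ∧ ((g.C i j = -1 ∧ (g.C j i = -1 ∧ g.r i = g.r j ∨
      g.C j i = -(g.r i : ℤ) ∧ g.r j = 1)) ∨
      (g.C j i = -1 ∧ g.C i j = -(g.r j : ℤ) ∧ g.r i = 1 ∧ 2 ≤ g.r j)) := by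
    clear hadm' hv1 hrev' hM0
    simp only [Hits] at h1 h3
    rcases hg.cases j i hij.symm with h | h | h | h <;> omega
  obtain ⟨hkv, key⟩ := key
  have hH : Hits g j i 0 0 kv 1 := by
    clear hadm' hv1 hrev' hM0 h1 h3
    simp only [Hits]; omega
  obtain ⟨n, hw⟩ := col_end c hr hgen hp (by omega) hM0
  have hw0 := hw.cell_eq_zero hm hP
  rcases Nat.eq_zero_or_pos n with rfl | hn0
  swap
  · obtain ⟨l, hl⟩ : ∃ l : ℤ, l = 0 - 2 * (n + 1) := ⟨_, rfl⟩
    rw [← hl] at hw hw0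
    apply hP.contract_of_commute hN hw
    · rw [admissible_iff c hkp (l' := 1) (by norm_num),
        cell_add_ne_off c hij (by simp only [Hits]; omega),
        cell_add_ne_off c hij (by simp only [Hits]; omega),
        cell_add_ne_off c hij (by simp only [Hits]; omega)]
      exact hadm'
    · rw [reversible_iff c hp (l' := 2) (by norm_num)] at hrev ⊢
      rwa [cell_add_same_off c (by omega) (by omega), cell_add_same_off c (by omega) (by omega),
        cell_add_same_off c (by omega) (by omega)]
    · have hw' := (reversible_iff c hp rfl).1 hw
      rw [admissible_iff c hp rfl,
        cell_add_same_off c (by omega) (by omega), cell_add_same_on c hrj (by omega),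
        cell_add_same_off c (by omega) (by omega), cell_add_same_off c (by omega) (by omega),
        cell_add_same_off c (by omega) (by omega), cell_add_same_off c (by omega) (by omega),
        cell_sub_ne_off c hij.symm (by simp only [Hits]; omega),
        cell_sub_ne_off c hij.symm (by simp only [Hits]; omega),
        cell_sub_ne_off c hij.symm (by simp only [Hits]; omega)]
      omega
  simp only [Nat.cast_zero, zero_add, mul_one, zero_sub] at hw hw0
  obtain ⟨N1, hN1, hP1⟩ := hN N le_rfl _ _ _ hP hw
  have hw' := (reversible_iff c hp (l' := 0) (by norm_num)).1 hw
  obtain ⟨N2, hN2, hP2⟩ := hN N1 (by omega) _ j (c * qt 0 0) hP1 (by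
    rw [reversible_iff c hp (l' := 2) (by norm_num), cell_add_same_off c (by omega) (by omega),
      cell_add_same_off c (by omega) (by omega), cell_add_same_on c hrj (by omega)]
    omega)
  obtain ⟨hr2, hg2⟩ := hm _ _ hP2
  have v0 : cell c (P + root g j (c * qt 0 (-2)) + root g j (c * qt 0 0)) i kv (-1) = 0 := by
    rw [cell_add_ne_off c hij (by simp only [Hits]; omega),
      cell_add_ne_on c hij (by simp only [Hits] at hH ⊢; omega)]
    omega
  have v1 : cell c (P + root g j (c * qt 0 (-2)) + root g j (c * qt 0 0)) i kv 1 = -1 := by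
    rw [cell_add_ne_on c hij hH, cell_add_ne_off c hij (by simp only [Hits]; omega)]
    omega
  have j1 : cell c (P + root g j (c * qt 0 (-2)) + root g j (c * qt 0 0)) j 0 (-2) = 1 := by
    rw [cell_add_same_off c (by omega) (by omega), cell_add_same_on c hrj (by omega)]
    omega
  have j2 : cell c (P + root g j (c * qt 0 (-2)) + root g j (c * qt 0 0)) j p (-2) = 0 := by
    rw [cell_add_same_off c (by omega) (by omega), cell_add_same_off c (by omega) (by omega)]
    omega
  have j3 : cell c (P + root g j (c * qt 0 (-2)) + root g j (c * qt 0 0)) j 0 0 = 1 := by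
    rw [cell_add_same_on c hrj (by omega), cell_add_same_off c (by omega) (by omega)]
    omega
  have j4 : cell c (P + root g j (c * qt 0 (-2)) + root g j (c * qt 0 0)) j p 0 = 0 := by
    rw [cell_add_same_off c (by omega) (by omega), cell_add_same_on c hrj (by omega)]
    omega
  have j5 : cell c (P + root g j (c * qt 0 (-2)) + root g j (c * qt 0 0)) j 0 2 = 0 := by
    rw [cell_add_same_off c (by omega) (by omega), cell_add_same_off c (by omega) (by omega)]
    omega
  obtain ⟨n, hx, hrun⟩ := row_end c hri hr2 hg2 (l' := 1) (by norm_num) v1 v0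
  obtain ⟨W, hW⟩ : ∃ W, W = kv + 2 * (g.r i : ℤ) * (n + 1) := ⟨_, rfl⟩
  rw [← hW] at hx
  have hW1 : g.r i = 1 → W = kv + 2 * (n + 1) := fun h => by rw [hW, h]; ring
  have hW2 : n = 0 → W = kv + 2 * g.r i := fun h => by rw [hW, h]; push_cast; ring
  have hW3 : n ≠ 0 → kv + 4 * g.r i ≤ W := fun h => by
    have : 1 ≤ (n : ℤ) := by omega
    rw [hW]; nlinarith
  clear hW
  have hx0 := hx.cell_eq_zero hm hP2
  obtain ⟨N3, hN3, hP3⟩ := hN _ (by omega) _ _ _ hP2 hx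
  obtain ⟨Wp, hWp⟩ : ∃ Wp, Wp = W - 2 * (g.r i : ℤ) := ⟨_, rfl⟩
  have hx' := (reversible_iff c hWp (l' := 1) (by norm_num)).1 hx
  have commute (hW4 : kv + 4 * g.r i ≤ W) (hW5 : ¬Hits g j i 0 0 Wp 1)
      (hW6 : ¬Hits g j i 0 0 W 1) :
      Reach g m N (P - root g i (c * qt kv (-1)) + root g j (c * qt 0 0)) := by
    rw [cell_add_ne_off c hij hW5, cell_add_ne_off c hij hW6,
      cell_add_ne_off c hij (by simp only [Hits]; omega),
      cell_add_ne_off c hij (by simp only [Hits]; omega),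
      cell_add_ne_off c hij (by simp only [Hits]; omega),
      cell_add_ne_off c hij (by simp only [Hits] at hW5 ⊢; omega)] at hx'
    rw [cell_add_ne_off c hij (by simp only [Hits]; omega),
      cell_add_ne_off c hij (by simp only [Hits] at hW6 ⊢; omega)] at hx0
    clear hW1 hW2 hW3
    have hC : ¬Hits g i j W (-1) p 0 := by
      clear hx0 hx' v0 v1 j1 j2 j3 j4 j5 hw' hw0 hH hM0 h3 h1 hv1 hadm' hrev' hW5 hW6
      simp only [Hits]; omega
    apply hP.contract_of_commute hN (iw := i) (w := c * qt W (-1))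
    · rwa [reversible_iff c hWp (l' := 1) (by norm_num)]
    · rw [admissible_iff c hkp (l' := 1) (by norm_num), cell_add_same_off c (by omega) (by omega),
        cell_add_same_off c (by omega) (by omega), cell_add_same_off c (by omega) (by omega)]
      exact hadm'
    · rw [reversible_iff c hp (l' := 2) (by norm_num)] at hrev ⊢
      rwa [cell_add_ne_off c hij.symm (by simp only [Hits]; omega),
        cell_add_ne_off c hij.symm (by simp only [Hits]; omega),
        cell_add_ne_off c hij.symm hC]
    · rw [admissible_iff c hWp (l' := 1) (by norm_num),
        cell_add_ne_off c hij (by simp only [Hits]; omega),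
        cell_add_ne_off c hij (by simp only [Hits]; omega),
        cell_add_ne_off c hij hW6,
        cell_add_same_on c hri (by omega),
        cell_add_same_off c (by omega) (by omega), cell_add_same_off c (by omega) (by omega),
        cell_sub_same_off c (by omega) (by omega), cell_sub_same_off c (by omega) (by omega),
        cell_sub_same_off c (by omega) (by omega)]
      omega
  rcases key with ⟨hC1, hC2⟩ | ⟨hC1, hC2, hi1, hj2⟩
  · rcases Nat.eq_zero_or_pos n with rfl | hn0
    swap
    · have := hW3 (by omega)
      simp only [Hits] at hH
      exact commute this (by simp only [Hits]; omega) (by simp only [Hits]; omega)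
    have hW4 := hW2 rfl
    clear hW1 hW2 hW3
    obtain rfl : Wp = kv := by omega
    have e1 := hP3.step (j := j) (a := c * qt 0 (-2)) (by
      rw [admissible_iff c hp (l' := 0) (by norm_num),
        cell_add_ne_off c hij.symm (by simp only [Hits]; omega),
        cell_add_ne_off c hij.symm (by simp only [Hits]; omega),
        cell_add_ne_on c hij.symm (by simp only [Hits]; omega)]
      omega)
    have e2 := e1.step (j := i) (a := c * qt Wp (-1)) (by
      rw [admissible_iff c hkp (l' := 1) (by norm_num),
        cell_sub_ne_on c hij (by simp only [Hits] at hH ⊢; omega),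
        cell_sub_ne_off c hij (by simp only [Hits]; omega),
        cell_sub_ne_off c hij (by simp only [Hits]; omega),
        cell_add_same_off c (by omega) (by omega), cell_add_same_off c (by omega) (by omega),
        cell_add_same_on c hri (by omega),
        cell_add_ne_off c hij (k := kp) (by simp only [Hits]; omega),
        cell_add_ne_off c hij (k := kp) (by simp only [Hits]; omega)]
      omega)
    have e3 := e2.step (j := i) (a := c * qt W (-1)) (by
      rw [admissible_iff c hWp (l' := 1) (by norm_num),
        cell_sub_same_off c (by omega) (by omega), cell_sub_same_on c hri (by omega),
        cell_sub_same_off c (by omega) (by omega),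
        cell_sub_ne_off c hij (by simp only [Hits]; omega),
        cell_sub_ne_on c hij (by simp only [Hits] at hH ⊢; omega),
        cell_sub_ne_off c hij (by simp only [Hits]; omega),
        cell_add_same_on c hri (by omega), cell_add_same_off c (by omega) (by omega),
        cell_add_same_off c (by omega) (by omega)]
      omega)
    rw [hN1, hN2, hN3]
    convert e3 using 1
    abel
  · have hW4 := hW1 hi1
    clear hW1 hW2 hW3
    rcases lt_trichotomy (n + 1) (g.r j) with h | h | h
    · exfalso
      have e1 := hP3.step (j := j) (a := c * qt 0 0) (by
        rw [admissible_iff c hp (l' := 2) (by norm_num),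
          cell_add_ne_off c hij.symm (by simp only [Hits]; omega),
          cell_add_ne_off c hij.symm (by simp only [Hits]; omega),
          cell_add_ne_off c hij.symm (by simp only [Hits]; omega)]
        omega)
      have e4 := ((hm _ _ e1).1.cell c i hWp (l := -1) (l' := 1) (by norm_num)).2.1
      rw [cell_sub_ne_off c hij (by simp only [Hits]; omega),
        cell_sub_ne_on c hij (by simp only [Hits]; omega),
        cell_sub_ne_off c hij (by simp only [Hits]; omega),
        cell_add_same_on c hri (by omega), cell_add_same_on c hri (by omega),
        cell_add_same_off c (by omega) (by omega)] at e4
      omega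
    · exfalso
      have e1 := hP3.step (j := j) (a := c * qt 0 (-2)) (by
        rw [admissible_iff c hp (l' := 0) (by norm_num),
          cell_add_ne_off c hij.symm (by simp only [Hits]; omega),
          cell_add_ne_off c hij.symm (by simp only [Hits]; omega),
          cell_add_ne_on c hij.symm (by simp only [Hits]; omega)]
        omega)
      have e4 := ((hm _ _ e1).1.cell c i hkp (l := -1) (l' := 1) (by norm_num)).1
      rw [cell_sub_ne_on c hij (k := kv) (l := -1) (by simp only [Hits] at hH ⊢; omega),
        cell_sub_ne_off c hij (k := kv) (l := 1) (by simp only [Hits]; omega),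
        cell_add_same_off c (k := kv) (l := -1) (by omega) (by omega),
        cell_add_same_off c (k := kv) (l := 1) (by omega) (by omega)] at e4
      omega
    · simp only [Hits] at hH
      exact commute (by omega) (by simp only [Hits]; omega) (by simp only [Hits]; omega)

end DeformedW

end

noncomputable section

namespace DeformedW

variable {I : Type*} [Fintype I] [DecidableEq I] {g : CartanData I}

variable {m P : Mono I} {c : Spec} {i j : I} {N : ℕ} {kv lv p : ℤ}

theorem contract_of_same (hrj : 0 < g.r j) (hm : NeverFails g m)
    (hN : ∀ n ≤ N, Contracts g m n) (hP : Reach g m N P)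
    (hadm : Admissible g P j (c * qt kv lv))
    (hrev : Reversible g (P - root g j (c * qt kv lv)) j (c * qt 0 0)) :
    Reach g m N (P - root g j (c * qt kv lv) + root g j (c * qt 0 0)) := by
  by_cases hc : kv = 0 ∧ lv = 0
  · rw [hc.1, hc.2, sub_add_cancel]
    exact hP
  obtain ⟨hr, hgen⟩ := hm _ _ hP
  obtain ⟨p, hp⟩ : ∃ p, p = 0 - 2 * (g.r j : ℤ) := ⟨_, rfl⟩
  obtain ⟨kp, hkp⟩ : ∃ kp, kp = kv - 2 * (g.r j : ℤ) := ⟨_, rfl⟩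
  have hadm' := (admissible_iff c hkp rfl).1 hadm
  have hv1 := hgen.cell c j kv lv
  have f0 : cell c P j kp (lv + 2) ≤ 0 := by
    have := (hr.cell c j hkp (l := lv) rfl).2.1
    omega
  have hrev' := (reversible_iff c hp (l' := 2) (by norm_num)).1 hrev
  have e1 : ¬(p = kv ∧ 2 = lv) := by
    rintro ⟨rfl, rfl⟩
    rw [cell_sub_same_on c hrj (by omega)] at hrev'
    omega
  rw [cell_sub_same_off c e1 (by omega)] at hrev'
  have e2 : ¬(0 = kv ∧ 2 = lv) := by
    rintro ⟨rfl, rfl⟩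
    rw [hp.trans hkp.symm] at hrev'
    omega
  have e3 : ¬(0 = kv - 2 * (g.r j : ℤ) ∧ 2 = lv + 2) := by
    rintro ⟨h1, h2⟩
    rw [cell_sub_same_on c hrj (by omega)] at hrev'
    rw [hkp, ← h1, ← h2] at f0
    omega
  have e4 : ¬(p = kv ∧ 0 = lv) := by
    rintro ⟨rfl, rfl⟩
    rw [zero_add] at hadm'
    omega
  have e5 : ¬(p = kv - 2 * (g.r j : ℤ) ∧ 0 = lv + 2) := by
    rintro ⟨h1, h2⟩
    rw [cell_sub_same_off c e2 e3, cell_sub_same_on c hrj (by omega)] at hrev'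
    rw [hkp, ← h1, ← h2] at f0
    omega
  rw [cell_sub_same_off c e2 e3, cell_sub_same_off c e4 e5] at hrev'
  obtain ⟨n, rfl, hn⟩ := hN N le_rfl _ _ _ hP
    ((reversible_iff c hp (l' := 2) (by norm_num)).2 hrev')
  have := hn.step (j := j) (a := c * qt kv lv) (by
    rw [admissible_iff c hkp rfl, cell_add_same_off c hc (by omega),
      cell_add_same_off c (by omega) (by omega), cell_add_same_off c (by omega) (by omega)]
    exact hadm')
  rwa [add_sub_right_comm] at this

theorem root_apply_eq_zero {a c : Spec} (h : ¬∃ k l, c = a * qt k l) (k l : ℤ) :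
    root g i a (j, c * qt k l) = 0 := by
  by_contra h0
  obtain ⟨k', l', h'⟩ := exists_of_root_apply_ne_zero g h0
  exact h ⟨k' - k, l' - l, by
    rw [← mul_left_inj (qt k l), h', mul_assoc, qt_mul, sub_add_cancel, sub_add_cancel]⟩

theorem contract_of_separate {a : Spec}
    (hN : ∀ n ≤ N, Contracts g m n) (hP : Reach g m N P)
    (hadm : Admissible g P i a) (hrev : Reversible g (P - root g i a) j c)
    (h : ¬∃ k l, a = c * qt k l) :
    Reach g m N (P - root g i a + root g j c) := by
  have h' : ¬∃ k l, c = a * qt k l := by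
    rintro ⟨k, l, rfl⟩
    exact h ⟨-k, -l, by rw [mul_assoc, qt_mul, add_neg_cancel, add_neg_cancel, qt_zero, mul_one]⟩
  simp only [Reversible, Finsupp.sub_apply, root_apply_eq_zero h', sub_zero] at hrev
  obtain ⟨n, rfl, hn⟩ := hN N le_rfl _ _ _ hP hrev
  have := hn.step (j := i) (a := a) (by
    have h0 := root_apply_eq_zero (g := g) (i := j) (j := i) h 0 0
    rw [qt_zero, mul_one] at h0
    simp only [Admissible, Finsupp.add_apply, root_apply_eq_zero h, add_zero, h0]
    exact hadm)
  rwa [add_sub_right_comm] at this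

/-- Every reversible factor of a created monomial comes from a step of the algorithm. -/
theorem contracts (hg : g.IsFinite) (hm : NeverFails g m) (hdom : Dominant m) (n : ℕ) :
    Contracts g m n := by
  induction n using Nat.strong_induction_on with
  | _ n ih =>
  intro M j c hM hrev
  cases hM with
  | start =>
    have h1 := hrev.1
    have h2 := hdom j (c * qt (-2 * g.r j) 2)
    omega
  | @step n P i a hP hadm =>
    refine ⟨n, rfl, ?_⟩
    have hN : ∀ k ≤ n, Contracts g m k := fun k hk => ih k (Nat.lt_succ_of_le hk)
    by_cases h : ∃ k l, a = c * qt k l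
    swap
    · exact contract_of_separate hN hP hadm hrev h
    obtain ⟨k, l, rfl⟩ := h
    have hrev' : Reversible g (P - root g i (c * qt k l)) j (c * qt 0 0) := by
      rwa [qt_zero, mul_one]
    suffices Reach g m n (P - root g i (c * qt k l) + root g j (c * qt 0 0)) by
      rwa [qt_zero, mul_one] at this
    by_cases hij : i = j
    · subst hij
      exact contract_of_same (hg.r_pos i) hm hN hP hadm hrev'
    by_cases h2 : Hits g i j k l 0 2
    · exact contract_of_hits_above hg hm hN hP hij hadm hrev' rfl h2
    by_cases h1 : Hits g i j k l (0 - 2 * g.r j) 0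
    · exact contract_of_hits_right hg hm hN hP hij hadm hrev' rfl h1
    exact contract_of_disjoint hg hm hN hP hij hadm hrev' rfl h1 h2

end DeformedW

end

noncomputable section

namespace DeformedW

theorem qpow_add (ξ η : PowerSeries ℂ) : qpow (ξ + η) = qpow ξ * qpow η :=
  (PowerSeries.exp_mul_exp_eq_exp_add (A := PowerSeries ℂ) ξ η).symm

theorem qpow_zero : qpow 0 = 1 := by
  rw [qpow, PowerSeries.rescale_zero_apply]
  simp

theorem val_mul (a b : Spec) : val (a * b) = val a * val b := by
  obtain ⟨x, k, l⟩ := a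
  obtain ⟨y, k', l'⟩ := b
  simp only [val, Prod.mk_mul_mk, toAdd_mul, Int.cast_add, map_add, Units.val_mul, map_mul]
  rw [mul_mul_mul_comm, ← qpow_add]
  congr 2
  ring

theorem val_one : val 1 = 1 := by
  change PowerSeries.C (PowerSeries.C ((1 : ℂˣ) : ℂ)) * qpow (PowerSeries.C ((0 : ℤ) : ℂ) +
    PowerSeries.C ((0 : ℤ) : ℂ) * PowerSeries.X) = 1
  simp [qpow_zero]

/-- Spectral parameters as units of the field of fractions. -/
def vF : Spec →* Fˣ := MonoidHom.toHomUnits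
  { toFun := fun a => algebraMap K F (val a)
    map_one' := by rw [val_one, map_one]
    map_mul' := fun a b => by rw [val_mul, map_mul] }

theorem coe_vF (a : Spec) : (vF a : F) = algebraMap K F (val a) := rfl

theorem Q_eq (k l : ℤ) : Q k l = vF (qt k l) := rfl

theorem vF_injective : Function.Injective vF := fun a b h =>
  val_injective (IsFractionRing.injective K F (by rw [← coe_vF, h, coe_vF]))

theorem one_sub_vF_ne_zero {a : Spec} (h : a ≠ 1) : (1 - vF a : F) ≠ 0 := by
  rw [sub_ne_zero, ne_comm, Ne, Units.val_eq_one, ← vF.map_one]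
  exact fun h' => h (vF_injective h')

theorem exists_qpow_eq (ξ : PowerSeries ℂ) :
    ∃ u : K, IsUnit u ∧ qpow ξ = 1 + PowerSeries.X * PowerSeries.C ξ * u := by
  have h : PowerSeries.exp (PowerSeries ℂ) = 1 + PowerSeries.X *
      PowerSeries.mk fun n => PowerSeries.coeff (n + 1) (PowerSeries.exp (PowerSeries ℂ)) := by
    ext n : 1
    rcases n with _ | n
    · simp
    · rw [map_add, PowerSeries.coeff_succ_X_mul, PowerSeries.coeff_mk, PowerSeries.coeff_one,
        if_neg n.succ_ne_zero, zero_add]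
  refine ⟨PowerSeries.rescale ξ (PowerSeries.mk fun n =>
    PowerSeries.coeff (n + 1) (PowerSeries.exp (PowerSeries ℂ))), ?_, ?_⟩
  · rw [PowerSeries.isUnit_iff_constantCoeff, ← PowerSeries.coeff_zero_eq_constantCoeff_apply,
      PowerSeries.coeff_rescale, PowerSeries.coeff_mk]
    simp
  · conv_lhs => rw [qpow, h]
    rw [map_add, map_one, map_mul, PowerSeries.rescale_X]
    ring

theorem associated_one_sub {R : Type*} [CommRing R] {X a b u v : R} (hu : IsUnit u)
    (hv : IsUnit v) (h : b = a * v) : Associated (1 - (1 + X * b * u)) (X * a) := by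
  refine ((associated_mul_unit_right _ _ (hu.mul hv).neg).trans (Associated.of_eq ?_)).symm
  rw [h]
  ring

/-- The order of vanishing of `1 - val a` depends only on the first two entries of `a`. -/
theorem exists_associated_one_sub_val : ∃ w : ℂˣ → Multiplicative ℤ → K, ∀ a : Spec,
    a ≠ 1 → Associated (1 - val a) (w a.1 a.2.1) := by
  classical
  refine ⟨fun c k => if c = 1 then
    (PowerSeries.X * PowerSeries.C (if k = 1 then PowerSeries.X else 1)) else 1, ?_⟩
  rintro ⟨c, k, l⟩ hne
  obtain ⟨u, hu, hu'⟩ := exists_qpow_eq (PowerSeries.C ((Multiplicative.toAdd k : ℤ) : ℂ) +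
      PowerSeries.C ((Multiplicative.toAdd l : ℤ) : ℂ) * PowerSeries.X)
  simp only [val, hu']
  split_ifs with hc hk
  · subst hc hk
    rw [Units.val_one, map_one, map_one, one_mul]
    refine associated_one_sub hu (v := PowerSeries.C (PowerSeries.C
      ((Multiplicative.toAdd l : ℤ) : ℂ))) ?_ ?_
    · refine IsUnit.map PowerSeries.C (IsUnit.map PowerSeries.C ?_)
      refine isUnit_iff_ne_zero.2 (Int.cast_ne_zero.2 fun h => hne ?_)
      exact Prod.ext rfl (Prod.ext rfl h)
    · rw [toAdd_one, Int.cast_zero, map_zero, zero_add, map_mul, mul_comm]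
  · subst hc
    rw [Units.val_one, map_one, map_one, one_mul]
    refine associated_one_sub hu (v := PowerSeries.C (PowerSeries.C
      ((Multiplicative.toAdd k : ℤ) : ℂ) + PowerSeries.C ((Multiplicative.toAdd l : ℤ) : ℂ) *
        PowerSeries.X)) ?_ ?_
    · refine IsUnit.map PowerSeries.C ?_
      rw [PowerSeries.isUnit_iff_constantCoeff]
      simpa using hk
    · rw [one_mul]
  · rw [associated_one_iff_isUnit, PowerSeries.isUnit_iff_constantCoeff,
      PowerSeries.isUnit_iff_constantCoeff]
    have : (1 : ℂ) - c ≠ 0 := fun h => hc (Units.ext (sub_eq_zero.1 h).symm)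
    simpa using this

theorem blockNum_associated (r : ℕ) {x : Spec} (h0 : x ≠ 1) (h1 : qt (-2 * r) 0 * x ≠ 1)
    (h2 : qt 0 2 * x ≠ 1) (h3 : qt (-2 * r) 2 * x ≠ 1) :
    Associated (blockNum r x) (blockDen r x) := by
  obtain ⟨w, hw⟩ := exists_associated_one_sub_val
  have e0 := hw _ h0
  have e1 := hw _ h1
  have e2 := hw _ h2
  have e3 := hw _ h3
  have f2 : (qt 0 2 * x).2.1 = x.2.1 := one_mul _
  have f1 : ∀ k l, (qt k l * x).1 = x.1 := fun k l => one_mul _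
  rw [f2, f1] at e2
  rw [f1] at e1 e3
  rw [blockNum, blockDen, mul_comm]
  exact (e2.trans e0.symm).mul_mul (e1.trans e3.symm)

theorem one_sub_val_ne_zero {a : Spec} (h : a ≠ 1) : 1 - val a ≠ 0 := by
  rw [sub_ne_zero, ← val_one]
  exact fun h' => h (val_injective h').symm

theorem blockNum_ne_zero (r : ℕ) {x : Spec} (h1 : qt (-2 * r) 0 * x ≠ 1) (h2 : qt 0 2 * x ≠ 1) :
    blockNum r x ≠ 0 := mul_ne_zero (one_sub_val_ne_zero h1) (one_sub_val_ne_zero h2)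

theorem blockDen_ne_zero (r : ℕ) {x : Spec} (h0 : x ≠ 1) (h3 : qt (-2 * r) 2 * x ≠ 1) :
    blockDen r x ≠ 0 := mul_ne_zero (one_sub_val_ne_zero h0) (one_sub_val_ne_zero h3)

/-! ### Regularized factors -/

open scoped Classical in
/-- `1 - x`, with the value `1` at `x = 1`. -/
def regOne (x : Spec) : Fˣ := if h : x = 1 then 1 else Units.mk0 _ (one_sub_vF_ne_zero h)

open scoped Classical in
/-- `1 - x`, with the value `-1` at `x = 1`. -/
def regTwo (x : Spec) : Fˣ := if h : x = 1 then -1 else Units.mk0 _ (one_sub_vF_ne_zero h)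

theorem coe_regOne {x : Spec} (h : x ≠ 1) : (regOne x : F) = 1 - vF x := by
  rw [regOne, dif_neg h, Units.val_mk0]

theorem coe_regTwo {x : Spec} (h : x ≠ 1) : (regTwo x : F) = 1 - vF x := by
  rw [regTwo, dif_neg h, Units.val_mk0]

theorem regOne_one : regOne 1 = 1 := by rw [regOne, dif_pos rfl]

theorem regTwo_one : regTwo 1 = -1 := by rw [regTwo, dif_pos rfl]

theorem regOne_inv (x : Spec) : regOne x⁻¹ = -((vF x)⁻¹ * regTwo x) := by
  by_cases h : x = 1
  · subst h; simp [regOne_one, regTwo_one]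
  · ext
    rw [coe_regOne (by simpa using h), Units.val_neg, Units.val_mul, coe_regTwo h, map_inv,
      mul_sub, mul_one, Units.inv_mul]
    ring

theorem regTwo_inv (x : Spec) : regTwo x⁻¹ = -((vF x)⁻¹ * regOne x) := by
  have := regOne_inv x⁻¹
  rw [inv_inv, map_inv, inv_inv] at this
  rw [this, mul_neg, neg_neg, inv_mul_cancel_left]

/-- The regularized ratio of `blockNum` and `blockDen`. -/
def blockRatio (r : ℕ) (x : Spec) : Fˣ :=
  regOne (qt (-2 * r) 0 * x) * regTwo (qt 0 2 * x) / (regOne x * regTwo (qt (-2 * r) 2 * x))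

theorem coe_blockRatio (r : ℕ) {x : Spec} (h0 : x ≠ 1) (h1 : qt (-2 * r) 0 * x ≠ 1)
    (h2 : qt 0 2 * x ≠ 1) (h3 : qt (-2 * r) 2 * x ≠ 1) : (blockRatio r x : F) =
      algebraMap K F (blockNum r x) / algebraMap K F (blockDen r x) := by
  rw [blockRatio, Units.val_div_eq_div_val, Units.val_mul, Units.val_mul, coe_regOne h0,
    coe_regOne h1, coe_regTwo h2, coe_regTwo h3]
  simp only [coe_vF]
  simp only [blockNum, blockDen, map_mul, map_sub, map_one]

theorem blockRatio_inv (r : ℕ) (x : Spec) :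
    blockRatio r x⁻¹ = blockRatio r (qt (2 * r) (-2) * x) := by
  have e : ∀ k l, qt k l * x⁻¹ = (qt (-k) (-l) * x)⁻¹ := fun k l => by
    rw [mul_inv, qt_inv, neg_neg, neg_neg]
  have e' : ∀ k l, qt k l * (qt (2 * r) (-2) * x) = qt (k + 2 * r) (l - 2) * x := fun k l => by
    rw [← mul_assoc, qt_mul]; rfl
  simp only [blockRatio, e, e', regOne_inv, regTwo_inv, neg_mul_neg, map_mul]
  have e1 : qt (-2 * r + 2 * r) (0 - 2) = qt (-0) (-2) := by rw [qt_inj]; omega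
  have e2 : qt (0 + 2 * r) (2 - 2) = qt (-(-2 * r)) (-0) := by rw [qt_inj]; omega
  have e3 : qt (-2 * r + 2 * r) (2 - 2) * x = x := by
    rw [neg_mul, neg_add_cancel, sub_self, qt_zero, one_mul]
  have e4 : qt (2 * r) (-2) = qt (-(-2 * r)) (-2) := by rw [qt_inj]; omega
  have e5 : vF (qt (-(-2 * r)) (-2)) = vF (qt (-(-2 * r)) (-0)) * vF (qt (-0) (-2)) := by
    rw [← map_mul, qt_mul]; simp
  rw [e1, e2, e3, e4, e5]
  generalize vF x = a, vF (qt (-(-2 * r)) (-0)) = b, vF (qt (-0) (-2)) = d,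
    regTwo (qt (-(-2 * r)) (-0) * x) = A, regOne (qt (-0) (-2) * x) = B, regTwo x = C,
    regOne (qt (-(-2 * r)) (-2) * x) = D
  simp only [div_eq_mul_inv, mul_inv, inv_inv]
  have : ((b⁻¹ * a⁻¹ * A) * (d⁻¹ * a⁻¹ * B)) * ((a * C⁻¹) * (b * d * a * D⁻¹)) =
    (B * A * (D⁻¹ * C⁻¹)) * ((b⁻¹ * b) * (a⁻¹ * a) * (d⁻¹ * d) * (a⁻¹ * a)) := by
      ac_rfl
  simpa only [inv_mul_cancel, mul_one] using this

/-- Telescoping of the factors along a row. -/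
theorem prod_blockRatio_one (x : Spec) (n : ℕ) :
    ∏ s ∈ Finset.range n, blockRatio 1 (qt (-2 * s) 0 * x) = blockRatio n x := by
  have e : ∀ k l k' l', qt k l * (qt k' l' * x) = qt (k + k') (l + l') * x :=
    fun k l k' l' => by rw [← mul_assoc, qt_mul]
  induction n with
  | zero =>
    simp [blockRatio, qt_zero]
  | succ n ih =>
    rw [Finset.prod_range_succ, ih]
    simp only [blockRatio, e]
    push_cast
    rw [show (-2 + -2 * (n : ℤ)) = -2 * (n + 1) by ring]
    simp only [zero_add]
    generalize regTwo (qt (-2 * n) 2 * x) = a, regOne (qt (-2 * n) 0 * x) = b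
    rw [div_mul_div_comm, div_eq_div_iff_mul_eq_mul]
    ac_rfl

end DeformedW

end

noncomputable section

namespace DeformedW

variable {I : Type*} [Fintype I] [DecidableEq I] (g : CartanData I)

/-- The factor by which an expansion at `u` multiplies the coefficient of `M`, up to the
contribution of `u` itself. -/
def stepFactor (u : I × Spec) (M : Mono I) : Fˣ :=
  M.prod fun p e => if p.1 = u.1 then blockRatio (g.r u.1) (u.2 / p.2) ^ e else 1

theorem stepFactor_add (u : I × Spec) (M N : Mono I) :
    stepFactor g u (M + N) = stepFactor g u M * stepFactor g u N := by
  classical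
  refine Finsupp.prod_add_index' (fun p => ?_) fun p e e' => ?_
  · simp
  · split_ifs
    · exact zpow_add _ _ _
    · rw [one_mul]

theorem stepFactor_zero (u : I × Spec) : stepFactor g u 0 = 1 := Finsupp.prod_zero_index

theorem stepFactor_neg (u : I × Spec) (M : Mono I) :
    stepFactor g u (-M) = (stepFactor g u M)⁻¹ := by
  rw [eq_inv_iff_mul_eq_one, ← stepFactor_add, neg_add_cancel, stepFactor_zero]

theorem stepFactor_sub (u : I × Spec) (M N : Mono I) :
    stepFactor g u (M - N) = stepFactor g u M / stepFactor g u N := by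
  rw [sub_eq_add_neg, stepFactor_add, stepFactor_neg, div_eq_mul_inv]

theorem stepFactor_sum {ι : Type*} (u : I × Spec) (s : Finset ι) (f : ι → Mono I) :
    stepFactor g u (∑ x ∈ s, f x) = ∏ x ∈ s, stepFactor g u (f x) := by
  classical
  induction s using Finset.induction_on with
  | empty => simp [stepFactor_zero]
  | insert x s hx ih => rw [Finset.sum_insert hx, Finset.prod_insert hx, stepFactor_add, ih]

theorem stepFactor_single_same (j : I) (a b : Spec) :
    stepFactor g (j, a) (Finsupp.single (j, b) 1) = blockRatio (g.r j) (a / b) := by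
  rw [stepFactor, Finsupp.prod_single_index (by simp), if_pos rfl, zpow_one]

theorem stepFactor_single_ne {i j : I} (hij : i ≠ j) (a b : Spec) :
    stepFactor g (j, a) (Finsupp.single (i, b) 1) = 1 := by
  rw [stepFactor, Finsupp.prod_single_index (by simp), if_neg hij]

theorem stepFactor_root_same (j : I) (a b : Spec) : stepFactor g (j, a) (root g j b) =
    blockRatio (g.r j) (a / b) * blockRatio (g.r j) (qt (2 * g.r j) (-2) * (a / b)) := by
  rw [root, rootMono, stepFactor_sub, stepFactor_add, stepFactor_single_same,
    stepFactor_single_same, stepFactor_sum, Finset.prod_eq_one, div_one]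
  · rw [mul_assoc, mul_assoc, qt_mul, qt_mul]
    rw [show (-(g.r j : ℤ) + g.r j) = 0 by ring, show (1 : ℤ) + -1 = 0 by norm_num, qt_zero,
      mul_one, div_mul_eq_div_div, div_eq_mul_inv (a / b), qt_inv, mul_comm (a / b)]
    congr 3
    rw [qt_inj]
    constructor <;> ring
  · intro i hi
    rw [stepFactor_sum]
    exact Finset.prod_eq_one fun s _ => stepFactor_single_ne g (Finset.ne_of_mem_erase hi) _ _

theorem stepFactor_root_ne {i j : I} (hij : i ≠ j) (a b : Spec) :
    stepFactor g (j, a) (root g i b) = (∏ s ∈ Finset.range (-g.C j i).toNat,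
      blockRatio (g.r j) (qt (-2 * s) 0 * (qt (g.r i - g.C j i - 1) (-1) * (a / b))))⁻¹ := by
  rw [root, rootMono, stepFactor_sub, stepFactor_add, stepFactor_single_ne g hij,
    stepFactor_single_ne g hij, stepFactor_sum, one_mul, one_div, inv_inj,
    Finset.prod_eq_single j]
  · rw [stepFactor_sum, ← Finset.prod_range_reflect]
    refine Finset.prod_congr rfl fun s hs => ?_
    rw [Finset.mem_range] at hs
    rw [stepFactor_single_same, mul_assoc, qt_mul, div_mul_eq_div_div, div_eq_mul_inv (a / b),
      qt_inv, mul_comm (a / b), ← mul_assoc, qt_mul]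
    congr 3
    omega
  · intro k hk hkj
    rw [stepFactor_sum]
    exact Finset.prod_eq_one fun s _ => stepFactor_single_ne g hkj _ _
  · exact fun h => absurd (Finset.mem_erase.2 ⟨hij.symm, Finset.mem_univ _⟩) h

variable {g}

theorem stepFactor_root_of_eq_one {i j : I} (hij : i ≠ j) (hj : g.r j = 1) (a b : Spec) {n : ℕ}
    (hn : g.C j i = -n) : stepFactor g (j, a) (root g i b) =
      (blockRatio n (qt (g.r i + n - 1) (-1) * (a / b)))⁻¹ := by
  rw [stepFactor_root_ne g hij, hj, hn, neg_neg, Int.toNat_natCast, prod_blockRatio_one]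
  congr 4
  ring

theorem stepFactor_root_of_eq_neg_one {i j : I} (hij : i ≠ j) (a b : Spec)
    (hn : g.C j i = -1) : stepFactor g (j, a) (root g i b) =
      (blockRatio (g.r j) (qt (g.r i) (-1) * (a / b)))⁻¹ := by
  rw [stepFactor_root_ne g hij, hn, neg_neg, Int.toNat_one, Finset.prod_range_one]
  rw [Nat.cast_zero, mul_zero, qt_zero, one_mul]
  congr 4
  ring

theorem blockRatio_qt_inv (r : ℕ) (k l : ℤ) (a b : Spec) :
    blockRatio r (qt k l * (b / a)) = blockRatio r (qt (2 * r - k) (-2 - l) * (a / b)) := by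
  rw [← inv_div a b, show qt k l * (a / b)⁻¹ = (qt (-k) (-l) * (a / b))⁻¹ by
    rw [mul_inv, qt_inv, neg_neg, neg_neg], blockRatio_inv, ← mul_assoc, qt_mul]
  rfl

/-- The coefficients do not depend on the order of two steps. -/
theorem stepFactor_root_comm (hg : g.IsFinite) (u v : I × Spec) :
    stepFactor g u (root g v.1 v.2) = stepFactor g v (root g u.1 u.2) := by
  obtain ⟨j, a⟩ := u
  obtain ⟨i, b⟩ := v
  simp only
  by_cases hij : i = j
  · subst hij
    have h1 := blockRatio_qt_inv (g.r i) 0 0 a b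
    have h2 := blockRatio_qt_inv (g.r i) (2 * g.r i) (-2) a b
    rw [qt_zero, one_mul, sub_zero, sub_zero] at h1
    rw [sub_self, sub_self, qt_zero, one_mul] at h2
    rw [stepFactor_root_same, stepFactor_root_same, h1, h2, mul_comm]
  rcases hg.cases j i (Ne.symm hij) with h | h | h | h
  · rw [stepFactor_root_ne g hij, stepFactor_root_ne g (Ne.symm hij), h.1, h.2]
    simp
  · rw [stepFactor_root_of_eq_neg_one hij _ _ h.1,
      stepFactor_root_of_eq_neg_one (Ne.symm hij) _ _ h.2.1, blockRatio_qt_inv, h.2.2]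
    congr 4
    ring
  · rw [stepFactor_root_of_eq_neg_one hij _ _ h.1,
      stepFactor_root_of_eq_one (Ne.symm hij) h.2.2 _ _ h.2.1, blockRatio_qt_inv, h.2.2]
    congr 4
    push_cast
    ring
  · rw [stepFactor_root_of_eq_neg_one (Ne.symm hij) _ _ h.1,
      stepFactor_root_of_eq_one hij h.2.2 _ _ h.2.1, blockRatio_qt_inv, h.2.2]
    congr 4
    push_cast
    ring

end DeformedW

end

noncomputable section

namespace DeformedW

variable {I : Type*} [Fintype I] [DecidableEq I] {g : CartanData I}

/-! ### A single step -/

theorem qt_mul_div_ne_one {a b : Spec} {k l : ℤ} (h : b ≠ a * qt k l) : qt k l * (a / b) ≠ 1 := by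
  intro h'
  rw [← mul_div_assoc, div_eq_one, mul_comm] at h'
  exact h h'.symm

theorem stepDen_ne_zero {I : Type*} {g : CartanData I} {M : Mono I} (hM : Regular g M) {j : I} {a : Spec}
    (h : Admissible g M j a) : stepDen g M j a ≠ 0 := by
  classical
  refine mul_ne_zero (Finset.prod_ne_zero_iff.2 ?_) (Finset.prod_ne_zero_iff.2 ?_)
  · rintro ⟨i, b⟩ hb
    rw [Finset.mem_filter] at hb
    obtain ⟨-, hij, hba, hb⟩ := hb
    obtain rfl : i = j := hij
    refine blockDen_ne_zero _ ?_ (qt_mul_div_ne_one ?_)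
    · exact fun h' => hba (div_eq_one.1 h').symm
    · rintro rfl
      have h1 := (hM i a).2.1 h.1 hb
      exact h1.1.ne' h.2.1
  · rintro ⟨i, b⟩ hb
    rw [Finset.mem_filter] at hb
    obtain ⟨-, hij, hb⟩ := hb
    obtain rfl : i = j := hij
    refine blockNum_ne_zero _ (qt_mul_div_ne_one ?_) (qt_mul_div_ne_one ?_)
    · rintro rfl
      exact hb.ne h.2.1
    · rintro rfl
      exact hb.ne h.2.2

theorem Admissible.opposite_eq_zero {M : Mono I} (hM : Regular g M) {j : I} {a : Spec}
    (hr : 0 < g.r j) (h : Admissible g M j a) (hM' : Generic (M - root g j a)) :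
    M (j, a * qt (-2 * g.r j) 2) = 0 := by
  have h1 := (hM j a).2.1 h.1
  have h2 := hM' j (a * qt (-2 * g.r j) 2)
  have h3 := h.2
  rw [Finsupp.sub_apply, root_apply_same, if_pos rfl, if_neg] at h2
  · omega
  · intro h'
    rw [eq_comm, mul_eq_left, ← qt_zero, qt_inj] at h'
    omega

theorem step_ratio {M : Mono I} (hM : Generic M) {j : I} {a : Spec}
    (h : Admissible g M j a) (h0 : M (j, a * qt (-2 * g.r j) 2) = 0) :
    Associated (stepNum g M j a) (stepDen g M j a) ∧
    algebraMap K F (stepNum g M j a) / algebraMap K F (stepDen g M j a) =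
      (((blockRatio (g.r j) 1)⁻¹ * stepFactor g (j, a) M : Fˣ) : F) := by
  obtain rfl : ‹DecidableEq I› = fun a b => Classical.propDecidable (a = b) := Subsingleton.elim _ _
  classical
  have ne : ∀ b : Spec, b ≠ a → M (j, b) ≠ 0 → a / b ≠ 1 ∧ qt (-2 * g.r j) 0 * (a / b) ≠ 1 ∧
      qt 0 2 * (a / b) ≠ 1 ∧ qt (-2 * g.r j) 2 * (a / b) ≠ 1 := by
    intro b hb hb0
    refine ⟨fun h' => hb (div_eq_one.1 h').symm, ?_, ?_, ?_⟩
    · exact qt_mul_div_ne_one (by rintro rfl; exact hb0 h.2.1)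
    · exact qt_mul_div_ne_one (by rintro rfl; exact hb0 h.2.2)
    · exact qt_mul_div_ne_one (by rintro rfl; exact hb0 h0)
  have ha : M (j, a) = 1 := by
    have := hM j a
    have := h.1
    omega
  constructor
  · refine Associated.mul_mul (Associated.prod _ _ _ ?_) (Associated.prod _ _ _ ?_)
    · rintro ⟨i, b⟩ hb
      rw [Finset.mem_filter] at hb
      obtain ⟨-, hij, hba, hb⟩ := hb
      obtain rfl : i = j := hij
      obtain ⟨e0, e1, e2, e3⟩ := ne b hba hb.ne'
      exact blockNum_associated _ e0 e1 e2 e3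
    · rintro ⟨i, b⟩ hb
      rw [Finset.mem_filter] at hb
      obtain ⟨-, hij, hb⟩ := hb
      obtain rfl : i = j := hij
      obtain ⟨e0, e1, e2, e3⟩ := ne b (by rintro rfl; omega) hb.ne
      exact (blockNum_associated _ e0 e1 e2 e3).symm
  · have hmem : (j, a) ∈ M.support := by rw [Finsupp.mem_support_iff, ha]; exact one_ne_zero
    rw [stepFactor, Finsupp.prod, ← Finset.mul_prod_erase _ _ hmem]
    simp only [if_true, ha, div_self', zpow_one, inv_mul_cancel_left]
    rw [stepNum, stepDen, map_mul, map_mul, map_prod, map_prod, map_prod, map_prod,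
      Units.coe_prod, mul_div_mul_comm, ← Finset.prod_div_distrib, ← Finset.prod_div_distrib,
      Finset.prod_filter, Finset.prod_filter, ← Finset.prod_mul_distrib,
      ← Finset.mul_prod_erase _ _ hmem]
    rw [if_neg (by simp), if_neg (by simp only [ha]; omega), one_mul, one_mul]
    refine Finset.prod_congr rfl ?_
    rintro ⟨i, b⟩ hb
    rw [Finset.mem_erase, Finsupp.mem_support_iff] at hb
    obtain ⟨hba, hb⟩ := hb
    simp only
    by_cases hij : i = j
    · subst hij
      have hba' : b ≠ a := fun h' => hba (by rw [h'])
      obtain ⟨e0, e1, e2, e3⟩ := ne b hba' hb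
      rcases hM i b with h1 | h1 | h1
      · rw [if_neg (by omega), if_pos (by simp [h1]), if_pos rfl, h1, zpow_neg_one,
          Units.val_inv_eq_inv_val, coe_blockRatio _ e0 e1 e2 e3, inv_div, one_mul]
      · exact absurd h1 hb
      · rw [if_pos (by simp [h1, hba']), if_neg (by simp [h1]), if_pos rfl, h1, zpow_one,
          coe_blockRatio _ e0 e1 e2 e3, mul_one]
    · rw [if_neg (fun h' => hij h'.1), if_neg (fun h' => hij h'.1), if_neg hij, mul_one,
        Units.val_one]

/-! ### Independence of the roots -/

variable (g) in
/-- The product of the monomials divided out along a list of steps. -/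
def rootSum (l : List (I × Spec)) : Mono I := (l.map fun u => root g u.1 u.2).sum

/-- The exponent of `t`. -/
def level (a : Spec) : ℤ := Multiplicative.toAdd a.2.2

theorem level_mul_qt (a : Spec) (k l : ℤ) : level (a * qt k l) = level a + l := rfl

theorem root_apply_self (hr : 0 < g.r i) (a : Spec) : root g i a (i, a) = 1 := by
  rw [root_apply_same, if_pos rfl, if_neg, add_zero]
  intro h'
  rw [mul_eq_left, ← qt_zero, qt_inj] at h'
  omega

theorem root_apply_level {i j : I} {a x : Spec} (h : root g j a (i, x) ≠ 0) :
    (i, x) = (j, a) ∨ level a < level x := by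
  by_cases hij : i = j
  · subst hij
    rw [root_apply_same] at h
    by_cases h1 : a = x
    · exact .inl (by rw [h1])
    · rw [if_neg h1, zero_add] at h
      have h2 := (ite_ne_right_iff.1 h).1
      rw [← h2, level_mul_qt]
      exact .inr (by omega)
  · rw [root_apply_ne g hij] at h
    obtain ⟨s, -, hs⟩ := Finset.exists_ne_zero_of_sum_ne_zero (neg_ne_zero.1 h)
    have h2 := (ite_ne_right_iff.1 hs).1
    rw [← h2, level_mul_qt]
    exact .inr (by omega)

theorem perm_of_rootSum_eq (hr : ∀ i, 0 < g.r i) {l l' : List (I × Spec)}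
    (h : rootSum g l = rootSum g l') : l.Perm l' := by
  classical
  set S := (l : Multiset (I × Spec)).toFinset ∪ (l' : Multiset (I × Spec)).toFinset with hS
  set n : I × Spec → ℤ := fun u => (l : Multiset (I × Spec)).count u -
    (l' : Multiset (I × Spec)).count u with hn
  have key : ∀ u : I × Spec, ∑ v ∈ S, n v * root g v.1 v.2 u = 0 := by
    have aux : ∀ L : List (I × Spec), (L : Multiset (I × Spec)).toFinset ⊆ S → ∀ u,
        rootSum g L u = ∑ v ∈ S, ((L : Multiset (I × Spec)).count v : ℤ) *
          root g v.1 v.2 u := by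
      intro L hL u
      have e : rootSum g L = ((L : Multiset (I × Spec)).map fun u => root g u.1 u.2).sum := by
        rw [Multiset.map_coe, Multiset.sum_coe]; rfl
      rw [e, Finset.sum_multiset_map_count, Finsupp.finsetSum_apply]
      refine (Finset.sum_congr rfl fun v _ => nsmul_eq_mul _ _).trans
        (Finset.sum_subset hL fun v _ hv => ?_)
      rw [Multiset.count_eq_zero.2 (by simpa using hv), Nat.cast_zero, zero_mul]
    intro u
    simp only [hn, sub_mul, Finset.sum_sub_distrib]
    rw [← aux l Finset.subset_union_left, ← aux l' Finset.subset_union_right, h, sub_self]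
  rw [← Multiset.coe_eq_coe, Multiset.ext]
  by_contra hne
  rw [not_forall] at hne
  obtain ⟨u, hu⟩ := hne
  have hmem : ∀ v, n v ≠ 0 → v ∈ S := by
    intro v hv
    rw [hS, Finset.mem_union, Multiset.mem_toFinset, Multiset.mem_toFinset]
    by_contra! hv'
    exact hv (by simp only [hn, Multiset.count_eq_zero.2 hv'.1, Multiset.count_eq_zero.2 hv'.2,
      sub_self])
  have hu' : n u ≠ 0 := by simp only [hn]; omega
  obtain ⟨w, hw, hmin⟩ := Finset.exists_min_image (S.filter fun v => n v ≠ 0)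
    (fun v => level v.2) ⟨u, Finset.mem_filter.2 ⟨hmem u hu', hu'⟩⟩
  rw [Finset.mem_filter] at hw
  have h1 := key w
  rw [Finset.sum_eq_single w] at h1
  · rw [root_apply_self (hr _), mul_one] at h1
    exact hw.2 h1
  · intro v hv hvw
    by_contra h0
    rcases root_apply_level (right_ne_zero_of_mul h0) with h2 | h2
    · exact hvw h2.symm
    · have := hmin v (Finset.mem_filter.2 ⟨hv, left_ne_zero_of_mul h0⟩)
      omega
  · exact fun h' => absurd hw.1 h'

/-! ### Paths -/

variable (g) in
/-- `l` is the list of the steps, the last one first, of a path starting at `m`. -/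
def IsPath (m : Mono I) : List (I × Spec) → Prop
  | [] => True
  | u :: l => IsPath m l ∧ Admissible g (m - rootSum g l) u.1 u.2

variable (g) in
/-- The coefficient given by a list of steps, the last one first. -/
def pathCoeff (m : Mono I) : List (I × Spec) → Fˣ
  | [] => 1
  | u :: l => pathCoeff m l * ((blockRatio (g.r u.1) 1)⁻¹ * stepFactor g u (m - rootSum g l))

theorem rootSum_nil : rootSum g [] = 0 := rfl

theorem rootSum_cons (u : I × Spec) (l : List (I × Spec)) :
    rootSum g (u :: l) = root g u.1 u.2 + rootSum g l := List.sum_cons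

theorem rootSum_append (l l' : List (I × Spec)) :
    rootSum g (l ++ l') = rootSum g l + rootSum g l' := by
  rw [rootSum, List.map_append, List.sum_append]; rfl

theorem rootSum_perm {l l' : List (I × Spec)} (h : l.Perm l') : rootSum g l = rootSum g l' :=
  (h.map _).sum_eq

theorem sub_rootSum_cons (m : Mono I) (u : I × Spec) (l : List (I × Spec)) :
    m - rootSum g (u :: l) = m - rootSum g l - root g u.1 u.2 := by
  rw [rootSum_cons]; abel

theorem pathCoeff_perm (hg : g.IsFinite) (m : Mono I) {l l' : List (I × Spec)} (h : l.Perm l') :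
    pathCoeff g m l = pathCoeff g m l' := by
  induction h with
  | nil => rfl
  | cons u h ih => rw [pathCoeff, pathCoeff, ih, rootSum_perm h]
  | swap u v l =>
    simp only [pathCoeff, sub_rootSum_cons, stepFactor_sub]
    rw [stepFactor_root_comm hg u v]
    simp only [div_eq_mul_inv]
    ac_rfl
  | trans _ _ h1 h2 => rw [h1, h2]

theorem pathCoeff_append (m : Mono I) (l l' : List (I × Spec)) :
    pathCoeff g m (l ++ l') = pathCoeff g (m - rootSum g l') l * pathCoeff g m l' := by
  induction l with
  | nil => simp [pathCoeff]
  | cons u l ih =>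
    rw [List.cons_append, pathCoeff, ih, pathCoeff, rootSum_append]
    rw [show m - (rootSum g l + rootSum g l') = m - rootSum g l' - rootSum g l by abel]
    ac_rfl

theorem IsPath.reach {m : Mono I} : ∀ {l : List (I × Spec)}, IsPath g m l →
    Reach g m l.length (m - rootSum g l)
  | [], _ => by rw [rootSum_nil, sub_zero]; exact .start
  | u :: l, h => by rw [sub_rootSum_cons]; exact (IsPath.reach h.1).step h.2

theorem Reach.exists_path {m M : Mono I} {n : ℕ} (h : Reach g m n M) :
    ∃ l, IsPath g m l ∧ l.length = n ∧ M = m - rootSum g l := by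
  induction h with
  | start => exact ⟨[], trivial, rfl, by rw [rootSum_nil, sub_zero]⟩
  | @step n M j a _ hadm ih =>
    obtain ⟨l, hl, rfl, rfl⟩ := ih
    exact ⟨(j, a) :: l, ⟨hl, hadm⟩, rfl, by rw [sub_rootSum_cons]⟩

theorem IsPath.coeff (hr : ∀ i, 0 < g.r i) {m : Mono I} {n : ℕ}
    (hn : ∀ k ≤ n, ∀ M, Reach g m k M → Regular g M ∧ Generic M) :
    ∀ {l : List (I × Spec)}, IsPath g m l → l.length ≤ n →
      (∃ c : K, c ≠ 0 ∧ algebraMap K F c = pathCoeff g m l) ∧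
        IsPathCoeff g m (m - rootSum g l) (pathCoeff g m l : F)
  | [], _, _ => ⟨⟨1, one_ne_zero, map_one _⟩, by rw [rootSum_nil, sub_zero]; exact .start⟩
  | u :: l, h, hl => by
    rw [List.length_cons] at hl
    obtain ⟨⟨c, hc, hc'⟩, hp⟩ := IsPath.coeff hr hn h.1 (by omega)
    obtain ⟨h1, h2⟩ := hn _ (by omega) _ h.1.reach
    have h3 := (hn _ (by simpa using hl) _ h.reach).2
    rw [sub_rootSum_cons] at h3 ⊢
    obtain ⟨⟨w, hw⟩, h4⟩ := step_ratio h2 h.2 (h.2.opposite_eq_zero h1 (hr _) h3)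
    rw [pathCoeff, Units.val_mul, ← h4]
    refine ⟨⟨c * (w⁻¹ : Kˣ), mul_ne_zero hc (Units.ne_zero _), ?_⟩, .step hp h.2⟩
    rw [map_mul, hc']
    congr 1
    rw [← hw, map_mul, div_mul_cancel_left₀]
    · exact map_units_inv _ _
    · intro h0
      rw [map_eq_zero_iff _ (IsFractionRing.injective K F)] at h0
      rw [h0, zero_mul] at hw
      exact stepDen_ne_zero h1 h.2 hw.symm

theorem IsPathCoeff.exists_path (hr : ∀ i, 0 < g.r i) {m : Mono I} {n : ℕ}
    (hn : ∀ k ≤ n, ∀ M, Reach g m k M → Regular g M ∧ Generic M) {M : Mono I} {x : F}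
    (h : IsPathCoeff g m M x) :
    ∃ l, IsPath g m l ∧ M = m - rootSum g l ∧ (l.length ≤ n → x = pathCoeff g m l) := by
  induction h with
  | start => exact ⟨[], trivial, by rw [rootSum_nil, sub_zero], fun _ => rfl⟩
  | @step M x j a _ hadm ih =>
    obtain ⟨l, hl, rfl, hx⟩ := ih
    refine ⟨(j, a) :: l, ⟨hl, hadm⟩, by rw [sub_rootSum_cons]; rfl, fun hlen => ?_⟩
    rw [List.length_cons] at hlen
    obtain ⟨h1, h2⟩ := hn _ (by omega) _ hl.reach
    have h3 := (hn _ (by simpa using hlen) _ (IsPath.reach (l := (j, a) :: l) ⟨hl, hadm⟩)).2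
    rw [sub_rootSum_cons] at h3
    rw [hx (by omega), (step_ratio h2 hadm (hadm.opposite_eq_zero h1 (hr _) h3)).2, pathCoeff,
      Units.val_mul (pathCoeff g m l)]

theorem isPathCoeff_iff (hg : g.IsFinite) {m : Mono I} {n : ℕ}
    (hn : ∀ k ≤ n, ∀ M, Reach g m k M → Regular g M ∧ Generic M) {l : List (I × Spec)}
    (hl : IsPath g m l) (hln : l.length ≤ n) (x : F) :
    IsPathCoeff g m (m - rootSum g l) x ↔ x = pathCoeff g m l := by
  constructor
  · intro h
    obtain ⟨l', -, h2, h3⟩ := h.exists_path hg.r_pos hn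
    have hp := perm_of_rootSum_eq hg.r_pos (sub_right_injective h2)
    rw [pathCoeff_perm hg m hp]
    exact h3 (hp.length_eq ▸ hln)
  · rintro rfl
    exact (hl.coeff hg.r_pos hn hln).2

theorem coefficients_wellDefined (hg : g.IsFinite) {m : Mono I} {n : ℕ} (hn : NotFailed g m n)
    {M : Mono I} (hM : M ∈ created g m n) :
    (∀ j a, Admissible g M j a → stepDen g M j a ≠ 0) ∧
      ∃ c : K, c ≠ 0 ∧ ∀ x : F, IsPathCoeff g m M x ↔ x = algebraMap K F c := by
  have hn' : ∀ k ≤ n, ∀ M, Reach g m k M → Regular g M ∧ Generic M :=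
    fun k hk M hM => hn M (mem_created_iff.2 ⟨k, hk, hM⟩)
  refine ⟨fun j a => stepDen_ne_zero (hn M hM).1, ?_⟩
  obtain ⟨k, hk, hkM⟩ := mem_created_iff.1 hM
  obtain ⟨l, hl, rfl, rfl⟩ := hkM.exists_path
  obtain ⟨c, hc, hc'⟩ := (hl.coeff hg.r_pos hn' hk).1
  refine ⟨c, hc, fun x => ?_⟩
  rw [isPathCoeff_iff hg hn' hl hk, hc']

end DeformedW

end

noncomputable section

namespace DeformedW

variable {I : Type*} [Fintype I] [DecidableEq I] {g : CartanData I}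

/-! ### Strips -/

variable (g) in
/-- `p` and `s` are the two shifts `q^(-2r_j)` and `t^2`, in either order. -/
def Directions (j : I) (p s : Spec) : Prop :=
  (p = qt (-2 * g.r j) 0 ∧ s = qt 0 2) ∨ (p = qt 0 2 ∧ s = qt (-2 * g.r j) 0)

/-- The degree in `Y_j(za p^i s^c)`. -/
def dcell (j : I) (p s a : Spec) (M : Mono I) (i c : ℤ) : ℤ := M (j, a * (p ^ i * s ^ c))

variable {j : I} {p s a : Spec} {M : Mono I}

theorem Directions.mul_eq (d : Directions g j p s) : p * s = qt (-2 * g.r j) 2 := by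
  rcases d with ⟨rfl, rfl⟩ | ⟨rfl, rfl⟩ <;> rw [qt_mul] <;> simp

theorem Directions.inj (d : Directions g j p s) (hr : 0 < g.r j) {i c i' c' : ℤ} :
    a * (p ^ i * s ^ c) = a * (p ^ i' * s ^ c') ↔ i = i' ∧ c = c' := by
  have h0 : (-2 * (g.r j : ℤ)) ≠ 0 := by omega
  rcases d with ⟨rfl, rfl⟩ | ⟨rfl, rfl⟩ <;>
  simp only [qt_zpow, qt_mul, mul_qt_inj, mul_zero, add_zero, zero_add, mul_eq_mul_right_iff, h0,
    or_false, OfNat.ofNat_ne_zero] <;> tauto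

theorem dcell_shift (i c : ℤ) : dcell j p s (a * p) M i c = dcell j p s a M (i + 1) c := by
  rw [dcell, dcell, zpow_add_one]
  congr 2
  ac_rfl

theorem dcell_root (d : Directions g j p s) (hr : 0 < g.r j) (i c : ℤ) :
    dcell j p s a (root g j a) i c =
      (if i = 0 ∧ c = 0 then 1 else 0) + (if i = 1 ∧ c = 1 then 1 else 0) := by
  have h0 := d.inj hr (a := a) (i := 0) (c := 0) (i' := i) (c' := c)
  have h1 := d.inj hr (a := a) (i := 1) (c := 1) (i' := i) (c' := c)
  rw [zpow_zero, zpow_zero, mul_one, mul_one] at h0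
  rw [zpow_one, zpow_one, d.mul_eq] at h1
  rw [dcell, root_apply_same]
  simp only [h0, h1, eq_comm]

theorem dcell_add (M N : Mono I) (i c : ℤ) :
    dcell j p s a (M + N) i c = dcell j p s a M i c + dcell j p s a N i c := rfl

theorem dcell_sub (M N : Mono I) (i c : ℤ) :
    dcell j p s a (M - N) i c = dcell j p s a M i c - dcell j p s a N i c := rfl

theorem Directions.regular (d : Directions g j p s) (hM : Regular g M) (a : Spec) (i c : ℤ) :
    (0 < dcell j p s a M i c → 0 ≤ dcell j p s a M (i + 1) c ∧ 0 ≤ dcell j p s a M i (c + 1)) ∧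
    (0 < dcell j p s a M i c → 0 < dcell j p s a M (i + 1) (c + 1) →
      0 < dcell j p s a M (i + 1) c ∧ 0 < dcell j p s a M i (c + 1)) ∧
    (dcell j p s a M i c < 0 → dcell j p s a M (i + 1) (c + 1) < 0 →
      dcell j p s a M (i + 1) c < 0 ∧ dcell j p s a M i (c + 1) < 0) := by
  have e1 : a * (p ^ (i + 1) * s ^ c) = a * (p ^ i * s ^ c) * p := by
    rw [zpow_add_one]; ac_rfl
  have e2 : a * (p ^ i * s ^ (c + 1)) = a * (p ^ i * s ^ c) * s := by
    simp only [zpow_add_one, mul_assoc]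
  have e3 : a * (p ^ (i + 1) * s ^ (c + 1)) = a * (p ^ i * s ^ c) * (p * s) := by
    rw [zpow_add_one p, zpow_add_one s]; ac_rfl
  simp only [dcell, e1, e2, e3, d.mul_eq]
  have := hM j (a * (p ^ i * s ^ c))
  rcases d with ⟨rfl, rfl⟩ | ⟨rfl, rfl⟩
  · exact this
  · tauto

theorem Directions.admissible_iff (d : Directions g j p s) :
    Admissible g M j a ↔ 0 < dcell j p s a M 0 0 ∧ dcell j p s a M 1 0 = 0 ∧
      dcell j p s a M 0 1 = 0 := by
  simp only [Admissible, dcell, zpow_zero, zpow_one, mul_one, one_mul]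
  rcases d with ⟨rfl, rfl⟩ | ⟨rfl, rfl⟩
  · exact Iff.rfl
  · tauto

theorem Directions.reversible_iff (d : Directions g j p s) :
    Reversible g M j a ↔ dcell j p s a M 1 1 = -1 ∧ dcell j p s a M 0 1 = 0 ∧
      dcell j p s a M 1 0 = 0 := by
  simp only [Reversible, dcell, zpow_zero, zpow_one, mul_one, one_mul, d.mul_eq]
  rcases d with ⟨rfl, rfl⟩ | ⟨rfl, rfl⟩
  · exact Iff.rfl
  · tauto

/-- The steps `a, ap, …, ap^(n-1)`. -/
def strip (j : I) (p : Spec) : Spec → ℕ → List (I × Spec)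
  | _, 0 => []
  | a, n + 1 => (j, a) :: strip j p (a * p) n

theorem dcell_strip (d : Directions g j p s) (hr : 0 < g.r j) (n : ℕ) : ∀ (a : Spec) (i c : ℤ),
    dcell j p s a (rootSum g (strip j p a n)) i c =
      (if 0 ≤ i ∧ i < n ∧ c = 0 then 1 else 0) + (if 1 ≤ i ∧ i ≤ n ∧ c = 1 then 1 else 0) := by
  induction n with
  | zero =>
    intro a i c
    rw [if_neg (by push_cast; omega), if_neg (by push_cast; omega)]
    rfl
  | succ n ih =>
    intro a i c
    rw [strip, rootSum_cons, dcell_add, dcell_root d hr]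
    have := ih (a * p) (i - 1) c
    rw [dcell_shift, sub_add_cancel] at this
    rw [this]
    push_cast
    split_ifs <;> omega

theorem dcell_strip_zero (d : Directions g j p s) (hr : 0 < g.r j) (n : ℕ) (a : Spec) (i : ℤ) :
    dcell j p s a (rootSum g (strip j p a n)) i 0 = if 0 ≤ i ∧ i < n then 1 else 0 := by
  rw [dcell_strip d hr]
  simp

theorem dcell_strip_one (d : Directions g j p s) (hr : 0 < g.r j) (n : ℕ) (a : Spec) (i : ℤ) :
    dcell j p s a (rootSum g (strip j p a n)) i 1 = if 1 ≤ i ∧ i ≤ n then 1 else 0 := by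
  rw [dcell_strip d hr]
  simp

variable (j p s) in
/-- A row of `n` factors starting at `a` which can be expanded one after the other. -/
def Expandable (M : Mono I) (a : Spec) (n : ℕ) : Prop :=
  (∀ i : ℤ, 0 ≤ i → i < n → dcell j p s a M i 0 = 1) ∧ dcell j p s a M n 0 = 0 ∧
    ∀ i : ℤ, 0 ≤ i → i ≤ n → dcell j p s a M i 1 = 0

variable (j p s) in
/-- A row of `n` factors which arises by expanding another one. -/
def Expanded (M : Mono I) (a : Spec) (n : ℕ) : Prop :=
  (∀ i : ℤ, 0 ≤ i → i ≤ n → dcell j p s a M i 0 = 0) ∧ dcell j p s a M 0 1 = 0 ∧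
    ∀ i : ℤ, 1 ≤ i → i ≤ n → dcell j p s a M i 1 = -1

theorem expanded_iff (d : Directions g j p s) (hr : 0 < g.r j) {n : ℕ} :
    Expanded j p s (M - rootSum g (strip j p a n)) a n ↔ Expandable j p s M a n := by
  simp only [Expanded, Expandable, dcell_sub, dcell_strip_zero d hr, dcell_strip_one d hr]
  constructor
  · rintro ⟨h1, h2, h3⟩
    refine ⟨fun i hi hn => ?_, ?_, fun i hi hn => ?_⟩
    · have := h1 i hi hn.le
      split_ifs at this <;> omega
    · have := h1 n (by omega) le_rfl
      split_ifs at this <;> omega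
    · rcases eq_or_lt_of_le hi with rfl | hi
      · split_ifs at h2 <;> omega
      · have := h3 i (by omega) hn
        split_ifs at this <;> omega
  · rintro ⟨h1, h2, h3⟩
    refine ⟨fun i hi hn => ?_, ?_, fun i hi hn => ?_⟩
    · rcases eq_or_lt_of_le hn with rfl | hn
      · split_ifs <;> omega
      · have := h1 i hi hn
        split_ifs <;> omega
    · have := h3 0 le_rfl (by omega)
      split_ifs <;> omega
    · have := h3 i (by omega) hn
      split_ifs <;> omega

theorem Expandable.isPath (d : Directions g j p s) (hr : 0 < g.r j) {m : Mono I}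
    {l : List (I × Spec)} (hl : IsPath g m l) (n : ℕ) : ∀ a,
      Expandable j p s (m - rootSum g l) a n → IsPath g m (strip j p a n ++ l) := by
  induction n with
  | zero => exact fun _ _ => hl
  | succ n ih =>
    rintro a ⟨h1, h2, h3⟩
    refine ⟨ih (a * p) ⟨fun i hi hn => ?_, ?_, fun i hi hn => ?_⟩, ?_⟩
    · rw [dcell_shift]
      exact h1 _ (by omega) (by push_cast; omega)
    · rw [dcell_shift]
      exact_mod_cast h2
    · rw [dcell_shift]
      exact h3 _ (by omega) (by push_cast; omega)
    · have e : ∀ i c, dcell j p s a (rootSum g (strip j p (a * p) n)) i c =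
          dcell j p s (a * p) (rootSum g (strip j p (a * p) n)) (i - 1) c := fun i c => by
        rw [dcell_shift, sub_add_cancel]
      change Admissible g (m - rootSum g (strip j p (a * p) n ++ l)) j a
      rw [rootSum_append, add_comm, ← sub_sub, d.admissible_iff]
      simp only [dcell_sub _ (rootSum g (strip j p _ n)), e, dcell_strip_zero d hr,
        dcell_strip_one d hr]
      have e1 := h1 0 le_rfl (by push_cast; omega)
      have e2 := h3 0 le_rfl (by push_cast; omega)
      have e3 : dcell j p s a (m - rootSum g l) 1 0 = if 0 < n then 1 else 0 := by
        split_ifs with hn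
        · exact h1 1 (by omega) (by push_cast; omega)
        · obtain rfl : n = 0 := by omega
          exact h2
      rw [e1, e2, e3]
      split_ifs <;> omega

theorem Expanded.reach (d : Directions g j p s) (hr : 0 < g.r j) {m : Mono I}
    (hN : ∀ n, Contracts g m n) (n : ℕ) :
    ∀ (N : ℕ) (M : Mono I) (a : Spec), Reach g m N M → Expanded j p s M a n →
      ∃ N', Reach g m N' (M + rootSum g (strip j p a n)) := by
  induction n with
  | zero =>
    intro N M a hM _
    exact ⟨N, by rwa [strip, rootSum_nil, add_zero]⟩
  | succ n ih =>
    rintro N M a hM ⟨h1, h2, h3⟩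
    obtain ⟨N', -, hN'⟩ := hN N M j a hM (d.reversible_iff.2
      ⟨h3 1 le_rfl (by push_cast; omega), h2, h1 1 (by omega) (by push_cast; omega)⟩)
    obtain ⟨N'', hN''⟩ := ih N' _ (a * p) hN' ⟨fun i hi hn => by
      rw [dcell_shift, dcell_add, dcell_root d hr, if_neg (by omega), if_neg (by omega),
        add_zero, add_zero]
      exact h1 _ (by omega) (by push_cast; omega), by
      rw [dcell_shift, dcell_add, dcell_root d hr, if_neg (by omega), if_pos (by omega)]
      have := h3 1 le_rfl (by push_cast; omega)
      rw [zero_add]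
      omega, fun i hi hn => by
      rw [dcell_shift, dcell_add, dcell_root d hr, if_neg (by omega), if_neg (by omega),
        add_zero, add_zero]
      exact h3 _ (by omega) (by push_cast; omega)⟩
    exact ⟨N'', by rwa [strip, rootSum_cons, ← add_assoc]⟩

theorem Expandable.unique {n n' : ℕ} (h : Expandable j p s M a n) (h' : Expandable j p s M a n') :
    n = n' := by
  by_contra hne
  rcases lt_or_gt_of_ne hne with hlt | hlt
  · have := h'.1 n (by omega) (by exact_mod_cast hlt)
    rw [h.2.1] at this
    omega
  · have := h.1 n' (by omega) (by exact_mod_cast hlt)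
    rw [h'.2.1] at this
    omega

theorem exists_dcell_eq_zero (d : Directions g j p s) (hr : 0 < g.r j) (a : Spec) (c : ℤ)
    (M : Mono I) (f : ℕ → ℤ) (hf : Function.Injective f) :
    ∃ n : ℕ, dcell j p s a M (f n) c = 0 := by
  have hinj : Function.Injective fun n : ℕ => (j, a * (p ^ f n * s ^ c)) := by
    intro x y hxy
    exact hf ((d.inj hr).1 (Prod.ext_iff.1 hxy).2).1
  obtain ⟨_, ⟨n, rfl⟩, hn⟩ := (Set.infinite_range_of_injective hinj).exists_notMem_finset M.support
  exact ⟨n, by simpa [dcell] using hn⟩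

theorem exists_expandable (d : Directions g j p s) (hr : 0 < g.r j) (hM : Regular g M)
    (hM' : Generic M)
    (hgen : ∀ a, Admissible g M j a → Generic (M - root g j a))
    (h1 : dcell j p s a M 0 0 = 1) (h2 : dcell j p s a M 0 1 = 0) :
    ∃ n, 0 < n ∧ Expandable j p s M a n := by
  classical
  have hG : ∀ i c, -1 ≤ dcell j p s a M i c ∧ dcell j p s a M i c ≤ 1 := fun i c => by
    have := hM' j (a * (p ^ i * s ^ c))
    rw [dcell]
    omega
  have hex : ∃ n : ℕ, dcell j p s a M n 0 ≠ 1 := by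
    obtain ⟨n, hn⟩ := exists_dcell_eq_zero d hr a 0 M (fun n => (n : ℤ)) Nat.cast_injective
    exact ⟨n, by omega⟩
  obtain ⟨n, hn⟩ : ∃ n, n + 1 = Nat.find hex := by
    refine ⟨Nat.find hex - 1, Nat.succ_pred fun h : Nat.find hex = 0 => ?_⟩
    have := Nat.find_spec hex
    rw [h] at this
    exact this (by simpa using h1)
  have hspec := Nat.find_spec hex
  have hmin : ∀ i : ℕ, i ≤ n → dcell j p s a M i 0 = 1 := fun i hi =>
    not_ne_iff.1 (Nat.find_min hex (by omega))
  rw [← hn] at hspec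
  push_cast at hspec
  have hs : ∀ i : ℕ, i ≤ n → dcell j p s a M i 1 = 0 := by
    intro i
    induction i with
    | zero => exact fun _ => h2
    | succ i ih =>
      intro hi
      have e1 := hmin _ hi
      have e2 := ih (by omega)
      have e3 := hmin i (by omega)
      have e4 := d.regular hM a i 0
      have e5 := d.regular hM a (i + 1 : ℕ) 0
      have e6 := hG (i + 1 : ℕ) 1
      rw [zero_add] at e4 e5
      push_cast at e1 e5 e6 ⊢
      omega
  have e1 := hmin n le_rfl
  have e2 := hs n le_rfl
  have e4 := d.regular hM a n 0
  have e5 := hG (n + 1) 0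
  have hend : dcell j p s a M (n + 1) 0 = 0 := by omega
  have hadm : Admissible g M j (a * p ^ (n : ℤ)) := by
    rw [d.admissible_iff]
    have e : ∀ i c, dcell j p s (a * p ^ (n : ℤ)) M i c = dcell j p s a M (n + i) c := by
      intro i c
      rw [dcell, dcell, zpow_add]
      congr 2
      ac_rfl
    rw [e, e, e, add_zero]
    omega
  have h0 := hadm.opposite_eq_zero hM hr (hgen _ hadm)
  rw [← d.mul_eq] at h0
  have hend' : dcell j p s a M (n + 1) 1 = 0 := by
    rw [← h0, dcell, zpow_add_one, zpow_one]
    congr 2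
    ac_rfl
  refine ⟨n + 1, by omega, fun i hi hi' => ?_, by exact_mod_cast hend, fun i hi hi' => ?_⟩
  · obtain ⟨i, rfl⟩ := Int.eq_ofNat_of_zero_le hi
    exact hmin i (by omega)
  · obtain ⟨i, rfl⟩ := Int.eq_ofNat_of_zero_le hi
    rcases Nat.lt_or_ge n i with h | h
    · obtain rfl : i = n + 1 := by omega
      exact_mod_cast hend'
    · exact hs i h

theorem exists_expanded (d : Directions g j p s) (hr : 0 < g.r j) (hM : Regular g M)
    (hM' : Generic M) (hrev : ∀ a, Reversible g M j a → M (j, a) = 0)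
    (h1 : dcell j p s a M 0 0 = 0) (h2 : dcell j p s a M 0 1 = -1) :
    ∃ n : ℕ, 0 < n ∧ Expanded j p s M (a * p ^ (-(n : ℤ))) n := by
  classical
  have hG : ∀ i c, -1 ≤ dcell j p s a M i c ∧ dcell j p s a M i c ≤ 1 := fun i c => by
    have := hM' j (a * (p ^ i * s ^ c))
    rw [dcell]
    omega
  have hex : ∃ n : ℕ, dcell j p s a M (-n) 1 ≠ -1 := by
    obtain ⟨n, hn⟩ := exists_dcell_eq_zero d hr a 1 M (fun n => (-n : ℤ)) fun x y h => by
      simpa using h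
    exact ⟨n, by omega⟩
  obtain ⟨n, hn⟩ : ∃ n, n + 1 = Nat.find hex := by
    refine ⟨Nat.find hex - 1, Nat.succ_pred fun h : Nat.find hex = 0 => ?_⟩
    have := Nat.find_spec hex
    rw [h] at this
    exact this (by simpa using h2)
  have hspec := Nat.find_spec hex
  have hmin : ∀ i : ℕ, i ≤ n → dcell j p s a M (-i) 1 = -1 := fun i hi =>
    not_ne_iff.1 (Nat.find_min hex (by omega))
  rw [← hn] at hspec
  have hs : ∀ i : ℕ, i ≤ n → dcell j p s a M (-i) 0 = 0 := by
    intro i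
    induction i with
    | zero => exact fun _ => by simpa using h1
    | succ i ih =>
      intro hi
      have e1 := hmin _ hi
      have e2 := ih (by omega)
      have e3 := hmin i (by omega)
      have e4 := d.regular hM a (-(i + 1 : ℕ)) 0
      have e6 := hG (-(i + 1 : ℕ)) 0
      rw [show (-((i + 1 : ℕ) : ℤ)) + 1 = -i by push_cast; ring, zero_add] at e4
      omega
  have e1 := hmin n le_rfl
  have e2 := hs n le_rfl
  have e4 := d.regular hM a (-(n + 1 : ℕ)) 1
  have e5 := hG (-(n + 1 : ℕ)) 1
  rw [show (-((n + 1 : ℕ) : ℤ)) + 1 = -n by push_cast; ring] at e4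
  have hend : dcell j p s a M (-(n + 1 : ℕ)) 1 = 0 := by omega
  have e : ∀ i c, dcell j p s (a * p ^ (-((n + 1 : ℕ) : ℤ))) M i c =
      dcell j p s a M (i - (n + 1 : ℕ)) c := by
    intro i c
    rw [dcell, dcell, sub_eq_add_neg, zpow_add]
    congr 2
    ac_rfl
  have hz : dcell j p s a M (-(n + 1 : ℕ)) 0 = 0 := by
    have := hrev (a * p ^ (-((n + 1 : ℕ) : ℤ))) (by
      rw [d.reversible_iff, e, e, e]
      rw [show (1 : ℤ) - (n + 1 : ℕ) = -n by push_cast; ring, zero_sub]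
      exact ⟨e1, hend, e2⟩)
    rwa [dcell, zpow_zero, mul_one]
  refine ⟨n + 1, by omega, fun i hi hi' => ?_, ?_, fun i hi hi' => ?_⟩
  · rw [e]
    rcases eq_or_lt_of_le hi with rfl | hi
    · rwa [zero_sub]
    · have := hs (n + 1 - i).toNat (by omega)
      rwa [show (-((n + 1 - i).toNat : ℤ)) = i - (n + 1 : ℕ) by push_cast; omega] at this
  · rwa [e, zero_sub]
  · rw [e]
    have := hmin (n + 1 - i).toNat (by omega)
    rwa [show (-((n + 1 - i).toNat : ℤ)) = i - (n + 1 : ℕ) by push_cast; omega] at this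

theorem Expanded.unique {n n' : ℕ} (h : Expanded j p s M (a * p ^ (-(n : ℤ))) n)
    (h' : Expanded j p s M (a * p ^ (-(n' : ℤ))) n') : n = n' := by
  have e : ∀ (n : ℕ) i c, dcell j p s (a * p ^ (-(n : ℤ))) M i c =
      dcell j p s a M (i - n) c := by
    intro n i c
    rw [dcell, dcell, sub_eq_add_neg, zpow_add]
    congr 2
    ac_rfl
  by_contra hne
  rcases lt_or_gt_of_ne hne with hlt | hlt
  · have h1 := h'.2.2 (n' - n) (by omega) (by omega)
    have h2 := h.2.1
    rw [e] at h1 h2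
    rw [show (n' - n - n' : ℤ) = 0 - n by ring] at h1
    omega
  · have h1 := h.2.2 (n - n') (by omega) (by omega)
    have h2 := h'.2.1
    rw [e] at h1 h2
    rw [show (n - n' - n : ℤ) = 0 - n' by ring] at h1
    omega

end DeformedW

end

noncomputable section

namespace DeformedW

/-! ### Exponentials of power series -/

instance charZero_F : CharZero F :=
  charZero_of_injective_ringHom (f := (algebraMap K F).comp
    ((PowerSeries.C : PowerSeries ℂ →+* K).comp (PowerSeries.C : ℂ →+* PowerSeries ℂ)))
    (RingHom.injective _)

section Exponential

variable {A : Type*} [Ring A] [Algebra F A]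

/-- The derivation `X d/dX` of power series. -/
def euler (f : PowerSeries A) : PowerSeries A :=
  PowerSeries.mk fun n => (n : F) • PowerSeries.coeff n f

theorem coeff_euler (f : PowerSeries A) (n : ℕ) :
    PowerSeries.coeff n (euler f) = (n : F) • PowerSeries.coeff n f := PowerSeries.coeff_mk _ _

theorem euler_add (f f' : PowerSeries A) : euler (f + f') = euler f + euler f' := by
  ext n
  simp only [coeff_euler, map_add, smul_add]

theorem euler_mul (f f' : PowerSeries A) : euler (f * f') = euler f * f' + f * euler f' := by
  ext n
  rw [coeff_euler, map_add, PowerSeries.coeff_mul, PowerSeries.coeff_mul, PowerSeries.coeff_mul,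
    Finset.smul_sum, ← Finset.sum_add_distrib]
  refine Finset.sum_congr rfl fun x hx => ?_
  rw [coeff_euler, coeff_euler, smul_mul_assoc, mul_smul_comm, ← add_smul,
    ← Finset.HasAntidiagonal.mem_antidiagonal.1 hx, Nat.cast_add]

theorem euler_one : euler (1 : PowerSeries A) = 0 := by
  ext n
  rw [coeff_euler, PowerSeries.coeff_one]
  split_ifs with h
  · rw [h]; simp
  · simp

theorem euler_pow {f : PowerSeries A} (h : Commute f (euler f)) (k : ℕ) :
    euler (f ^ (k + 1)) = ((k + 1 : ℕ) : PowerSeries A) * (euler f * f ^ k) := by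
  induction k with
  | zero => simp
  | succ k ih =>
    have e : f * (((k + 1 : ℕ) : PowerSeries A) * (euler f * f ^ k)) =
        ((k + 1 : ℕ) : PowerSeries A) * (euler f * f ^ (k + 1)) := by
      rw [← mul_assoc f, ← (Nat.cast_commute (k + 1) f).eq, mul_assoc, ← mul_assoc f, h.eq,
        mul_assoc, ← pow_succ']
    rw [pow_succ' f (k + 1), euler_mul, ih, e, Nat.cast_succ (k + 1), add_mul, one_mul, add_comm]

theorem coeff_pow_eq_zero {f : PowerSeries A} (h0 : PowerSeries.coeff 0 f = 0) (k : ℕ) :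
    ∀ l < k, PowerSeries.coeff l (f ^ k) = 0 := by
  induction k with
  | zero => intro l hl; omega
  | succ k ih =>
    intro l hl
    rw [pow_succ', PowerSeries.coeff_mul]
    refine Finset.sum_eq_zero fun x hx => ?_
    have hx' := Finset.HasAntidiagonal.mem_antidiagonal.1 hx
    rcases Nat.eq_zero_or_pos x.1 with h | h
    · rw [h, h0, zero_mul]
    · rw [ih x.2 (by omega), mul_zero]

theorem expCoeff_eq_sum {f : PowerSeries A} (h0 : PowerSeries.coeff 0 f = 0) {l n : ℕ}
    (hn : l < n) : expCoeff f l =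
      ∑ k ∈ Finset.range n, ((k.factorial : F))⁻¹ • PowerSeries.coeff l (f ^ k) := by
  rw [expCoeff]
  refine Finset.sum_subset (Finset.range_mono hn) fun k _ hk => ?_
  rw [coeff_pow_eq_zero h0 k l (by simpa using hk), smul_zero]

/-- The exponential of a power series without constant term. -/
def expSeries (f : PowerSeries A) : PowerSeries A := PowerSeries.mk (expCoeff f)

theorem coeff_expSeries (f : PowerSeries A) (l : ℕ) :
    PowerSeries.coeff l (expSeries f) = expCoeff f l := PowerSeries.coeff_mk _ _

theorem expCoeff_zero (f : PowerSeries A) : expCoeff f 0 = 1 := by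
  simp [expCoeff]

theorem euler_expSeries {f : PowerSeries A} (h0 : PowerSeries.coeff 0 f = 0)
    (h : Commute f (euler f)) : euler (expSeries f) = euler f * expSeries f := by
  ext l
  rw [coeff_euler, coeff_expSeries, expCoeff, Finset.smul_sum, Finset.sum_range_succ',
    PowerSeries.coeff_mul]
  have e0 : (l : F) • ((Nat.factorial 0 : F))⁻¹ • PowerSeries.coeff l (f ^ 0) = 0 := by
    rw [smul_comm, ← coeff_euler, pow_zero, euler_one, map_zero, smul_zero]
  have e1 : ∀ k, (l : F) • (((k + 1).factorial : F))⁻¹ • PowerSeries.coeff l (f ^ (k + 1)) =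
      ((k.factorial : F))⁻¹ • PowerSeries.coeff l (euler f * f ^ k) := by
    intro k
    rw [smul_comm, ← coeff_euler, euler_pow h, ← nsmul_eq_mul, map_nsmul,
      ← Nat.cast_smul_eq_nsmul F, smul_smul, Nat.factorial_succ, Nat.cast_mul, mul_inv,
      mul_right_comm, inv_mul_cancel₀ (Nat.cast_ne_zero.2 k.succ_ne_zero), one_mul]
  rw [e0, add_zero, Finset.sum_congr rfl fun k _ => e1 k]
  simp only [PowerSeries.coeff_mul, Finset.smul_sum]
  rw [Finset.sum_comm]
  refine Finset.sum_congr rfl fun x hx => ?_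
  have hx' := Finset.HasAntidiagonal.mem_antidiagonal.1 hx
  rw [coeff_expSeries, coeff_euler]
  rcases Nat.eq_zero_or_pos x.1 with h1 | h1
  · simp [h1]
  · rw [expCoeff_eq_sum h0 (show x.2 < l by omega), Finset.mul_sum]
    exact Finset.sum_congr rfl fun k _ => (mul_smul_comm _ _ _).symm

theorem euler_unique {h Y Z : PowerSeries A} (h0 : PowerSeries.coeff 0 h = 0)
    (hY : euler Y = h * Y) (hZ : euler Z = h * Z)
    (hYZ : PowerSeries.coeff 0 Y = PowerSeries.coeff 0 Z) : Y = Z := by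
  ext l
  induction l using Nat.strong_induction_on with
  | _ l ih =>
  rcases Nat.eq_zero_or_pos l with rfl | hl
  · exact hYZ
  have e : (l : F) • PowerSeries.coeff l Y = (l : F) • PowerSeries.coeff l Z := by
    rw [← coeff_euler, ← coeff_euler, hY, hZ, PowerSeries.coeff_mul, PowerSeries.coeff_mul]
    refine Finset.sum_congr rfl fun x hx => ?_
    have hx' := Finset.HasAntidiagonal.mem_antidiagonal.1 hx
    rcases Nat.eq_zero_or_pos x.1 with h1 | h1
    · rw [h1, h0, zero_mul, zero_mul]
    · rw [ih x.2 (by omega)]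
  have hl' : (l : F) ≠ 0 := Nat.cast_ne_zero.2 hl.ne'
  simpa only [smul_smul, inv_mul_cancel₀ hl', one_smul] using congrArg ((l : F)⁻¹ • ·) e

theorem coeff_zero_euler (f : PowerSeries A) : PowerSeries.coeff 0 (euler f) = 0 := by
  rw [coeff_euler, Nat.cast_zero, zero_smul]

/-- The coefficients of `f` commute with those of `f'`. -/
def CoeffCommute (f f' : PowerSeries A) : Prop :=
  ∀ i j, Commute (PowerSeries.coeff i f) (PowerSeries.coeff j f')

theorem CoeffCommute.symm {f f' : PowerSeries A} (h : CoeffCommute f f') : CoeffCommute f' f :=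
  fun i j => (h j i).symm

theorem CoeffCommute.commute {f f' : PowerSeries A} (h : CoeffCommute f f') : Commute f f' := by
  ext l
  rw [PowerSeries.coeff_mul, PowerSeries.coeff_mul, ← Finset.Nat.sum_antidiagonal_swap]
  exact Finset.sum_congr rfl fun x _ => (h _ _).eq

theorem CoeffCommute.euler {f f' : PowerSeries A} (h : CoeffCommute f f') :
    CoeffCommute f (euler f') := fun i j => by
  rw [coeff_euler]
  exact (h i j).smul_right _

theorem CoeffCommute.pow {f f' : PowerSeries A} (h : CoeffCommute f f') (k : ℕ) :
    CoeffCommute f (f' ^ k) := by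
  induction k with
  | zero =>
    intro i j
    rw [pow_zero, PowerSeries.coeff_one]
    split_ifs
    · exact Commute.one_right _
    · exact Commute.zero_right _
  | succ k ih =>
    intro i j
    rw [pow_succ, PowerSeries.coeff_mul]
    exact Commute.sum_right _ _ _ fun x _ => (ih _ _).mul_right (h _ _)

theorem CoeffCommute.expSeries {f f' : PowerSeries A} (h : CoeffCommute f f') :
    CoeffCommute f (expSeries f') := fun i j => by
  rw [coeff_expSeries, expCoeff]
  exact Commute.sum_right _ _ _ fun k _ => (h.pow k i j).smul_right _

theorem expSeries_add {f f' : PowerSeries A} (h0 : PowerSeries.coeff 0 f = 0)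
    (h0' : PowerSeries.coeff 0 f' = 0) (h : CoeffCommute f f) (h' : CoeffCommute f' f')
    (hc : CoeffCommute f f') : expSeries (f + f') = expSeries f * expSeries f' := by
  refine euler_unique (coeff_zero_euler (f + f')) (euler_expSeries ?_ ?_) ?_ ?_
  · rw [map_add, h0, h0', add_zero]
  · rw [euler_add]
    exact ((h.euler.commute).add_left hc.symm.euler.commute).add_right
      (hc.euler.commute.add_left h'.euler.commute)
  · rw [euler_mul, euler_expSeries h0 h.euler.commute, euler_expSeries h0' h'.euler.commute,
      euler_add, add_mul, mul_assoc, ← mul_assoc _ (euler f'),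
      (hc.symm.expSeries.symm.euler.commute).eq, mul_assoc]
  · rw [PowerSeries.coeff_mul]
    simp [coeff_expSeries, expCoeff_zero]

theorem coeff_pow_rescale {R : Type*} [CommRing R] [Algebra R A] (x : R) (f : PowerSeries A) (k : ℕ) : ∀ l : ℕ,
    PowerSeries.coeff l ((PowerSeries.mk fun n => x ^ n • PowerSeries.coeff n f) ^ k) =
      x ^ l • PowerSeries.coeff l (f ^ k) := by
  induction k with
  | zero =>
    intro l
    rw [pow_zero, pow_zero, PowerSeries.coeff_one]
    split_ifs with h
    · rw [h]; simp
    · simp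
  | succ k ih =>
    intro l
    rw [pow_succ, pow_succ, PowerSeries.coeff_mul, PowerSeries.coeff_mul, Finset.smul_sum]
    refine Finset.sum_congr rfl fun y hy => ?_
    rw [ih, PowerSeries.coeff_mk, smul_mul_smul_comm, ← pow_add,
      Finset.HasAntidiagonal.mem_antidiagonal.1 hy]

theorem expCoeff_rescale {R : Type*} [CommRing R] [Algebra R A] [SMulCommClass F R A] (x : R)
     (f : PowerSeries A) (l : ℕ) :
    expCoeff (PowerSeries.mk fun n => x ^ n • PowerSeries.coeff n f) l = x ^ l • expCoeff f l := by
  rw [expCoeff, expCoeff, Finset.smul_sum]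
  exact Finset.sum_congr rfl fun k _ => by rw [coeff_pow_rescale, smul_comm]

theorem expCoeff_map {A' : Type*} [Ring A'] [Algebra F A'] (φ : A →ₐ[F] A') (f : PowerSeries A)
    (l : ℕ) : expCoeff (PowerSeries.map φ.toRingHom f) l = φ (expCoeff f l) := by
  rw [expCoeff, expCoeff, map_sum]
  refine Finset.sum_congr rfl fun k _ => ?_
  rw [← map_pow, PowerSeries.coeff_map, map_smul]
  rfl

end Exponential

/-! ### Exponentials of derivations -/

section Derivations

variable {B : Type*} [CommRing B] [Algebra F B] {f : PowerSeries (Module.End F B)}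

/-- The generating series of the values at `u` of the exponential of a series of operators. -/
def expApply (f : PowerSeries (Module.End F B)) (u : B) : PowerSeries B :=
  PowerSeries.mk fun l => expCoeff f l u

theorem coeff_expApply (u : B) (l : ℕ) : PowerSeries.coeff l (expApply f u) = expCoeff f l u :=
  PowerSeries.coeff_mk _ _

theorem expApply_mul (h0 : PowerSeries.coeff 0 f = 0) (hf : CoeffCommute f f)
    (hD : ∀ n u v, PowerSeries.coeff n f (u * v) =
      PowerSeries.coeff n f u * v + u * PowerSeries.coeff n f v) (u v : B) :
    expApply f (u * v) = expApply f u * expApply f v := by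
  set M : PowerSeries B →+* PowerSeries (Module.End F B) :=
    PowerSeries.map (Algebra.lmul F B).toRingHom with hM
  have hM' : ∀ Y l, PowerSeries.coeff l (M Y) = (Algebra.lmul F B) (PowerSeries.coeff l Y) :=
    fun Y l => PowerSeries.coeff_map _ _ _
  have hl : ∀ a b : B, (Algebra.lmul F B) a b = a * b := fun _ _ => rfl
  have hE := euler_expSeries h0 hf.euler.commute
  have key : expSeries f * PowerSeries.C (Algebra.lmul F B u) = M (expApply f u) * expSeries f := by
    refine euler_unique (coeff_zero_euler f) ?_ ?_ ?_
    · rw [euler_mul, hE, mul_assoc]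
      have : euler (PowerSeries.C (Algebra.lmul F B u)) = 0 := by
        ext1 n
        rw [coeff_euler, PowerSeries.coeff_C]
        split_ifs with h
        · rw [h]; simp
        · simp
      rw [this, mul_zero, add_zero]
    · have e : euler f * M (expApply f u) =
          euler (M (expApply f u)) + M (expApply f u) * euler f := by
        ext1 l
        have e1 : PowerSeries.coeff l (euler (M (expApply f u))) =
            ∑ x ∈ Finset.HasAntidiagonal.antidiagonal l,
              (Algebra.lmul F B) (PowerSeries.coeff x.1 (euler f) (expCoeff f x.2 u)) := by
          rw [coeff_euler, hM', coeff_expApply, ← map_smul, ← LinearMap.smul_apply,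
            ← coeff_expSeries, ← coeff_euler, hE, PowerSeries.coeff_mul, LinearMap.sum_apply,
            map_sum]
          simp only [coeff_expSeries, Module.End.mul_apply]
        rw [map_add, e1, PowerSeries.coeff_mul, PowerSeries.coeff_mul,
          ← Finset.Nat.sum_antidiagonal_swap (f := fun x => PowerSeries.coeff x.1 (M (expApply f u)) *
            PowerSeries.coeff x.2 (euler f)), ← Finset.sum_add_distrib]
        refine Finset.sum_congr rfl fun x _ => ?_
        simp only [Prod.fst_swap, Prod.snd_swap, hM', coeff_expApply]
        ext v
        simp only [Module.End.mul_apply, LinearMap.add_apply, hl, coeff_euler,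
          LinearMap.smul_apply, hD, smul_add, smul_mul_assoc, mul_smul_comm]
      rw [euler_mul, hE, ← mul_assoc, ← add_mul, ← e, mul_assoc]
    · rw [PowerSeries.coeff_mul, PowerSeries.coeff_mul]
      simp [coeff_expSeries, expCoeff_zero, hM', coeff_expApply]
  ext l
  have := congrArg (fun z : PowerSeries (Module.End F B) => PowerSeries.coeff l z v) key
  simp only [PowerSeries.coeff_mul_C, coeff_expSeries, Module.End.mul_apply,
    hl] at this
  rw [coeff_expApply, this, PowerSeries.coeff_mul, PowerSeries.coeff_mul, LinearMap.sum_apply]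
  simp only [hM', coeff_expApply, coeff_expSeries, Module.End.mul_apply, hl]

theorem expApply_of_linear (h0 : PowerSeries.coeff 0 f = 0) (hf : CoeffCommute f f)
    {u : B} (hu : ∀ n n', PowerSeries.coeff n f (PowerSeries.coeff n' f u) = 0) :
    expApply f u = PowerSeries.C u + PowerSeries.mk fun n => PowerSeries.coeff n f u := by
  ext l
  rw [coeff_expApply, map_add, PowerSeries.coeff_C, PowerSeries.coeff_mk]
  induction l using Nat.strong_induction_on with
  | _ l ih =>
  rcases Nat.eq_zero_or_pos l with rfl | hl
  · rw [expCoeff_zero, if_pos rfl, h0, LinearMap.zero_apply, add_zero]; rfl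
  have e : (l : F) • expCoeff f l u = (l : F) • PowerSeries.coeff l f u := by
    rw [← LinearMap.smul_apply, ← coeff_expSeries, ← coeff_euler,
      euler_expSeries h0 hf.euler.commute, PowerSeries.coeff_mul, LinearMap.sum_apply,
      Finset.sum_eq_single (l, 0)]
    · rw [Module.End.mul_apply, coeff_expSeries, expCoeff_zero, coeff_euler, Module.End.one_apply,
        LinearMap.smul_apply]
    · intro x hx hne
      have hx' := Finset.HasAntidiagonal.mem_antidiagonal.1 hx
      have h2 : x.2 ≠ 0 := fun h => hne (Prod.ext (by simp only; omega) h)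
      rw [Module.End.mul_apply, coeff_expSeries, coeff_euler, LinearMap.smul_apply]
      rcases Nat.eq_zero_or_pos x.1 with h1 | h1
      · rw [h1, Nat.cast_zero, zero_smul]
      · rw [ih x.2 (by omega), if_neg h2, zero_add, hu, smul_zero]
    · intro h
      exact absurd (Finset.HasAntidiagonal.mem_antidiagonal.2 (add_zero l)) h
  rw [if_neg hl.ne', zero_add]
  have hl' : (l : F) ≠ 0 := Nat.cast_ne_zero.2 hl.ne'
  simpa only [smul_smul, inv_mul_cancel₀ hl', one_smul] using congrArg ((l : F)⁻¹ • ·) e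

/-- The exponential of a series of commuting derivations is multiplicative. -/
def expApplyHom (h0 : PowerSeries.coeff 0 f = 0) (hf : CoeffCommute f f)
    (hD : ∀ n u v, PowerSeries.coeff n f (u * v) =
      PowerSeries.coeff n f u * v + u * PowerSeries.coeff n f v) : B →ₐ[F] PowerSeries B :=
  AlgHom.ofLinearMap
    { toFun := expApply f
      map_add' := fun u v => by ext l; simp only [coeff_expApply, map_add]
      map_smul' := fun x u => by
        ext l
        rw [coeff_expApply, map_smul, RingHom.id_apply, PowerSeries.coeff_smul, coeff_expApply] }
    (by
      have h1 : ∀ n, PowerSeries.coeff n f 1 = 0 := fun n => by simpa using hD n 1 1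
      refine (expApply_of_linear h0 hf fun n n' => by rw [h1, map_zero]).trans ?_
      ext l
      rw [map_add, PowerSeries.coeff_mk, h1, add_zero, map_one])
    (expApply_mul h0 hf hD)

end Derivations

end DeformedW

end

noncomputable section

namespace DeformedW

/-! ### Operators on Fock space -/

variable {I : Type*} [Fintype I] [DecidableEq I] (g : CartanData I)

theorem derivation_sum_apply {R B ι : Type*} [CommRing R] [CommRing B] [Algebra R B] (t : Finset ι)
    (d : ι → Derivation R B B) (u : B) : (∑ i ∈ t, d i) u = ∑ i ∈ t, d i u := by
  rw [← Derivation.coeFnAddMonoidHom_apply, map_sum, Finset.sum_apply]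
  rfl

theorem CoeffCommute.all {B : Type*} [CommRing B] (f f' : PowerSeries B) : CoeffCommute f f' :=
  fun _ _ => Commute.all _ _

/-- The annihilation part of a combination of generators, as a derivation. -/
def modeDerivation (c : I → F) (n : ℕ) : Derivation F (FockPoly I) (FockPoly I) :=
  if hn : 0 < n then ∑ i, ∑ j, (c i * kappa g i j n) • MvPolynomial.pderiv (j, n.toPNat hn)
  else 0

theorem mode_zero (c : I → F) : mode g c 0 = 0 := by
  simp [mode, xOp]

theorem mode_natCast (c : I → F) (n : ℕ) :
    mode g c n = (modeDerivation g c n).toLinearMap := by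
  rcases Nat.eq_zero_or_pos n with rfl | hn
  · rw [Nat.cast_zero, mode_zero, modeDerivation, dif_neg (lt_irrefl 0)]; rfl
  have hn' : 0 < (n : ℤ) := by omega
  rw [modeDerivation, dif_pos hn, mode]
  refine LinearMap.ext fun u => ?_
  refine Eq.trans ?_ (derivation_sum_apply _ _ _).symm
  rw [LinearMap.sum_apply]
  refine Finset.sum_congr rfl fun i _ => ?_
  refine Eq.trans ?_ (derivation_sum_apply _ _ _).symm
  rw [LinearMap.smul_apply, xOp, dif_pos hn', LinearMap.sum_apply, Finset.smul_sum]
  exact Finset.sum_congr rfl fun j _ => smul_smul _ _ _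

theorem modeDerivation_X (c : I → F) (n : ℕ) (i : I) (m : ℕ+) :
    modeDerivation g c n (MvPolynomial.X (i, m)) =
      MvPolynomial.C (if n = m then ∑ k, c k * kappa g k i n else 0) := by
  classical
  rw [modeDerivation]
  split_ifs with hn h h
  · simp only [derivation_sum_apply, Derivation.coe_smul, Pi.smul_apply,
      MvPolynomial.pderiv_X, map_sum]
    refine Finset.sum_congr rfl fun k _ => ?_
    rw [Finset.sum_eq_single i]
    · have : (i, m) = (i, n.toPNat hn) := by rw [Prod.mk.injEq]; exact ⟨rfl, PNat.eq h.symm⟩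
      rw [this, Pi.single_eq_same, MvPolynomial.smul_eq_C_mul, mul_one]
    · intro j _ hj
      rw [Pi.single_eq_of_ne (by simpa using fun h => absurd h.symm hj), smul_zero]
    · simp
  · simp only [derivation_sum_apply, Derivation.coe_smul, Pi.smul_apply,
      MvPolynomial.pderiv_X, map_zero]
    refine Finset.sum_eq_zero fun k _ => Finset.sum_eq_zero fun j _ => ?_
    rw [Pi.single_eq_of_ne, smul_zero]
    intro e
    exact h (by rw [(Prod.mk.inj e).2]; rfl)
  · exact absurd m.pos (by omega)
  · rw [map_zero]; rfl

theorem modeDerivation_comm (c c' : I → F) (n n' : ℕ) (u : FockPoly I) :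
    modeDerivation g c n (modeDerivation g c' n' u) =
      modeDerivation g c' n' (modeDerivation g c n u) := by
  have : ⁅modeDerivation g c n, modeDerivation g c' n'⁆ = 0 := by
    refine MvPolynomial.derivation_ext fun p => ?_
    rw [Derivation.commutator_apply, modeDerivation_X, modeDerivation_X, MvPolynomial.derivation_C,
      MvPolynomial.derivation_C, sub_zero]
    rfl
  have := congrArg (fun d : Derivation F (FockPoly I) (FockPoly I) => d u) this
  rw [Derivation.commutator_apply] at this
  exact sub_eq_zero.1 this

/-- The exponent of the annihilation part of a vertex operator. -/
def annSeries (c : ℤ → I → F) : PowerSeries (Module.End F (FockPoly I)) :=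
  PowerSeries.mk fun n : ℕ => mode g (c n) n

/-- The exponent of the creation part of a vertex operator. -/
def creSeries (c : ℤ → I → F) : PowerSeries (FockPoly I) :=
  PowerSeries.mk fun n : ℕ => if hn : 0 < n then
    ∑ i, c (-n) i • MvPolynomial.X (i, n.toPNat hn) else 0

theorem creation_apply (c : ℤ → I → F) (p : ℕ) (u : FockPoly I) :
    creation g c p u = expCoeff (creSeries c) p * u := by
  have : PowerSeries.map (Algebra.lmul F (FockPoly I)).toRingHom (creSeries c) =
      PowerSeries.mk fun n : ℕ => mode g (c (-n)) (-n) := by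
    ext1 n
    rw [PowerSeries.coeff_map, creSeries, PowerSeries.coeff_mk, PowerSeries.coeff_mk]
    rcases Nat.eq_zero_or_pos n with rfl | hn
    · rw [dif_neg (lt_irrefl 0), map_zero, Nat.cast_zero, neg_zero, mode_zero]
    · rw [dif_pos hn]
      refine LinearMap.ext fun u => ?_
      have h1 : ¬ (0 : ℤ) < -n := by omega
      have h2 : -(n : ℤ) < 0 := by omega
      simp only [mode, LinearMap.sum_apply, LinearMap.smul_apply, xOp, dif_neg h1, dif_pos h2,
        neg_neg, Int.toNat_natCast, map_sum, LinearMap.mulLeft_apply, AlgHom.toRingHom_eq_coe,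
        RingHom.coe_coe, map_smul]
      rfl
  rw [creation, ← this, expCoeff_map]
  rfl

theorem creation_comm (c s : ℤ → I → F) (p p' : ℕ) (u : FockPoly I) :
    creation g c p (creation g s p' u) = creation g s p' (creation g c p u) := by
  simp only [creation_apply]
  ring

theorem coeff_zero_creSeries (c : ℤ → I → F) : PowerSeries.coeff 0 (creSeries c) = 0 := by
  rw [creSeries, PowerSeries.coeff_mk, dif_neg (lt_irrefl 0)]

theorem creSeries_add (c s : ℤ → I → F) : creSeries (c + s) = creSeries c + creSeries s := by
  ext1 n
  rw [map_add, creSeries, creSeries, creSeries, PowerSeries.coeff_mk, PowerSeries.coeff_mk,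
    PowerSeries.coeff_mk]
  split_ifs
  · rw [← Finset.sum_add_distrib]
    exact Finset.sum_congr rfl fun i _ => add_smul _ _ _
  · rw [add_zero]

theorem creation_add_apply (c s : ℤ → I → F) (p : ℕ) (u : FockPoly I) :
    creation g (c + s) p u = ∑ x ∈ Finset.HasAntidiagonal.antidiagonal p,
      creation g c x.1 (creation g s x.2 u) := by
  simp only [creation_apply, ← mul_assoc]
  rw [← Finset.sum_mul, creSeries_add, ← coeff_expSeries, expSeries_add (coeff_zero_creSeries c)
    (coeff_zero_creSeries s) (CoeffCommute.all _ _) (CoeffCommute.all _ _)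
    (CoeffCommute.all _ _), PowerSeries.coeff_mul]
  simp only [coeff_expSeries]

/-- The coefficients of a generating series in `z^{-1}` after `z` has been replaced by `z x⁻¹`. -/
def dilate (x : F) (s : ℤ → I → F) : ℤ → I → F := fun n => x ^ n • s n

theorem creation_dilate {x : F} (hx : x ≠ 0) (s : ℤ → I → F) (p : ℕ) :
    creation g (dilate x s) p = x ^ (-(p : ℤ)) • creation g s p := by
  rw [creation, creation, zpow_neg, zpow_natCast, ← inv_pow, ← expCoeff_rescale]
  congr 1
  ext1 n
  rw [PowerSeries.coeff_mk, PowerSeries.coeff_mk, PowerSeries.coeff_mk, dilate, inv_pow,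
    ← zpow_natCast, ← zpow_neg, mode, mode, Finset.smul_sum]
  simp only [Pi.smul_apply, smul_eq_mul, mul_smul]

theorem annihilation_dilate (x : F) (s : ℤ → I → F) (l : ℕ) :
    annihilation g (dilate x s) l = x ^ l • annihilation g s l := by
  rw [annihilation, annihilation, ← expCoeff_rescale]
  congr 1
  ext1 n
  rw [PowerSeries.coeff_mk, PowerSeries.coeff_mk, PowerSeries.coeff_mk, dilate,
    zpow_natCast, mode, mode, Finset.smul_sum]
  simp only [Pi.smul_apply, smul_eq_mul, mul_smul]

theorem coeff_annSeries_apply (c : ℤ → I → F) (n : ℕ) (u : FockPoly I) :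
    PowerSeries.coeff n (annSeries g c) u = modeDerivation g (c n) n u := by
  rw [annSeries, PowerSeries.coeff_mk, mode_natCast]
  rfl

theorem coeff_zero_annSeries (c : ℤ → I → F) : PowerSeries.coeff 0 (annSeries g c) = 0 := by
  rw [annSeries, PowerSeries.coeff_mk, Nat.cast_zero, mode_zero]

theorem coeffCommute_annSeries (c s : ℤ → I → F) :
    CoeffCommute (annSeries g c) (annSeries g s) := fun i j => by
  refine LinearMap.ext fun u => ?_
  rw [Module.End.mul_apply, Module.End.mul_apply]
  simp only [coeff_annSeries_apply]
  exact modeDerivation_comm g _ _ _ _ _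

theorem annihilation_eq (c : ℤ → I → F) (l : ℕ) :
    annihilation g c l = expCoeff (annSeries g c) l := rfl

theorem annihilation_add_apply (c s : ℤ → I → F) (l : ℕ) (u : FockPoly I) :
    annihilation g (c + s) l u = ∑ x ∈ Finset.HasAntidiagonal.antidiagonal l,
      annihilation g c x.1 (annihilation g s x.2 u) := by
  have : annSeries g (c + s) = annSeries g c + annSeries g s := by
    ext1 n
    rw [map_add, annSeries, annSeries, annSeries, PowerSeries.coeff_mk, PowerSeries.coeff_mk,
      PowerSeries.coeff_mk]
    simp only [mode, Pi.add_apply, add_smul, Finset.sum_add_distrib]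
  rw [annihilation_eq, this, ← coeff_expSeries, expSeries_add (coeff_zero_annSeries g c)
    (coeff_zero_annSeries g s) (coeffCommute_annSeries g _ _) (coeffCommute_annSeries g _ _)
    (coeffCommute_annSeries g _ _), PowerSeries.coeff_mul, LinearMap.sum_apply]
  simp only [coeff_expSeries, annihilation_eq, Module.End.mul_apply]

theorem annihilation_comm (c s : ℤ → I → F) (l l' : ℕ) (u : FockPoly I) :
    annihilation g c l (annihilation g s l' u) = annihilation g s l' (annihilation g c l u) := by
  have h1 : CoeffCommute (expSeries (annSeries g s)) (expSeries (annSeries g c)) :=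
    ((coeffCommute_annSeries g c s).expSeries.symm).expSeries
  have h2 := (h1 l' l).eq
  rw [coeff_expSeries, coeff_expSeries] at h2
  exact (congrArg (fun e : Module.End F (FockPoly I) => e u) h2).symm

/-- The exponent of the contraction of two vertex operators: the coefficient of degree `n` is the
commutator of the combinations `∑ c_i x_i[n]` and `∑ s_j x_j[-n]`. -/
def pairing (c s : ℤ → I → F) : PowerSeries F :=
  PowerSeries.mk fun n : ℕ => ∑ i, ∑ j, c n i * s (-n) j * kappa g i j n

theorem modeDerivation_creSeries (c s : ℤ → I → F) (n m : ℕ) :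
    modeDerivation g (c n) n (PowerSeries.coeff m (creSeries s)) =
      MvPolynomial.C (if n = m then PowerSeries.coeff n (pairing g c s) else 0) := by
  rw [creSeries, pairing, PowerSeries.coeff_mk, PowerSeries.coeff_mk]
  rcases Nat.eq_zero_or_pos m with rfl | hm
  · rw [dif_neg (lt_irrefl 0), map_zero]
    split_ifs with h
    · rw [h]; simp [kappa]
    · rw [map_zero]
  · rw [dif_pos hm, map_sum]
    have e : ∀ j, modeDerivation g (c n) n (s (-m) j • MvPolynomial.X (j, m.toPNat hm)) =
        MvPolynomial.C (if n = m then s (-m) j * ∑ i, c n i * kappa g i j n else 0) := by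
      intro j
      rw [Derivation.map_smul, modeDerivation_X, MvPolynomial.smul_eq_C_mul, ← map_mul, mul_ite,
        mul_zero]
      rfl
    rw [Finset.sum_congr rfl fun j _ => e j, ← map_sum]
    split_ifs with h
    · subst h
      rw [Finset.sum_comm]
      congr 1
      refine Finset.sum_congr rfl fun j _ => ?_
      rw [Finset.mul_sum]
      exact Finset.sum_congr rfl fun i _ => by ring
    · rw [Finset.sum_const_zero]

theorem expApply_creSeries (c s : ℤ → I → F) (m : ℕ) :
    expApply (annSeries g c) (PowerSeries.coeff m (creSeries s)) =
      PowerSeries.C (PowerSeries.coeff m (creSeries s)) +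
        (PowerSeries.X : PowerSeries (FockPoly I)) ^ m •
          algebraMap F (PowerSeries (FockPoly I)) (PowerSeries.coeff m (pairing g c s)) := by
  rw [expApply_of_linear (coeff_zero_annSeries g c) (coeffCommute_annSeries g c c)]
  · congr 1
    ext1 l
    rw [PowerSeries.coeff_mk, coeff_annSeries_apply, modeDerivation_creSeries, smul_eq_mul,
      PowerSeries.algebraMap_apply, PowerSeries.coeff_mul_C, PowerSeries.coeff_X_pow]
    split_ifs with h
    · rw [h, one_mul]; rfl
    · rw [zero_mul, map_zero]
  · intro n n'
    rw [coeff_annSeries_apply, coeff_annSeries_apply, modeDerivation_creSeries,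
      MvPolynomial.derivation_C]

theorem map_expCoeff_of_translate {B : Type*} [CommRing B] [Algebra F B] (E : B →ₐ[F] PowerSeries B)
    {f : PowerSeries B} {f' : PowerSeries F} (h0 : PowerSeries.coeff 0 f = 0)
    (h0' : PowerSeries.coeff 0 f' = 0) (h : ∀ n, E (PowerSeries.coeff n f) =
      PowerSeries.C (PowerSeries.coeff n f) + (PowerSeries.X : PowerSeries B) ^ n •
        algebraMap F (PowerSeries B) (PowerSeries.coeff n f')) (p : ℕ) :
    E (expCoeff f p) = ∑ x ∈ Finset.HasAntidiagonal.antidiagonal p,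
      PowerSeries.X ^ x.1 * PowerSeries.C (expCoeff f' x.1 • expCoeff f x.2) := by
  have e1 : PowerSeries.map E.toRingHom f =
      (PowerSeries.mk fun n => (PowerSeries.X : PowerSeries B) ^ n •
        PowerSeries.coeff n (PowerSeries.map (Algebra.ofId F (PowerSeries B)).toRingHom f')) +
      PowerSeries.map (IsScalarTower.toAlgHom F B (PowerSeries B)).toRingHom f := by
    ext1 n
    rw [map_add, PowerSeries.coeff_map, PowerSeries.coeff_map, PowerSeries.coeff_mk,
      PowerSeries.coeff_map, add_comm]
    exact h n
  rw [← expCoeff_map, e1, ← coeff_expSeries, expSeries_add _ _ (CoeffCommute.all _ _)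
    (CoeffCommute.all _ _) (CoeffCommute.all _ _), PowerSeries.coeff_mul]
  · refine Finset.sum_congr rfl fun x _ => ?_
    rw [coeff_expSeries, coeff_expSeries, expCoeff_map, expCoeff_rescale, expCoeff_map,
      smul_eq_mul, mul_assoc, Algebra.smul_def, map_mul, Algebra.ofId_apply,
      IsScalarTower.coe_toAlgHom', PowerSeries.algebraMap_apply, PowerSeries.algebraMap_apply,
      Algebra.algebraMap_self, RingHom.id_apply]
  · rw [PowerSeries.coeff_mk, PowerSeries.coeff_map, h0', map_zero, smul_zero]
  · rw [PowerSeries.coeff_map, h0, map_zero]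

theorem annihilation_creation (c s : ℤ → I → F) (l p : ℕ) (u : FockPoly I) :
    annihilation g c l (creation g s p u) =
      ∑ x ∈ Finset.HasAntidiagonal.antidiagonal p, if x.1 ≤ l then
        expCoeff (pairing g c s) x.1 • creation g s x.2 (annihilation g c (l - x.1) u) else 0 := by
  set E := expApplyHom (coeff_zero_annSeries g c) (coeffCommute_annSeries g c c)
    (fun n u v => by
      simp only [coeff_annSeries_apply, Derivation.leibniz, smul_eq_mul]; ring) with hE
  have hEa : ∀ u, E u = expApply (annSeries g c) u := fun _ => rfl
  have e2 := map_expCoeff_of_translate E (coeff_zero_creSeries s) (f' := pairing g c s)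
    (by simp [pairing, kappa]) (fun n => expApply_creSeries g c s n) p
  rw [creation_apply, annihilation_eq, ← coeff_expApply, ← hEa, map_mul, e2, Finset.sum_mul,
    map_sum]
  refine Finset.sum_congr rfl fun x _ => ?_
  rw [mul_assoc, PowerSeries.coeff_X_pow_mul']
  split_ifs with h
  · rw [PowerSeries.coeff_C_mul, hEa, coeff_expApply, creation_apply, annihilation_eq,
      smul_mul_assoc]
  · rfl

end DeformedW

end

noncomputable section

namespace DeformedW

/-! ### Products of vertex operators -/

variable {I : Type*} [Fintype I] [DecidableEq I] (g : CartanData I)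

theorem lowWeight_mono {d d' : ℕ} (h : d ≤ d') {f : FockPoly I} (hf : f ∈ lowWeight I d) :
    f ∈ lowWeight I d' := fun s hs => (hf s hs).trans_le h

theorem annihilation_eq_zero (c : ℤ → I → F) {l d : ℕ} (h : d ≤ l) {f : FockPoly I}
    (hf : f ∈ lowWeight I d) : annihilation g c l f = 0 := by
  have := annihilation_mem_lowWeight g c l d hf
  rw [Nat.sub_eq_zero_of_le h] at this
  exact eq_zero_of_mem_lowWeight_zero this

/-- The creation operators, extended by zero to negative degrees. -/
def creationInt (c : ℤ → I → F) (k : ℤ) : Module.End F (FockPoly I) :=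
  if 0 ≤ k then creation g c k.toNat else 0

theorem creationInt_natCast (c : ℤ → I → F) (p : ℕ) : creationInt g c p = creation g c p := by
  rw [creationInt, if_pos (Int.natCast_nonneg p), Int.toNat_natCast]

theorem creationInt_of_neg (c : ℤ → I → F) {k : ℤ} (hk : k < 0) : creationInt g c k = 0 :=
  if_neg (not_le.2 hk)

theorem creationInt_comm (c s : ℤ → I → F) (k k' : ℤ) (u : FockPoly I) :
    creationInt g c k (creationInt g s k' u) = creationInt g s k' (creationInt g c k u) := by
  rw [creationInt, creationInt]
  split_ifs
  · exact creation_comm g c s _ _ u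
  all_goals simp

theorem creationInt_dilate {x : F} (hx : x ≠ 0) (s : ℤ → I → F) (k : ℤ) :
    creationInt g (dilate x s) k = x ^ (-k) • creationInt g s k := by
  rw [creationInt, creationInt]
  split_ifs with h
  · rw [creation_dilate g hx, Int.toNat_of_nonneg h]
  · rw [smul_zero]

theorem creationInt_add_apply (c s : ℤ → I → F) (u v : ℤ) (w : FockPoly I) {N : ℕ}
    (hN : u.natAbs + v.natAbs ≤ N) : creationInt g (c + s) (u + v) w =
      ∑ μ ∈ Finset.Icc (-(N : ℤ)) N, creationInt g c (u + μ) (creationInt g s (v - μ) w) := by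
  rcases lt_or_ge (u + v) 0 with h | h
  · rw [creationInt_of_neg g _ h, LinearMap.zero_apply]
    refine (Finset.sum_eq_zero fun μ _ => ?_).symm
    rcases lt_or_ge (u + μ) 0 with h' | h'
    · rw [creationInt_of_neg g _ h', LinearMap.zero_apply]
    · rw [creationInt_of_neg g _ (show v - μ < 0 by omega), LinearMap.zero_apply, map_zero]
  obtain ⟨p, hp⟩ := Int.eq_ofNat_of_zero_le h
  rw [hp, creationInt_natCast, creation_add_apply]
  refine Finset.sum_of_injOn (fun x => (x.1 : ℤ) - u) ?_ ?_ ?_ ?_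
  · intro x hx y hy hxy
    have hx' := Finset.HasAntidiagonal.mem_antidiagonal.1 (Finset.mem_coe.1 hx)
    have hy' := Finset.HasAntidiagonal.mem_antidiagonal.1 (Finset.mem_coe.1 hy)
    simp only at hxy
    exact Prod.ext (by omega) (by omega)
  · intro x hx
    have hx' := Finset.HasAntidiagonal.mem_antidiagonal.1 (Finset.mem_coe.1 hx)
    simp only [Finset.coe_Icc, Set.mem_Icc]
    omega
  · intro μ _ hμ
    rcases lt_or_ge (u + μ) 0 with h' | h'
    · rw [creationInt_of_neg g _ h', LinearMap.zero_apply]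
    rcases lt_or_ge (v - μ) 0 with h'' | h''
    · rw [creationInt_of_neg g _ h'', LinearMap.zero_apply, map_zero]
    refine absurd ⟨((u + μ).toNat, (v - μ).toNat), ?_, ?_⟩ hμ
    · exact Finset.mem_coe.2 (Finset.HasAntidiagonal.mem_antidiagonal.2 (by simp only; omega))
    · simp only; omega
  · intro x hx
    have hx' := Finset.HasAntidiagonal.mem_antidiagonal.1 hx
    rw [← creationInt_natCast, ← creationInt_natCast, show u + ((x.1 : ℤ) - u) = x.1 by ring,
      show v - ((x.1 : ℤ) - u) = x.2 by omega]

theorem vertexCoeff_eq_sum (c : ℤ → I → F) (k : ℤ) {d : ℕ} {f : FockPoly I}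
    (hf : f ∈ lowWeight I d) {N : ℕ} (hN : d ≤ N) : vertexCoeff g c k f =
      ∑ l ∈ Finset.range N, creationInt g c (k + l) (annihilation g c l f) := by
  have e : ∀ l : ℕ, (if 0 ≤ k + l then creation g c (k + l).toNat (annihilation g c l f) else 0) =
      creationInt g c (k + l) (annihilation g c l f) := by
    intro l
    rw [creationInt]
    split_ifs <;> rfl
  refine (finsum_congr e).trans (finsum_eq_sum_of_support_subset _ fun l hl => ?_)
  by_contra h
  refine hl ?_
  simp only
  rw [annihilation_eq_zero g c (hN.trans (by simpa using h)) hf, map_zero]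

theorem sum_range_antidiagonal {V : Type*} [AddCommMonoid V] (G : ℕ × ℕ → V) {N D T : ℕ}
    (hT : N + D ≤ T) (h : ∀ x : ℕ × ℕ, N ≤ x.1 ∨ D ≤ x.2 → G x = 0) :
    ∑ L ∈ Finset.range T, ∑ x ∈ Finset.HasAntidiagonal.antidiagonal L, G x =
      ∑ μ ∈ Finset.range N, ∑ b ∈ Finset.range D, G (μ, b) := by
  rw [← Finset.sum_product', ← Finset.sum_biUnion]
  · symm
    refine Finset.sum_subset ?_ ?_
    · intro x hx
      simp only [Finset.mem_product, Finset.mem_range] at hx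
      simp only [Finset.mem_biUnion, Finset.mem_range, Finset.HasAntidiagonal.mem_antidiagonal]
      exact ⟨x.1 + x.2, by omega, rfl⟩
    · intro x _ hx
      refine h x ?_
      simp only [Finset.mem_product, Finset.mem_range] at hx
      omega
  · intro L _ L' _ hL
    refine Finset.disjoint_left.2 fun x hx hx' => hL ?_
    rw [← Finset.HasAntidiagonal.mem_antidiagonal.1 hx,
      ← Finset.HasAntidiagonal.mem_antidiagonal.1 hx']

theorem annihilation_creationInt (c s : ℤ → I → F) (L : ℕ) (n : ℤ) (u : FockPoly I) :
    annihilation g c L (creationInt g s n u) = ∑ x ∈ Finset.HasAntidiagonal.antidiagonal L,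
      expCoeff (pairing g c s) x.1 • creationInt g s (n - x.1) (annihilation g c x.2 u) := by
  rcases lt_or_ge n 0 with h | h
  · rw [creationInt_of_neg g _ h, LinearMap.zero_apply, map_zero]
    refine (Finset.sum_eq_zero fun x _ => ?_).symm
    rw [creationInt_of_neg g _ (show n - x.1 < 0 by omega), LinearMap.zero_apply, smul_zero]
  obtain ⟨p, rfl⟩ := Int.eq_ofNat_of_zero_le h
  rw [creationInt_natCast, annihilation_creation, Finset.Nat.sum_antidiagonal_eq_sum_range_succ_mk,
    Finset.Nat.sum_antidiagonal_eq_sum_range_succ_mk]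
  set G : ℕ → FockPoly I := fun a => if a ≤ L ∧ a ≤ p then
    expCoeff (pairing g c s) a • creation g s (p - a) (annihilation g c (L - a) u) else 0 with hG
  have e1 : ∑ a ∈ Finset.range p.succ, G a = ∑ a ∈ Finset.range (p + L + 1), G a := by
    refine Finset.sum_subset (Finset.range_mono (by omega)) fun a _ ha => if_neg ?_
    simp only [Finset.mem_range] at ha
    omega
  have e2 : ∑ a ∈ Finset.range L.succ, G a = ∑ a ∈ Finset.range (p + L + 1), G a := by
    refine Finset.sum_subset (Finset.range_mono (by omega)) fun a _ ha => if_neg ?_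
    simp only [Finset.mem_range] at ha
    omega
  have e3 := e1.trans e2.symm
  refine (Finset.sum_congr rfl fun a ha => ?_).trans (e3.trans (Finset.sum_congr rfl fun a ha => ?_))
  · have ha' : a ≤ p := by simpa using Finset.mem_range_succ_iff.1 ha
    simp only [hG, ha', and_true]
  · have ha' : a ≤ L := by simpa using Finset.mem_range_succ_iff.1 ha
    simp only [hG, ha', true_and]
    split_ifs with hp
    · rw [show (p : ℤ) - a = ((p - a : ℕ) : ℤ) by omega, creationInt_natCast]
    · rw [creationInt_of_neg g _ (show (p : ℤ) - a < 0 by omega), LinearMap.zero_apply, smul_zero]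

theorem eventually_vertexCoeff_creationInt (c s : ℤ → I → F) (k n : ℤ) {D : ℕ} {u : FockPoly I}
    (hu : u ∈ lowWeight I D) : ∀ᶠ N : ℕ in Filter.atTop,
      vertexCoeff g c k (creationInt g s n u) = ∑ μ ∈ Finset.range N, ∑ b ∈ Finset.range D,
        expCoeff (pairing g c s) μ •
          creationInt g c (k + μ + b) (creationInt g s (n - μ) (annihilation g c b u)) := by
  obtain ⟨d, hd⟩ := exists_mem_lowWeight (creationInt g s n u)
  filter_upwards [Filter.eventually_ge_atTop d, Filter.eventually_ge_atTop (n.toNat + 1)]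
    with N h1 h2
  rw [vertexCoeff_eq_sum g c k hd (h1.trans (Nat.le_add_right N D)), ← sum_range_antidiagonal
    (fun x => expCoeff (pairing g c s) x.1 • creationInt g c (k + x.1 + x.2)
      (creationInt g s (n - x.1) (annihilation g c x.2 u))) (le_refl (N + D))]
  · refine Finset.sum_congr rfl fun L _ => ?_
    rw [annihilation_creationInt, map_sum]
    refine Finset.sum_congr rfl fun x hx => ?_
    have hx' := Finset.HasAntidiagonal.mem_antidiagonal.1 hx
    rw [map_smul, show k + (L : ℤ) = k + x.1 + x.2 by omega]
  · rintro x (hx | hx)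
    · rw [creationInt_of_neg g s (show n - x.1 < 0 by omega), LinearMap.zero_apply, map_zero,
        smul_zero]
    · rw [annihilation_eq_zero g c hx hu, map_zero, map_zero, smul_zero]

/-- The operator `∑_{|μ| ≤ N} χ_μ` times the product of the normally ordered exponentials, in the
degrees `k + μ` and `m - μ`, on vectors of weight less than `D`. -/
def normalProduct (c s : ℤ → I → F) (k m : ℤ) (D N : ℕ) (f : FockPoly I) (χ : ℤ → F) :
    FockPoly I :=
  ∑ μ ∈ Finset.Icc (-(N : ℤ)) N, ∑ b ∈ Finset.range D, ∑ l ∈ Finset.range D,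
    χ μ • creationInt g c (k + μ + b)
      (creationInt g s (m - μ + l) (annihilation g c b (annihilation g s l f)))

/-- The coefficients of the contraction, extended by zero to negative degrees. -/
def contraction (c s : ℤ → I → F) (μ : ℤ) : F :=
  if 0 ≤ μ then expCoeff (pairing g c s) μ.toNat else 0

theorem sum_Icc_of_neg_eq_zero {V : Type*} [AddCommMonoid V] (N : ℕ) (G : ℤ → V)
    (hG : ∀ μ < 0, G μ = 0) :
    ∑ μ ∈ Finset.Icc (-(N : ℤ)) N, G μ = ∑ μ ∈ Finset.range (N + 1), G μ := by
  symm
  refine Finset.sum_of_injOn (fun μ : ℕ => (μ : ℤ)) (fun _ _ _ _ h => Int.ofNat_injective h) ?_ ?_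
    fun _ _ => rfl
  · intro μ hμ
    simp only [Finset.coe_range, Set.mem_Iio] at hμ
    simp only [Finset.coe_Icc, Set.mem_Icc]
    omega
  · intro μ hμ h
    rcases lt_or_ge μ 0 with h0 | h0
    · exact hG μ h0
    · refine absurd ⟨μ.toNat, ?_, Int.toNat_of_nonneg h0⟩ h
      rw [Finset.mem_Icc] at hμ
      simp only [Finset.coe_range, Set.mem_Iio]
      omega

theorem eventually_vertexCoeff_vertexCoeff (c s : ℤ → I → F) (k m : ℤ) {D : ℕ} {f : FockPoly I}
    (hf : f ∈ lowWeight I D) : ∀ᶠ N : ℕ in Filter.atTop,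
      vertexCoeff g c k (vertexCoeff g s m f) =
        normalProduct g c s k m D N f (contraction g c s) := by
  have key : ∀ l ∈ Finset.range D, ∀ᶠ N : ℕ in Filter.atTop,
      vertexCoeff g c k (creationInt g s (m + l) (annihilation g s l f)) =
        ∑ μ ∈ Finset.range N, ∑ b ∈ Finset.range D, expCoeff (pairing g c s) μ •
          creationInt g c (k + μ + b) (creationInt g s (m + l - μ)
            (annihilation g c b (annihilation g s l f))) := fun l _ =>
    eventually_vertexCoeff_creationInt g c s k (m + l)
      (lowWeight_mono (Nat.sub_le D l) (annihilation_mem_lowWeight g s l D hf))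
  have key' := (Finset.eventually_all _).2 key
  filter_upwards [(Filter.tendsto_add_atTop_nat 1).eventually key'] with N hN
  rw [vertexCoeff_eq_sum g s m hf le_rfl, map_sum, Finset.sum_congr rfl hN, Finset.sum_comm,
    normalProduct, sum_Icc_of_neg_eq_zero]
  · refine Finset.sum_congr rfl fun μ _ => ?_
    rw [Finset.sum_comm]
    refine Finset.sum_congr rfl fun b _ => Finset.sum_congr rfl fun l _ => ?_
    rw [contraction, if_pos (Int.natCast_nonneg μ), Int.toNat_natCast,
      show m + (l : ℤ) - μ = m - μ + l by ring]
  · intro μ hμ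
    simp only [contraction, if_neg (not_le.2 hμ), zero_smul, Finset.sum_const_zero]

theorem eventually_vertexCoeff_vertexCoeff_swap (c s : ℤ → I → F) (k m : ℤ) {D : ℕ}
    {f : FockPoly I} (hf : f ∈ lowWeight I D) : ∀ᶠ N : ℕ in Filter.atTop,
      vertexCoeff g s m (vertexCoeff g c k f) =
        normalProduct g c s k m D N f (fun μ => contraction g s c (-μ)) := by
  filter_upwards [eventually_vertexCoeff_vertexCoeff g s c m k hf] with N hN
  rw [hN, normalProduct, normalProduct]
  refine Finset.sum_bij' (fun μ _ => -μ) (fun μ _ => -μ) ?_ ?_ ?_ ?_ ?_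
  · intro μ hμ
    rw [Finset.mem_Icc] at hμ ⊢
    omega
  · intro μ hμ
    rw [Finset.mem_Icc] at hμ ⊢
    omega
  · intro μ _; exact neg_neg μ
  · intro μ _; exact neg_neg μ
  · intro μ _
    rw [Finset.sum_comm]
    refine Finset.sum_congr rfl fun b _ => Finset.sum_congr rfl fun l _ => ?_
    rw [neg_neg, annihilation_comm, creationInt_comm, sub_neg_eq_add, ← sub_eq_add_neg]

theorem eventually_normalProduct_zpow (c s : ℤ → I → F) (k m : ℤ) {D : ℕ} {f : FockPoly I}
    (hf : f ∈ lowWeight I D) {x : F} (hx : x ≠ 0) : ∀ᶠ N : ℕ in Filter.atTop,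
      normalProduct g c s k m D N f (fun μ => x ^ μ) =
        x ^ m • vertexCoeff g (c + dilate x s) (k + m) f := by
  filter_upwards [Filter.eventually_ge_atTop (k.natAbs + m.natAbs + 2 * D)] with N hN
  have e : ∀ μ : ℤ, ∀ b l : ℕ, x ^ μ • creationInt g c (k + μ + b)
      (creationInt g s (m - μ + l) (annihilation g c b (annihilation g s l f))) =
      x ^ m • creationInt g c (k + b + μ) (creationInt g (dilate x s) (m + l - μ)
        (annihilation g c b (annihilation g (dilate x s) l f))) := by
    intro μ b l
    rw [creationInt_dilate g hx, annihilation_dilate, LinearMap.smul_apply, LinearMap.smul_apply,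
      map_smul, map_smul, map_smul, map_smul, smul_smul, smul_smul, ← zpow_natCast, ← zpow_add₀ hx,
      ← zpow_add₀ hx, show k + (b : ℤ) + μ = k + μ + b by ring,
      show m + (l : ℤ) - μ = m - μ + l by ring, show m + -(m - μ + l) + (l : ℤ) = μ by ring]
  rw [normalProduct, Finset.sum_comm]
  simp only [e]
  rw [vertexCoeff_eq_sum g _ _ hf (show D ≤ D + D by omega), Finset.smul_sum]
  have e' : ∀ L : ℕ, x ^ m • creationInt g (c + dilate x s) (k + m + L)
      (annihilation g (c + dilate x s) L f) = ∑ y ∈ Finset.HasAntidiagonal.antidiagonal L,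
        x ^ m • creationInt g (c + dilate x s) (k + m + y.1 + y.2)
          (annihilation g c y.1 (annihilation g (dilate x s) y.2 f)) := by
    intro L
    rw [annihilation_add_apply, map_sum, Finset.smul_sum]
    refine Finset.sum_congr rfl fun y hy => ?_
    rw [← Finset.HasAntidiagonal.mem_antidiagonal.1 hy, Nat.cast_add, add_assoc (k + m)]
  rw [Finset.sum_congr rfl fun L _ => e' L, sum_range_antidiagonal
    (fun y => x ^ m • creationInt g (c + dilate x s) (k + m + y.1 + y.2)
      (annihilation g c y.1 (annihilation g (dilate x s) y.2 f))) le_rfl]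
  · refine Finset.sum_congr rfl fun b hb => ?_
    rw [Finset.sum_comm]
    refine Finset.sum_congr rfl fun l hl => ?_
    rw [Finset.mem_range] at hb hl
    rw [← Finset.smul_sum, show k + m + (b : ℤ) + l = (k + b) + (m + l) by ring,
      creationInt_add_apply g c (dilate x s) (k + b) (m + l)]
    omega
  · rintro y (hy | hy)
    · rw [annihilation_comm, annihilation_eq_zero g c hy hf, map_zero, map_zero, smul_zero]
    · rw [annihilation_eq_zero g _ hy hf, map_zero, map_zero, smul_zero]

theorem normalProduct_linear (c s : ℤ → I → F) (k m : ℤ) (D N : ℕ) (f : FockPoly I) :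
    ∃ φ : (ℤ → F) →ₗ[F] FockPoly I, ∀ χ, normalProduct g c s k m D N f χ = φ χ :=
  ⟨{  toFun := normalProduct g c s k m D N f
      map_add' := fun χ χ' => by
        simp only [normalProduct, Pi.add_apply, add_smul, Finset.sum_add_distrib]
      map_smul' := fun x χ => by
        simp only [normalProduct, Pi.smul_apply, smul_eq_mul, mul_smul, Finset.smul_sum,
          RingHom.id_apply] }, fun _ => rfl⟩

/-- If the two contractions of normally ordered exponentials differ by a combination of geometric
progressions, then their coefficients commute up to coefficients of products. -/
theorem vertexCoeff_commutator (c s : ℤ → I → F) (A B : F) {ι : Type*} (S : Finset ι) (ρ x : ι → F)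
    (hx : ∀ i ∈ S, x i ≠ 0) (h : ∀ μ : ℤ, A * contraction g c s μ - B * contraction g s c (-μ) =
      ∑ i ∈ S, ρ i * x i ^ μ) (k m : ℤ) (f : FockPoly I) :
    A • vertexCoeff g c k (vertexCoeff g s m f) - B • vertexCoeff g s m (vertexCoeff g c k f) =
      ∑ i ∈ S, (ρ i * x i ^ m) • vertexCoeff g (c + dilate (x i) s) (k + m) f := by
  obtain ⟨D, hf⟩ := exists_mem_lowWeight f
  have h3 := (Finset.eventually_all S).2 fun i hi =>
    eventually_normalProduct_zpow g c s k m hf (hx i hi)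
  obtain ⟨N, h1, h2, h3⟩ := ((eventually_vertexCoeff_vertexCoeff g c s k m hf).and
    ((eventually_vertexCoeff_vertexCoeff_swap g c s k m hf).and h3)).exists
  obtain ⟨φ, hφ⟩ := normalProduct_linear g c s k m D N f
  rw [h1, h2, hφ, hφ, ← map_smul, ← map_smul, ← map_sub]
  have : A • contraction g c s - B • (fun μ => contraction g s c (-μ)) =
      ∑ i ∈ S, ρ i • fun μ => x i ^ μ := by
    ext1 μ
    rw [Finset.sum_apply]
    exact h μ
  rw [this, map_sum]
  refine Finset.sum_congr rfl fun i hi => ?_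
  rw [map_smul, ← hφ, h3 i hi, smul_smul]

end DeformedW

end

noncomputable section

namespace DeformedW

/-! ### Partial fractions -/

/-- The series `-log (1 - x X)`. -/
def logSeries (x : F) : PowerSeries F := PowerSeries.mk fun n => x ^ n / n

theorem coeff_zero_logSeries (x : F) : PowerSeries.coeff 0 (logSeries x) = 0 := by
  rw [logSeries, PowerSeries.coeff_mk, Nat.cast_zero, div_zero]

theorem expSeries_zero : expSeries (0 : PowerSeries F) = 1 := by
  refine euler_unique (h := 0) (map_zero _) ?_ ?_ ?_
  · rw [euler_expSeries (map_zero _) (Commute.all _ _)]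
    have : euler (0 : PowerSeries F) = 0 := by ext n; rw [coeff_euler, map_zero, smul_zero]
    rw [this]
  · rw [euler_one, zero_mul]
  · rw [coeff_expSeries, expCoeff_zero, PowerSeries.coeff_zero_one]

theorem mk_pow_mul (x : F) :
    (PowerSeries.mk fun n => x ^ n) * (1 - PowerSeries.C x * PowerSeries.X) = 1 := by
  ext n
  rw [mul_sub, mul_one, map_sub, mul_left_comm, PowerSeries.coeff_C_mul, PowerSeries.coeff_mk]
  rcases n with _ | n
  · simp
  · rw [PowerSeries.coeff_succ_mul_X, PowerSeries.coeff_mk, PowerSeries.coeff_one,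
      if_neg n.succ_ne_zero, pow_succ', sub_self]

theorem expSeries_neg_logSeries (x : F) :
    expSeries (-logSeries x) = 1 - PowerSeries.C x * PowerSeries.X := by
  have h0 : PowerSeries.coeff 0 (-logSeries x) = 0 := by
    rw [map_neg, coeff_zero_logSeries, neg_zero]
  refine euler_unique (coeff_zero_euler (-logSeries x))
    (euler_expSeries h0 (Commute.all _ _)) ?_ ?_
  · have e1 : euler (-logSeries x) = 1 - PowerSeries.mk fun n => x ^ n := by
      ext n
      rw [coeff_euler, map_neg, logSeries, PowerSeries.coeff_mk, map_sub, PowerSeries.coeff_mk,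
        PowerSeries.coeff_one, smul_eq_mul]
      rcases n with _ | n
      · simp
      · have : ((n + 1 : ℕ) : F) ≠ 0 := Nat.cast_ne_zero.2 n.succ_ne_zero
        rw [if_neg n.succ_ne_zero]
        field_simp
        ring
    have e2 : euler (1 - PowerSeries.C x * PowerSeries.X) = -(PowerSeries.C x * PowerSeries.X) := by
      ext n
      rw [coeff_euler, map_sub, map_neg, PowerSeries.coeff_C_mul, PowerSeries.coeff_X,
        PowerSeries.coeff_one, smul_eq_mul]
      rcases n with _ | _ | n <;> simp
    rw [e1, e2, sub_mul, mk_pow_mul]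
    ring
  · rw [coeff_expSeries, expCoeff_zero]
    simp

theorem coeff_zero_sum_logSeries {ι : Type*} (S : Finset ι) (x : ι → F) (n : ι → ℕ) :
    PowerSeries.coeff 0 (∑ a ∈ S, PowerSeries.C (n a : F) * -logSeries (x a)) = 0 := by
  rw [map_sum]
  refine Finset.sum_eq_zero fun a _ => ?_
  rw [PowerSeries.coeff_C_mul, map_neg, coeff_zero_logSeries, neg_zero, mul_zero]

theorem expSeries_sum_logSeries {ι : Type*} (S : Finset ι) (x : ι → F) (n : ι → ℕ) :
    expSeries (∑ a ∈ S, PowerSeries.C (n a : F) * -logSeries (x a)) =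
      ∏ a ∈ S, (1 - PowerSeries.C (x a) * PowerSeries.X) ^ n a := by
  classical
  have h1 : ∀ (a : ι) (k : F), PowerSeries.coeff 0 (PowerSeries.C k * -logSeries (x a)) = 0 :=
    fun a k => by rw [PowerSeries.coeff_C_mul, map_neg, coeff_zero_logSeries, neg_zero, mul_zero]
  have h2 : ∀ (a : ι) (k : ℕ), expSeries (PowerSeries.C (k : F) * -logSeries (x a)) =
      (1 - PowerSeries.C (x a) * PowerSeries.X) ^ k := by
    intro a k
    induction k with
    | zero => rw [Nat.cast_zero, map_zero, zero_mul, expSeries_zero, pow_zero]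
    | succ k ih =>
      rw [Nat.cast_succ, map_add, add_mul, expSeries_add (h1 a k) (h1 a 1) (CoeffCommute.all _ _)
        (CoeffCommute.all _ _) (CoeffCommute.all _ _), ih, map_one, one_mul,
        expSeries_neg_logSeries, pow_succ]
  induction S using Finset.induction_on with
  | empty => rw [Finset.sum_empty, Finset.prod_empty, expSeries_zero]
  | insert a S ha ih =>
    rw [Finset.sum_insert ha, Finset.prod_insert ha, expSeries_add (h1 _ _)
      (coeff_zero_sum_logSeries S x n) (CoeffCommute.all _ _) (CoeffCommute.all _ _)
      (CoeffCommute.all _ _), h2, ih]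

section Polynomial

open Polynomial

variable {k : Type*} [Field k]

theorem natDegree_one_sub_C_mul_X_le (x : k) : (1 - C x * X : k[X]).natDegree ≤ 1 := by
  compute_degree

theorem coeff_prod_one_sub {ι : Type*} (S : Finset ι) (x : ι → k) (n : ι → ℕ) :
    (∏ a ∈ S, (1 - C (x a) * X) ^ n a : k[X]).natDegree ≤ ∑ a ∈ S, n a ∧
      (∏ a ∈ S, (1 - C (x a) * X) ^ n a : k[X]).coeff (∑ a ∈ S, n a) = ∏ a ∈ S, (-x a) ^ n a := by
  classical
  have h1 : ∀ a m, ((1 - C (x a) * X) ^ m : k[X]).natDegree ≤ m := fun a m =>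
    (natDegree_pow_le_of_le m (natDegree_one_sub_C_mul_X_le (x a))).trans (by rw [mul_one])
  have h2 : ∀ a m, ((1 - C (x a) * X) ^ m : k[X]).coeff m = (-x a) ^ m := fun a m => by
    have := coeff_pow_of_natDegree_le (m := m) (natDegree_one_sub_C_mul_X_le (x a))
    rw [mul_one] at this
    rw [this]
    simp [coeff_one]
  induction S using Finset.induction_on with
  | empty => simp
  | insert a S ha ih =>
    rw [Finset.prod_insert ha, Finset.sum_insert ha, Finset.prod_insert ha]
    refine ⟨natDegree_mul_le_of_le (h1 a _) ih.1, ?_⟩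
    rw [coeff_mul_add_eq_of_natDegree_le (h1 a _) ih.1, h2, ih.2]

theorem partialFraction_polynomial {ι : Type*} [DecidableEq ι] (T S : Finset ι) (x : ι → k)
    (n : ι → ℕ) (hx : ∀ a ∈ T, x a ≠ 0) (hinj : Set.InjOn x T) (hn : ∑ a ∈ S, n a = T.card)
    (ρ : ι → k) (hρ : ∀ a ∈ T, (ρ a) * ∏ b ∈ T.erase a, (1 - x b * (x a)⁻¹) =
      ∏ b ∈ S, (1 - x b * (x a)⁻¹) ^ n b) (κ : k)
    (hκ : κ * ∏ a ∈ T, (-x a) = ∏ a ∈ S, (-x a) ^ n a) :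
    (∏ a ∈ S, (1 - C (x a) * X) ^ n a : k[X]) = C κ * ∏ a ∈ T, (1 - C (x a) * X) +
      ∑ a ∈ T, C (ρ a) * ∏ b ∈ T.erase a, (1 - C (x b) * X) := by
  rw [← sub_eq_iff_eq_add']
  have hT := coeff_prod_one_sub T x fun _ => 1
  simp only [pow_one, Finset.sum_const, smul_eq_mul, mul_one] at hT
  have hS := coeff_prod_one_sub S x n
  rw [hn] at hS
  have hlt : ∀ p : k[X], p.natDegree ≤ T.card → p.coeff T.card = 0 → p.degree < T.card := by
    intro p h1 h2
    refine (degree_lt_iff_coeff_zero _ _).2 fun m hm => ?_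
    rcases hm.eq_or_lt with h | h
    · rw [← h, h2]
    · exact coeff_eq_zero_of_natDegree_lt (h1.trans_lt h)
  refine eq_of_degrees_lt_of_eval_index_eq (v := fun a => (x a)⁻¹) T
    (fun a ha b hb h => hinj ha hb (inv_injective h)) (hlt _ ?_ ?_) ?_ ?_
  · refine (natDegree_sub_le _ _).trans (max_le hS.1 ((natDegree_C_mul_le _ _).trans hT.1))
  · rw [coeff_sub, coeff_C_mul, hS.2, hT.2, hκ, sub_self]
  · refine (degree_sum_le _ _).trans_lt ((Finset.sup_lt_iff (WithBot.bot_lt_coe _)).2 fun a ha => ?_)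
    have h := (coeff_prod_one_sub (T.erase a) x fun _ => 1).1
    simp only [pow_one, Finset.sum_const, smul_eq_mul, mul_one] at h
    refine (degree_le_of_natDegree_le ((natDegree_C_mul_le _ _).trans h)).trans_lt ?_
    exact_mod_cast Finset.card_erase_lt_of_mem ha
  · intro a ha
    have hz : ∏ b ∈ T, (1 - x b * (x a)⁻¹) = 0 :=
      Finset.prod_eq_zero ha (by rw [mul_inv_cancel₀ (hx a ha), sub_self])
    simp only [eval_sub, eval_mul, eval_C, eval_prod, eval_pow, eval_one, eval_X, eval_finsetSum]
    rw [hz, mul_zero, sub_zero, ← hρ a ha, Finset.sum_eq_single a]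
    · intro b hb hba
      rw [Finset.prod_eq_zero (Finset.mem_erase.2 ⟨hba.symm, ha⟩)
        (by rw [mul_inv_cancel₀ (hx a ha), sub_self]), mul_zero]
    · exact fun h => absurd ha h

end Polynomial

section Contraction

variable {ι : Type*} [DecidableEq ι] {S : Finset ι} {e : ι → ℤ}

/-- The residue of `∏ (1 - x_b u)^{-e_b}` at a simple pole. -/
def residue (S : Finset ι) (e : ι → ℤ) (x : ι → F) (a : ι) : F :=
  ∏ b ∈ S.erase a, (1 - x b * (x a)⁻¹) ^ (-e b)

theorem expCoeff_eq_partialFraction (he : ∀ a ∈ S, e a ≤ 1) (hsum : ∑ a ∈ S, e a = 0) {x : ι → F}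
    (hx : ∀ a ∈ S, x a ≠ 0) (hinj : Set.InjOn x S) {f : PowerSeries F}
    (hf : ∀ n, PowerSeries.coeff n f = ∑ a ∈ S, e a * (x a ^ n / n)) (μ : ℕ) :
    expCoeff f μ = (if μ = 0 then ∏ a ∈ S, x a ^ (-e a) else 0) +
      ∑ a ∈ S with e a = 1, residue S e x a * x a ^ μ := by
  set T := S.filter fun a => e a = 1 with hT
  set R := S.filter fun a => ¬ e a = 1 with hR
  have hTS : T ⊆ S := Finset.filter_subset _ _
  have hneg : ∀ a ∈ R, ((-e a).toNat : ℤ) = -e a := fun a ha => by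
    have h1 := he a (Finset.mem_filter.1 ha).1
    have h2 := (Finset.mem_filter.1 ha).2
    omega
  have hone : ∀ a ∈ T, e a = 1 := fun a ha => (Finset.mem_filter.1 ha).2
  have hn : ∑ a ∈ R, (-e a).toNat = T.card := by
    have h1 := Finset.sum_filter_add_sum_filter_not S (fun a => e a = 1) e
    rw [← hT, ← hR, hsum, Finset.sum_congr rfl hone, Finset.sum_const, nsmul_eq_mul, mul_one] at h1
    zify
    rw [Finset.sum_congr rfl hneg, Finset.sum_neg_distrib]
    omega
  have hne : ∀ a ∈ S, ∀ b ∈ S.erase a, 1 - x b * (x a)⁻¹ ≠ 0 := by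
    intro a ha b hb h
    rw [sub_eq_zero, eq_comm, mul_inv_eq_one₀ (hx a ha)] at h
    exact Finset.ne_of_mem_erase hb (hinj (Finset.mem_of_mem_erase hb) ha h)
  have hκ : (∏ a ∈ S, x a ^ (-e a)) * ∏ a ∈ T, (-x a) = ∏ a ∈ R, (-x a) ^ (-e a).toNat := by
    have h1 : ∏ a ∈ S, x a ^ (-e a) = ∏ a ∈ S, (-x a) ^ (-e a) := by
      have h2 : ∏ a ∈ S, (-x a) ^ (-e a) = (∏ a ∈ S, (-1 : F) ^ (-e a)) * ∏ a ∈ S, x a ^ (-e a) := by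
        rw [← Finset.prod_mul_distrib]
        exact Finset.prod_congr rfl fun a _ => by rw [← mul_zpow, neg_one_mul]
      have h3 : ∀ S' : Finset ι, ∏ a ∈ S', (-1 : F) ^ (-e a) = (-1) ^ (∑ a ∈ S', -e a) := by
        intro S'
        induction S' using Finset.induction_on with
        | empty => simp
        | insert a S' ha ih =>
          rw [Finset.prod_insert ha, Finset.sum_insert ha, ih,
            zpow_add₀ (neg_ne_zero.2 one_ne_zero)]
      rw [h2, h3, Finset.sum_neg_distrib, hsum, neg_zero, zpow_zero, one_mul]
    rw [h1, ← Finset.prod_filter_mul_prod_filter_not S (fun a => e a = 1), ← hT, ← hR,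
      mul_right_comm, ← Finset.prod_mul_distrib, Finset.prod_eq_one, one_mul]
    · exact Finset.prod_congr rfl fun a ha => by rw [← zpow_natCast, hneg a ha]
    · intro a ha
      rw [hone a ha, zpow_neg_one, inv_mul_cancel₀ (neg_ne_zero.2 (hx a (hTS ha)))]
  have hρ : ∀ a ∈ T, residue S e x a * ∏ b ∈ T.erase a, (1 - x b * (x a)⁻¹) =
      ∏ b ∈ R, (1 - x b * (x a)⁻¹) ^ (-e b).toNat := by
    intro a ha
    rw [residue, ← Finset.prod_filter_mul_prod_filter_not (S.erase a) (fun a => e a = 1),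
      Finset.filter_erase, Finset.filter_erase, ← hT, ← hR, mul_right_comm,
      ← Finset.prod_mul_distrib, Finset.prod_eq_one, one_mul, Finset.erase_eq_of_notMem]
    · exact Finset.prod_congr rfl fun b hb => by rw [← zpow_natCast, hneg b hb]
    · intro h
      exact (Finset.mem_filter.1 h).2 (hone a ha)
    · intro b hb
      rw [hone b (Finset.mem_of_mem_erase hb), zpow_neg_one,
        inv_mul_cancel₀ (hne a (hTS ha) b (Finset.erase_subset_erase a hTS hb))]
  have hpoly := partialFraction_polynomial T R x (fun a => (-e a).toNat)
    (fun a ha => hx a (hTS ha)) (hinj.mono hTS) hn _ hρ _ hκ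
  have hpow := congrArg (Polynomial.coeToPowerSeries.ringHom (R := F)) hpoly
  simp only [map_prod, map_sum, map_add, map_mul, map_pow, map_sub, map_one,
    Polynomial.coeToPowerSeries.ringHom_apply, Polynomial.coe_C, Polynomial.coe_X] at hpow
  have hf0 : PowerSeries.coeff 0 f = 0 := by
    rw [hf]
    simp
  have hexp : expSeries f * ∏ a ∈ T, (1 - PowerSeries.C (x a) * PowerSeries.X) =
      ∏ a ∈ R, (1 - PowerSeries.C (x a) * PowerSeries.X) ^ (-e a).toNat := by
    have h1 := expSeries_sum_logSeries T x fun _ => 1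
    simp only [pow_one] at h1
    rw [← h1, ← expSeries_sum_logSeries, ← expSeries_add hf0 (coeff_zero_sum_logSeries _ _ _)
      (CoeffCommute.all _ _) (CoeffCommute.all _ _) (CoeffCommute.all _ _)]
    congr 1
    ext n
    simp only [map_add, map_sum, PowerSeries.coeff_C_mul, map_neg, hf, logSeries, PowerSeries.coeff_mk, Nat.cast_one,
      one_mul]
    rw [← Finset.sum_filter_add_sum_filter_not S (fun a => e a = 1), ← hT, ← hR,
      add_right_comm, ← Finset.sum_add_distrib, Finset.sum_eq_zero, zero_add]
    · refine Finset.sum_congr rfl fun a ha => ?_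
      rw [← Int.cast_natCast (R := F) (-e a).toNat, hneg a ha, Int.cast_neg, neg_mul_neg]
    · intro a ha
      rw [hone a ha, Int.cast_one, one_mul, add_neg_cancel]
  have hprod : ∏ a ∈ T, (1 - PowerSeries.C (x a) * PowerSeries.X) ≠ 0 := by
    refine Finset.prod_ne_zero_iff.2 fun a _ h => ?_
    have := mk_pow_mul (x a)
    rw [h, mul_zero] at this
    exact zero_ne_one this
  have hfinal : expSeries f = PowerSeries.C (∏ a ∈ S, x a ^ (-e a)) +
      ∑ a ∈ T, PowerSeries.C (residue S e x a) * PowerSeries.mk fun n => x a ^ n := by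
    refine mul_right_cancel₀ hprod ?_
    rw [hexp, hpow, ← map_prod, add_mul, Finset.sum_mul]
    congr 1
    refine Finset.sum_congr rfl fun a ha => ?_
    rw [← Finset.mul_prod_erase T _ ha, mul_assoc, ← mul_assoc (PowerSeries.mk _), mk_pow_mul,
      one_mul]
  rw [← coeff_expSeries, hfinal, map_add, map_sum, PowerSeries.coeff_C]
  simp only [PowerSeries.coeff_C_mul, PowerSeries.coeff_mk]

theorem residue_inv (hsum : ∑ a ∈ S, e a = 0) {x : ι → F} (hx : ∀ a ∈ S, x a ≠ 0) {a : ι}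
    (ha : a ∈ S) (hea : e a = 1) :
    (∏ b ∈ S, x b ^ (-e b)) * residue S e (fun b => (x b)⁻¹) a = -residue S e x a := by
  have hpow : ∀ (y : F) (S' : Finset ι), y ≠ 0 →
      ∏ b ∈ S', y ^ (-e b) = y ^ (∑ b ∈ S', -e b) := by
    intro y S' hy
    induction S' using Finset.induction_on with
    | empty => simp
    | insert b S' hb ih => rw [Finset.prod_insert hb, Finset.sum_insert hb, ih, zpow_add₀ hy]
  have hs : ∑ b ∈ S.erase a, -e b = 1 := by
    rw [Finset.sum_neg_distrib, ← hea]
    have := Finset.add_sum_erase S e ha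
    omega
  have hxa := hx a ha
  have h1 : residue S e (fun b => (x b)⁻¹) a =
      residue S e x a * ((-x a) * (∏ b ∈ S.erase a, x b ^ (-e b))⁻¹) := by
    have := hpow (-x a) (S.erase a) (neg_ne_zero.2 hxa)
    rw [hs, zpow_one] at this
    rw [residue, residue, ← this, ← Finset.prod_inv_distrib, ← Finset.prod_mul_distrib,
      ← Finset.prod_mul_distrib]
    refine Finset.prod_congr rfl fun b hb => ?_
    have hxb := hx b (Finset.mem_of_mem_erase hb)
    rw [← inv_zpow, ← mul_zpow, ← mul_zpow]
    congr 1
    field_simp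
    ring
  have h2 : ∏ b ∈ S.erase a, x b ^ (-e b) ≠ 0 :=
    Finset.prod_ne_zero_iff.2 fun b hb => zpow_ne_zero _ (hx b (Finset.mem_of_mem_erase hb))
  rw [h1, ← Finset.mul_prod_erase S _ ha, hea, zpow_neg_one]
  field_simp

/-- The difference of the expansions of `∏ (1 - x_a u)^{-e_a}` in positive and in negative powers
of `u`. -/
theorem expCoeff_sub_expCoeff (he : ∀ a ∈ S, e a ≤ 1) (hsum : ∑ a ∈ S, e a = 0) {x : ι → F}
    (hx : ∀ a ∈ S, x a ≠ 0) (hinj : Set.InjOn x S) {f f' : PowerSeries F}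
    (hf : ∀ n, PowerSeries.coeff n f = ∑ a ∈ S, e a * (x a ^ n / n))
    (hf' : ∀ n, PowerSeries.coeff n f' = ∑ a ∈ S, e a * ((x a)⁻¹ ^ n / n)) (μ : ℤ) :
    (if 0 ≤ μ then expCoeff f μ.toNat else 0) -
        (∏ a ∈ S, x a ^ (-e a)) * (if 0 ≤ -μ then expCoeff f' (-μ).toNat else 0) =
      ∑ a ∈ S with e a = 1, residue S e x a * x a ^ μ := by
  have h2 : ∀ n : ℕ, (∏ a ∈ S, x a ^ (-e a)) * expCoeff f' n = (if n = 0 then 1 else 0) -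
      ∑ a ∈ S with e a = 1, residue S e x a * x a ^ (-n : ℤ) := by
    intro n
    have hκ : ∏ a ∈ S, x a ^ (-e a) ≠ 0 :=
      Finset.prod_ne_zero_iff.2 fun b hb => zpow_ne_zero _ (hx b hb)
    rw [expCoeff_eq_partialFraction he hsum (x := fun a => (x a)⁻¹)
      (fun a ha => inv_ne_zero (hx a ha)) (fun a ha b hb h => hinj ha hb (inv_injective h)) hf',
      mul_add, sub_eq_add_neg, ← Finset.sum_neg_distrib, Finset.mul_sum]
    congr 1
    · simp only [inv_zpow, Finset.prod_inv_distrib]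
      rw [mul_ite, mul_zero, mul_inv_cancel₀ hκ]
    · refine Finset.sum_congr rfl fun a ha => ?_
      have ha' := Finset.mem_filter.1 ha
      rw [← mul_assoc, residue_inv hsum hx ha'.1 ha'.2, neg_mul, inv_pow, zpow_neg, zpow_natCast]
  rcases lt_trichotomy μ 0 with h | rfl | h
  · rw [if_neg (not_le.2 h), if_pos (by omega), h2, if_neg (by omega), zero_sub, zero_sub, neg_neg,
      Int.toNat_of_nonneg (by omega), neg_neg]
  · have h1 := h2 0
    rw [expCoeff_zero, if_pos rfl, mul_one] at h1
    rw [neg_zero, if_pos le_rfl, if_pos le_rfl, Int.toNat_zero, expCoeff_zero, expCoeff_zero,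
      mul_one, h1, Nat.cast_zero, neg_zero, sub_sub_cancel]
  · rw [if_pos h.le, if_neg (by omega), mul_zero, sub_zero,
      expCoeff_eq_partialFraction he hsum hx hinj hf, if_neg (by omega), zero_add]
    refine Finset.sum_congr rfl fun a _ => ?_
    rw [← zpow_natCast, Int.toNat_of_nonneg h.le]

end Contraction

end DeformedW

end

noncomputable section

namespace DeformedW

/-! ### The deformed Cartan matrix -/

variable {I : Type*} [Fintype I] [DecidableEq I] {g : CartanData I}

theorem sub_div_sub_swap {k : Type*} [Field k] (a b c d : k) :
    (b - a) / (d - c) = (a - b) / (c - d) := by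
  rw [← neg_sub, ← neg_sub c d, neg_div_neg_eq]

theorem sub_div_neg {k : Type*} [Field k] (a b n : k) : (b - a) / -n = (a - b) / n := by
  rw [← neg_sub, neg_div_neg_eq]

theorem inv_sub_mul_swap {k : Type*} [Field k] (a b c : k) : (b - a)⁻¹ * c = -((a - b)⁻¹ * c) := by
  rw [← neg_sub, inv_neg, neg_mul]

theorem neg_div_eq_neg_div {k : Type*} [Field k] (a b : k) : -a / b = -(a / b) := neg_div b a

theorem Q_mul (k l k' l' : ℤ) : Q k l * Q k' l' = Q (k + k') (l + l') := by
  rw [Q_eq, Q_eq, Q_eq, ← Units.val_mul, ← map_mul, qt_mul]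

theorem Q_sub_Q_ne_zero {k l k' l' : ℤ} (h : k ≠ k' ∨ l ≠ l') : Q k l - Q k' l' ≠ 0 := by
  rw [sub_ne_zero, Q_eq, Q_eq, Ne, Units.val_inj, vF_injective.eq_iff, qt_inj]
  tauto

theorem qint_mul (m : ℤ) {n : ℤ} (hn : n ≠ 0) :
    qint m n * (Q n 0 - Q (-n) 0) = Q (m * n) 0 - Q (-(m * n)) 0 := by
  rw [qint, mul_comm m n, div_mul_cancel₀]
  exact Q_sub_Q_ne_zero (.inl (by omega))

theorem qint_natCast (m : ℕ) {n : ℤ} (hn : n ≠ 0) :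
    qint m n = ∑ s ∈ Finset.range m, Q (n * (m - 1 - 2 * s)) 0 := by
  have hn' : Q n 0 - Q (-n) 0 ≠ 0 := Q_sub_Q_ne_zero (.inl (by omega))
  refine mul_right_cancel₀ hn' ?_
  rw [qint_mul _ hn, Finset.sum_mul]
  have : ∀ s ∈ Finset.range m, Q (n * (m - 1 - 2 * s)) 0 * (Q n 0 - Q (-n) 0) =
      Q (n * (m - 2 * (s : ℕ))) 0 - Q (n * (m - 2 * ((s + 1 : ℕ) : ℤ))) 0 := by
    intro s _
    rw [mul_sub, Q_mul, Q_mul, add_zero]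
    congr 2 <;> push_cast <;> ring
  rw [Finset.sum_congr rfl this, Finset.sum_range_sub']
  congr 2 <;> push_cast <;> ring

theorem qint_neg (m n : ℤ) : qint m (-n) = qint m n := by
  rw [qint, qint, neg_neg, neg_mul, neg_neg]
  exact sub_div_sub_swap _ _ _ _

theorem cartanQT_neg (n : ℤ) : cartanQT g (-n) = cartanQT g n := by
  ext i j
  rw [cartanQT, cartanQT, qint_neg]
  congr 2
  rw [mul_neg, neg_neg, neg_neg, add_comm]

theorem cartanQT_same (hg : g.IsFinite) (n : ℤ) (i : I) :
    cartanQT g n i i = Q (g.r i * n) (-n) + Q (-(g.r i * n)) n := by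
  rw [cartanQT, if_pos rfl, if_pos rfl, hg.diag, sub_self, qint, mul_zero, neg_zero, sub_self,
    zero_div, sub_zero]

theorem cartanQT_ne {i j : I} (hij : i ≠ j) (n : ℤ) :
    cartanQT g n i j = -qint (-g.C i j) n := by
  rw [cartanQT, if_neg hij, if_neg hij, zero_sub, zero_sub]

theorem CartanData.IsFinite.C_nonpos (hg : g.IsFinite) {i j : I} (hij : i ≠ j) : g.C i j ≤ 0 := by
  rcases hg.cases i j hij with h | h | h | h <;> omega

theorem cartanQT_ne_sum (hg : g.IsFinite) {i j : I} (hij : i ≠ j) {n : ℤ} (hn : n ≠ 0) :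
    cartanQT g n i j = -∑ s ∈ Finset.range (-g.C i j).toNat, Q (n * (-g.C i j - 1 - 2 * s)) 0 := by
  have h := hg.C_nonpos hij
  have h' : ((-g.C i j).toNat : ℤ) = -g.C i j := Int.toNat_of_nonneg (by omega)
  rw [cartanQT_ne hij]
  conv_lhs => rw [← h', qint_natCast _ hn, h']

theorem symQT_apply (n : ℤ) (i j : I) : symQT g n i j = qint (g.r i) n * cartanQT g n i j := by
  rw [symQT, Matrix.diagonal_mul]

theorem symQT_symm (hg : g.IsFinite) (n : ℤ) (i j : I) : symQT g n i j = symQT g n j i := by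
  by_cases hij : i = j
  · rw [hij]
  rw [symQT_apply, symQT_apply, cartanQT_ne hij, cartanQT_ne (Ne.symm hij)]
  rcases hg.cases i j hij with h | h | h | h
  · rw [h.1, h.2]
    simp [qint]
  · rw [h.1, h.2.1, h.2.2]
  · rw [h.1, h.2.1, h.2.2, neg_neg, neg_neg, mul_neg, mul_neg, mul_comm, Nat.cast_one]
  · rw [h.1, h.2.1, h.2.2, neg_neg, neg_neg, mul_neg, mul_neg, mul_comm, Nat.cast_one]

theorem kappa_symm (hg : g.IsFinite) (i j : I) (n : ℤ) : kappa g i j n = kappa g j i n := by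
  rw [kappa, kappa, symQT_symm hg]

theorem cartanQT_det_ne_zero (hg : g.IsFinite) {n : ℤ} (hn : n ≠ 0) : (cartanQT g n).det ≠ 0 := by
  set A : Matrix I I K := fun i j => if i = j then
    val (qt (g.r i * n) (-n)) + val (qt (-(g.r i * n)) n) else
    -∑ s ∈ Finset.range (-g.C i j).toNat, val (qt (n * (-g.C i j - 1 - 2 * s)) 0) with hA
  have h1 : cartanQT g n = (algebraMap K F).mapMatrix A := by
    ext i j
    rw [RingHom.mapMatrix_apply, Matrix.map_apply, hA]
    by_cases hij : i = j
    · subst hij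
      rw [cartanQT_same hg]
      simp only [if_true, map_add]
      rfl
    · rw [cartanQT_ne_sum hg hij hn]
      simp only [if_neg hij, map_neg, map_sum]
      rfl
  have hval : ∀ k l, PowerSeries.constantCoeff (PowerSeries.constantCoeff (val (qt k l))) = 1 := by
    intro k l
    rw [val, map_mul, map_mul, qpow, ← PowerSeries.coeff_zero_eq_constantCoeff_apply
      (PowerSeries.rescale _ _), PowerSeries.coeff_rescale]
    simp [qt]
  have h2 : ((PowerSeries.constantCoeff (R := ℂ)).comp
      (PowerSeries.constantCoeff (R := PowerSeries ℂ))).mapMatrix A =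
      (Int.castRingHom ℂ).mapMatrix g.C := by
    ext i j
    rw [RingHom.mapMatrix_apply, RingHom.mapMatrix_apply, Matrix.map_apply, Matrix.map_apply, hA]
    by_cases hij : i = j
    · subst hij
      simp only [if_true, RingHom.comp_apply, map_add, hval, hg.diag]
      norm_num
    · have h := hg.C_nonpos hij
      have h' : ((-g.C i j).toNat : ℤ) = -g.C i j := Int.toNat_of_nonneg (by omega)
      simp only [if_neg hij, RingHom.comp_apply, map_neg, map_sum, hval, Finset.sum_const,
        Finset.card_range, nsmul_eq_mul, mul_one, eq_intCast]
      rw [← Int.cast_natCast, h', Int.cast_neg, neg_neg]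
  rw [h1, ← RingHom.map_det]
  refine (map_ne_zero_iff _ (IsFractionRing.injective K F)).2 fun h3 => hg.det_ne_zero ?_
  have h4 := congrArg Matrix.det h2
  rw [← RingHom.map_det, ← RingHom.map_det, h3, map_zero] at h4
  exact (Int.cast_eq_zero.1 h4.symm)

/-! ### Contractions of the generators -/

/-- The coefficient of `x_i[n]` in `a_i[n]`. -/
theorem yVec_apply (i k : I) (n : ℤ) :
    yVec g i n k = (cartanQT g n)⁻¹ k i * ((Q n 0 - Q (-n) 0) / (n : F)) := by
  rw [yVec, Finset.sum_apply, Finset.sum_eq_single k]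
  · rw [Pi.smul_apply, aVec, Pi.single_eq_same, smul_eq_mul]
  · intro l _ hl
    rw [Pi.smul_apply, aVec, Pi.single_eq_of_ne hl.symm, smul_zero]
  · simp

theorem aVec_neg (i : I) (n : ℤ) : aVec i (-n) = aVec i n := by
  rw [aVec, aVec, neg_neg, Int.cast_neg]
  exact congrArg _ (sub_div_neg _ _ _)

theorem yVec_neg (i : I) (n : ℤ) : yVec g i (-n) = yVec g i n := by
  simp only [yVec, cartanQT_neg, aVec_neg]

theorem sum_cartanQT_smul_yVec (hg : g.IsFinite) (j : I) {n : ℤ} (hn : n ≠ 0) :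
    ∑ i, cartanQT g n i j • yVec g i n = aVec j n := by
  have hC : (cartanQT g n)⁻¹ * cartanQT g n = 1 :=
    Matrix.nonsing_inv_mul _ (isUnit_iff_ne_zero.2 (cartanQT_det_ne_zero hg hn))
  ext k
  have := congrFun (congrFun hC k) j
  rw [Matrix.mul_apply] at this
  rw [Finset.sum_apply]
  simp only [Pi.smul_apply, smul_eq_mul, yVec_apply]
  simp only [← mul_assoc]
  rw [← Finset.sum_mul, Finset.sum_congr rfl fun i _ => mul_comm _ _, this, aVec, Matrix.one_apply,
    Pi.single_apply]
  split_ifs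
  · rw [one_mul]
  · rw [zero_mul]

theorem sum_yVec_mul_kappa (hg : g.IsFinite) (i j : I) {n : ℤ} (hn : n ≠ 0) :
    ∑ k, yVec g i n k * kappa g k j n =
      if i = j then (Q 0 n - Q 0 (-n)) * qint (g.r j) n else 0 := by
  have hC : cartanQT g n * (cartanQT g n)⁻¹ = 1 :=
    Matrix.mul_nonsing_inv _ (isUnit_iff_ne_zero.2 (cartanQT_det_ne_zero hg hn))
  have hq : Q n 0 - Q (-n) 0 ≠ 0 := Q_sub_Q_ne_zero (.inl (by omega))
  have hn' : (n : F) ≠ 0 := Int.cast_ne_zero.2 hn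
  have e : ∀ k, yVec g i n k * kappa g k j n = (Q 0 n - Q 0 (-n)) * qint (g.r j) n *
      (cartanQT g n j k * (cartanQT g n)⁻¹ k i) := by
    intro k
    rw [yVec_apply, kappa, symQT_symm hg, symQT_apply]
    field_simp
  have := congrFun (congrFun hC j) i
  rw [Matrix.mul_apply] at this
  rw [Finset.sum_congr rfl fun k _ => e k, ← Finset.mul_sum, this, Matrix.one_apply]
  by_cases h : i = j
  · rw [if_pos h, if_pos h.symm, mul_one]
  · rw [if_neg h, if_neg (Ne.symm h), mul_zero]

theorem coe_vF_qt_zpow (k l n : ℤ) : ((vF (qt k l) ^ n : Fˣ) : F) = Q (n * k) (n * l) := by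
  rw [← map_zpow, qt_zpow]; rfl

/-- A multiple of `a_j[n]` together with the directions in which it acts: its contraction with
`y_i[n]` is `-δ_ij (τ^n - τ^{-n}) / n`. -/
structure Screening (g : CartanData I) (j : I) (τ p : Spec) (σ : ℤ → I → F) : Prop where
  directions : Directions g j p (τ ^ 2)
  contract_left : ∀ n : ℕ, 0 < n → ∀ i, ∑ k, ∑ l, yVec g i n k * σ (-n) l * kappa g k l n =
    if i = j then -(((vF τ ^ (n : ℤ) : Fˣ) : F) - ((vF τ ^ (-n : ℤ) : Fˣ) : F)) / n else 0
  contract_right : ∀ n : ℕ, 0 < n → ∀ i, ∑ k, ∑ l, σ n k * yVec g i (-n) l * kappa g k l n =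
    if i = j then (((vF τ ^ (n : ℤ) : Fˣ) : F) - ((vF τ ^ (-n : ℤ) : Fˣ) : F)) / n else 0
  aVec_eq : ∀ n : ℤ, n ≠ 0 → ((vF (qt (-g.r j) 1) ^ (-n) : Fˣ) : F) • aVec j n =
    (((vF (τ * p) ^ (-n) : Fˣ) : F) - ((vF τ ^ (-n) : Fˣ) : F)) • σ n

theorem contraction_of_single (hg : g.IsFinite) {j : I} {σ : ℤ → I → F} {y : ℤ → F}
    (hσ : ∀ n, σ n = Pi.single j (y n)) (hodd : ∀ n, y (-n) = -y n) {n : ℕ} (hn : 0 < n) (i : I) :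
    (∑ k, ∑ l, yVec g i n k * σ (-n) l * kappa g k l n =
      if i = j then -((Q 0 n - Q 0 (-n)) * qint (g.r j) n * y n) else 0) ∧
    (∑ k, ∑ l, σ n k * yVec g i (-n) l * kappa g k l n =
      if i = j then (Q 0 n - Q 0 (-n)) * qint (g.r j) n * y n else 0) := by
  have hn' : (n : ℤ) ≠ 0 := by omega
  have key : ∀ c : F, ∑ k, ∑ l, yVec g i n k * (Pi.single j c : I → F) l * kappa g k l n =
      if i = j then (Q 0 n - Q 0 (-n)) * qint (g.r j) n * c else 0 := by
    intro c
    have e : ∀ k, ∑ l, yVec g i n k * (Pi.single j c : I → F) l * kappa g k l n =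
        yVec g i n k * kappa g k j n * c := by
      intro k
      rw [Finset.sum_eq_single j]
      · rw [Pi.single_eq_same]; ring
      · intro l _ hl
        rw [Pi.single_eq_of_ne hl, mul_zero, zero_mul]
      · simp
    rw [Finset.sum_congr rfl fun k _ => e k, ← Finset.sum_mul, sum_yVec_mul_kappa hg i j hn', ite_mul,
      zero_mul]
  constructor
  · rw [hσ, key, hodd, mul_neg]
  · rw [hσ, yVec_neg, Finset.sum_comm, ← key]
    refine Finset.sum_congr rfl fun k _ => Finset.sum_congr rfl fun l _ => ?_
    rw [kappa_symm hg l k]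
    ring

theorem screening_plus (hg : g.IsFinite) (j : I) :
    Screening g j (qt 0 1) (qt (-2 * g.r j) 0) (sPlusVec g j) := by
  have hr : (0 : ℤ) < g.r j := by exact_mod_cast hg.r_pos j
  set y : ℤ → F := fun n => (Q (n * g.r j) 0 - Q (-(n * g.r j)) 0)⁻¹ *
    ((Q n 0 - Q (-n) 0) / (n : F)) with hy
  have hσ : ∀ n, sPlusVec g j n = Pi.single j (y n) := by
    intro n
    rw [sPlusVec, aVec, ← Pi.single_smul, smul_eq_mul]
  have hodd : ∀ n, y (-n) = -y n := by
    intro n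
    rw [hy]
    simp only [neg_neg, neg_mul, Int.cast_neg]
    exact (congrArg _ (sub_div_neg _ _ _)).trans (inv_sub_mul_swap _ _ _)
  have hyn : ∀ n : ℤ, n ≠ 0 → qint (g.r j) n * y n = 1 / n := by
    intro n hn
    have h1 : Q n 0 - Q (-n) 0 ≠ 0 := Q_sub_Q_ne_zero (.inl (by omega))
    have h2 : Q (n * g.r j) 0 - Q (-(n * g.r j)) 0 ≠ 0 :=
      Q_sub_Q_ne_zero (.inl fun h => mul_ne_zero hn hr.ne' (by omega))
    have h3 : (n : F) ≠ 0 := Int.cast_ne_zero.2 hn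
    rw [hy, qint]
    field_simp
  refine ⟨.inl ⟨rfl, by rw [← zpow_ofNat, qt_zpow]; rfl⟩, fun n hn i => ?_, fun n hn i => ?_, fun n hn => ?_⟩
  · rw [(contraction_of_single hg hσ hodd hn i).1, mul_assoc, hyn n (by omega), coe_vF_qt_zpow,
      coe_vF_qt_zpow, Int.cast_natCast, mul_one_div, mul_zero, mul_zero, mul_one, mul_one]
    exact if_congr Iff.rfl (neg_div_eq_neg_div _ _).symm rfl
  · rw [(contraction_of_single hg hσ hodd hn i).2, mul_assoc, hyn n (by omega), coe_vF_qt_zpow,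
      coe_vF_qt_zpow, Int.cast_natCast, mul_one_div, mul_zero, mul_zero, mul_one, mul_one]
  · have h2 : Q (n * g.r j) 0 - Q (-(n * g.r j)) 0 ≠ 0 :=
      Q_sub_Q_ne_zero (.inl fun h => mul_ne_zero hn hr.ne' (by omega))
    rw [sPlusVec, smul_smul]
    congr 1
    rw [eq_mul_inv_iff_mul_eq₀ h2, qt_mul, coe_vF_qt_zpow, coe_vF_qt_zpow, coe_vF_qt_zpow, mul_sub,
      Q_mul, Q_mul]
    congr 2 <;> ring

theorem screening_minus (hg : g.IsFinite) (j : I) :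
    Screening g j (qt (-g.r j) 0) (qt 0 2) (fun n => -sMinusVec j n) := by
  have hr : (0 : ℤ) < g.r j := by exact_mod_cast hg.r_pos j
  set y : ℤ → F := fun n => -((Q 0 n - Q 0 (-n))⁻¹ * ((Q n 0 - Q (-n) 0) / (n : F))) with hy
  have hσ : ∀ n, -sMinusVec j n = Pi.single j (y n) := by
    intro n
    rw [sMinusVec, aVec, ← Pi.single_smul, smul_eq_mul, hy, Pi.single_neg]
  have hodd : ∀ n, y (-n) = -y n := by
    intro n
    rw [hy]
    simp only [neg_neg, Int.cast_neg]
    refine (congrArg _ ((congrArg _ (sub_div_neg _ _ _)).trans (inv_sub_mul_swap _ _ _))).trans ?_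
    exact neg_neg _
  have hyn : ∀ n : ℤ, n ≠ 0 → (Q 0 n - Q 0 (-n)) * qint (g.r j) n * y n =
      -((Q (g.r j * n) 0 - Q (-(g.r j * n)) 0) / n) := by
    intro n hn
    have h1 : Q n 0 - Q (-n) 0 ≠ 0 := Q_sub_Q_ne_zero (.inl (by omega))
    have h2 : Q 0 n - Q 0 (-n) ≠ 0 := Q_sub_Q_ne_zero (.inr (by omega))
    have h3 : (n : F) ≠ 0 := Int.cast_ne_zero.2 hn
    rw [← qint_mul _ hn, hy]
    field_simp
  refine ⟨.inr ⟨rfl, by rw [← zpow_ofNat, qt_zpow]; norm_num⟩, fun n hn i => ?_, fun n hn i => ?_, fun n hn => ?_⟩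
  · rw [(contraction_of_single hg hσ hodd hn i).1, hyn n (by omega), coe_vF_qt_zpow,
      coe_vF_qt_zpow, Int.cast_natCast, neg_neg, neg_sub, mul_zero, mul_zero]
    ring_nf
  · rw [(contraction_of_single hg hσ hodd hn i).2, hyn n (by omega), coe_vF_qt_zpow,
      coe_vF_qt_zpow, Int.cast_natCast, ← neg_div, neg_sub, mul_zero, mul_zero]
    ring_nf
  · have h2 : Q 0 n - Q 0 (-n) ≠ 0 := Q_sub_Q_ne_zero (.inr (by omega))
    rw [sMinusVec, smul_neg, smul_smul, ← neg_smul]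
    congr 1
    rw [← neg_mul, eq_mul_inv_iff_mul_eq₀ h2, qt_mul, coe_vF_qt_zpow, coe_vF_qt_zpow,
      coe_vF_qt_zpow, mul_sub, Q_mul, Q_mul, neg_sub]
    congr 2 <;> ring

end DeformedW

end

noncomputable section

namespace DeformedW

/-! ### The columns of a monomial -/

variable {I : Type*}

/-- The part of a monomial of colour `j`. -/
def column (M : Mono I) (j : I) : Spec →₀ ℤ :=
  M.comapDomain (Prod.mk j) (Prod.mk_right_injective j).injOn

theorem column_apply (M : Mono I) (j : I) (a : Spec) : column M j a = M (j, a) := rfl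

theorem sum_column {V : Type*} [AddCommMonoid V] [DecidableEq I] (M : Mono I) (j : I)
    (f : Spec → ℤ → V) :
    (M.sum fun p e => if p.1 = j then f p.2 e else 0) = (column M j).sum f := by
  rw [Finsupp.sum, Finsupp.sum, ← Finset.sum_filter]
  symm
  refine Finset.sum_bij (fun a _ => (j, a)) ?_ ?_ ?_ ?_
  · intro a ha
    rw [Finsupp.mem_support_iff, column_apply] at ha
    exact Finset.mem_filter.2 ⟨Finsupp.mem_support_iff.2 ha, rfl⟩
  · intro a _ b _ h
    exact (Prod.mk.inj h).2
  · rintro ⟨i, a⟩ h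
    obtain ⟨h1, rfl⟩ := Finset.mem_filter.1 h
    exact ⟨a, Finsupp.mem_support_iff.2 (by rwa [column_apply, ← Finsupp.mem_support_iff]), rfl⟩
  · intro a _
    rfl

/-- The differences `d_a - d_{as}` of a family of degrees. -/
def descent (c : Spec →₀ ℤ) (s a : Spec) : ℤ := c a - c (a * s)

/-- The places where the differences `d_a - d_{as}` may be nonzero. -/
def descentSupport (c : Spec →₀ ℤ) (s : Spec) : Finset Spec :=
  open scoped Classical in c.support ∪ c.support.image (· * s⁻¹)

theorem mem_descentSupport {c : Spec →₀ ℤ} {s a : Spec} (h : descent c s a ≠ 0) :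
    a ∈ descentSupport c s := by
  classical
  rw [descentSupport, Finset.mem_union, Finset.mem_image]
  by_cases h1 : c a = 0
  · refine .inr ⟨a * s, Finsupp.mem_support_iff.2 fun h2 => h ?_, mul_inv_cancel_right a s⟩
    rw [descent, h1, h2, sub_zero]
  · exact .inl (Finsupp.mem_support_iff.2 h1)

@[to_additive sum_descent_zsmul]
theorem prod_zpow_descent {G : Type*} [CommGroup G] (c : Spec →₀ ℤ) (s : Spec) (φ : Spec → G) :
    ∏ a ∈ descentSupport c s, φ a ^ descent c s a =
      c.prod fun b e => (φ b / φ (b * s⁻¹)) ^ e := by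
  classical
  have h1 : ∏ a ∈ descentSupport c s, φ a ^ c a = c.prod fun b e => φ b ^ e := by
    rw [Finsupp.prod]
    refine (Finset.prod_subset Finset.subset_union_left fun a _ ha => ?_).symm
    rw [Finsupp.notMem_support_iff.1 ha, zpow_zero]
  have h2 : ∏ a ∈ descentSupport c s, φ a ^ c (a * s) =
      c.prod fun b e => φ (b * s⁻¹) ^ e := by
    rw [Finsupp.prod]
    symm
    refine Finset.prod_of_injOn (· * s⁻¹) ((mul_left_injective _).injOn) ?_ ?_ ?_
    · intro b hb
      exact Finset.mem_coe.2 (Finset.mem_union_right _ (Finset.mem_image_of_mem _ hb))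
    · intro a _ ha
      rw [Finsupp.notMem_support_iff.1 fun h => ha ⟨a * s, h, mul_inv_cancel_right a s⟩, zpow_zero]
    · intro b _
      simp only [inv_mul_cancel_right]
  simp only [descent, zpow_sub, ← div_eq_mul_inv, Finset.prod_div_distrib, h1, h2, div_zpow,
    Finsupp.prod]

theorem sum_descent_mul {R : Type*} [CommRing R] (c : Spec →₀ ℤ) (s : Spec) (φ : Spec → R) :
    ∑ a ∈ descentSupport c s, (descent c s a : R) * φ a =
      c.sum fun b e => (e : R) * (φ b - φ (b * s⁻¹)) := by
  have := sum_descent_zsmul c s φ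
  simpa only [zsmul_eq_mul] using this

theorem sum_descent (c : Spec →₀ ℤ) (s : Spec) : ∑ a ∈ descentSupport c s, descent c s a = 0 := by
  have := sum_descent_mul c s fun _ => (1 : ℤ)
  simpa using this

/-! ### The vertex operators of monomials -/

variable [Fintype I] [DecidableEq I] {g : CartanData I} {j : I}

variable (g) in
/-- The coefficients of the exponent of the field of a monomial. -/
def coeffs (M : Mono I) : ℤ → I → F := fun n =>
  M.sum fun p e => ((e : F) * algebraMap K F (val (p.2 ^ (-n)))) • yVec g p.1 n

theorem coeffs_add (M N : Mono I) : coeffs g (M + N) = coeffs g M + coeffs g N := by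
  ext1 n
  refine Finsupp.sum_add_index' (fun p => ?_) fun p e e' => ?_
  · rw [Int.cast_zero, zero_mul, zero_smul]
  · rw [Int.cast_add, add_mul, add_smul]

theorem coeffs_sub (M N : Mono I) : coeffs g (M - N) = coeffs g M - coeffs g N := by
  rw [eq_sub_iff_add_eq, ← coeffs_add, sub_add_cancel]

theorem coeffs_zero : coeffs g (0 : Mono I) = 0 := rfl

theorem coeffs_sum {ι : Type*} (t : Finset ι) (M : ι → Mono I) :
    coeffs g (∑ x ∈ t, M x) = ∑ x ∈ t, coeffs g (M x) := by
  classical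
  induction t using Finset.induction_on with
  | empty => exact coeffs_zero
  | insert x t hx ih => rw [Finset.sum_insert hx, Finset.sum_insert hx, coeffs_add, ih]

theorem coeffs_single (i : I) (a : Spec) (n : ℤ) :
    coeffs g (Finsupp.single (i, a) 1) n = ((vF a ^ (-n) : Fˣ) : F) • yVec g i n := by
  rw [coeffs, Finsupp.sum_single_index]
  · rw [Int.cast_one, one_mul, ← map_zpow]; rfl
  · rw [Int.cast_zero, zero_mul, zero_smul]

theorem coeffs_root (hg : g.IsFinite) (j : I) (a : Spec) {n : ℤ} (hn : n ≠ 0) :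
    coeffs g (root g j a) n =
      ((vF (a * qt (-g.r j) 1) ^ (-n) : Fˣ) : F) • aVec j n := by
  have e : ∀ (b : Spec) (k l : ℤ), ((vF (b * qt k l) ^ (-n) : Fˣ) : F) =
      ((vF b ^ (-n) : Fˣ) : F) * Q (-n * k) (-n * l) := by
    intro b k l
    rw [map_mul, mul_zpow, Units.val_mul, coe_vF_qt_zpow]
  generalize hb : a * qt (-g.r j) 1 = b
  rw [root, rootMono, hb, coeffs_sub, coeffs_add, coeffs_sum, Pi.sub_apply, Pi.add_apply,
    coeffs_single, coeffs_single, e b (g.r j), e b (-g.r j), Finset.sum_apply,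
    ← sum_cartanQT_smul_yVec hg j hn, ← Finset.add_sum_erase _ _ (Finset.mem_univ j), smul_add,
    cartanQT_same hg, ← add_smul, ← mul_add, smul_smul, sub_eq_add_neg, ← Finset.sum_neg_distrib,
    Finset.smul_sum]
  congr 1
  · rw [show Q (-n * g.r j) (-n * -1) = Q (-(g.r j * n)) n by congr 1 <;> ring,
      show Q (-n * -g.r j) (-n * 1) = Q (g.r j * n) (-n) by congr 1 <;> ring,
      add_comm (Q (-(g.r j * n)) n)]
  · refine Finset.sum_congr rfl fun i hi => ?_
    rw [coeffs_sum, Finset.sum_apply, cartanQT_ne_sum hg (Finset.ne_of_mem_erase hi) hn, neg_smul,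
      smul_neg, Finset.sum_smul, Finset.smul_sum, neg_inj, ← Finset.sum_range_reflect]
    refine Finset.sum_congr rfl fun s hs => ?_
    have hs' := Finset.mem_range.1 hs
    have h1 : -n * (-g.C i j - 1 - 2 * (((-g.C i j).toNat - 1 - s : ℕ) : ℤ)) =
        n * (-g.C i j - 1 - 2 * s) := by
      rw [Nat.sub_sub, Nat.cast_sub (by omega), Int.toNat_of_nonneg (by omega)]
      push_cast
      ring
    rw [coeffs_single, e, smul_smul, mul_zero, h1]

variable (g) in
/-- The exponent of `q` in the constant factor of the field of a monomial. -/
def zeroWeight (M : Mono I) (ν : Weight I) : Polynomial ℂ :=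
  M.sum fun p e => e • zeroMode g p.1 ν

theorem zeroWeight_add (M N : Mono I) (ν : Weight I) :
    zeroWeight g (M + N) ν = zeroWeight g M ν + zeroWeight g N ν :=
  Finsupp.sum_add_index' (fun _ => zero_smul _ _) fun _ _ _ => add_smul _ _ _

theorem zeroWeight_sub (M N : Mono I) (ν : Weight I) :
    zeroWeight g (M - N) ν = zeroWeight g M ν - zeroWeight g N ν := by
  rw [eq_sub_iff_add_eq, ← zeroWeight_add, sub_add_cancel]

theorem zeroWeight_sum {ι : Type*} (t : Finset ι) (M : ι → Mono I) (ν : Weight I) :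
    zeroWeight g (∑ x ∈ t, M x) ν = ∑ x ∈ t, zeroWeight g (M x) ν := by
  classical
  induction t using Finset.induction_on with
  | empty => exact Finsupp.sum_zero_index
  | insert x t hx ih => rw [Finset.sum_insert hx, Finset.sum_insert hx, zeroWeight_add, ih]

theorem zeroWeight_single (i : I) (a : Spec) (ν : Weight I) :
    zeroWeight g (Finsupp.single (i, a) 1) ν = zeroMode g i ν := by
  rw [zeroWeight, Finsupp.sum_single_index, one_smul]
  exact zero_smul _ _

variable (g) in
/-- The eigenvalue on `π_ν` of the constant factor of the field of a monomial. -/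
def zeta (M : Mono I) (ν : Weight I) : F :=
  algebraMap K F (qpow (zeroWeight g M ν : PowerSeries ℂ))

theorem zeta_add (M N : Mono I) (ν : Weight I) :
    zeta g (M + N) ν = zeta g M ν * zeta g N ν := by
  rw [zeta, zeroWeight_add, Polynomial.coe_add, qpow_add, map_mul]
  rfl

theorem zeta_sub_mul (M N : Mono I) (ν : Weight I) :
    zeta g (M - N) ν * zeta g N ν = zeta g M ν := by
  rw [← zeta_add, sub_add_cancel]

theorem qpow_coe_val (k l : ℤ) :
    qpow ((Polynomial.C (k : ℂ) + Polynomial.C (l : ℂ) * Polynomial.X : Polynomial ℂ) :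
      PowerSeries ℂ) = val (qt k l) := by
  rw [val, qt]
  simp only [Units.val_one, map_one, one_mul, toAdd_ofAdd, Polynomial.coe_add, Polynomial.coe_mul,
    Polynomial.coe_C, Polynomial.coe_X]

theorem zeroMode_add_single (i j : I) (ν : Weight I) (ξ : Polynomial ℂ) :
    zeroMode g i (ν + Pi.single j ξ) = zeroMode g i ν + if i = j then 2 * (ξ * (g.r j : Polynomial ℂ)) else 0 := by
  rw [zeroMode, zeroMode, Pi.add_apply]
  split_ifs with h
  · subst h
    rw [Pi.single_eq_same]
    ring
  · rw [Pi.single_eq_of_ne h, add_zero, add_zero]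

theorem zeroWeight_add_single (M : Mono I) (j : I) (ν : Weight I) (ξ : Polynomial ℂ) :
    zeroWeight g M (ν + Pi.single j ξ) = zeroWeight g M ν +
      ((column M j).sum fun _ e => e) • (2 * (ξ * (g.r j : Polynomial ℂ))) := by
  rw [← sum_column M j fun _ e => e, zeroWeight, zeroWeight, Finsupp.sum, Finsupp.sum, Finsupp.sum,
    Finset.sum_smul, ← Finset.sum_add_distrib]
  refine Finset.sum_congr rfl fun p _ => ?_
  rw [zeroMode_add_single, smul_add, smul_ite, ite_smul, smul_zero, zero_smul]

theorem sum_cartan_mul_inv (hg : g.IsFinite) (j : I) (f : I → ℂ) :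
    ∑ i, (g.C i j : ℂ) * ∑ k, (g.C.map (Int.cast : ℤ → ℂ))⁻¹ k i * f k = f j := by
  have hdet : IsUnit (g.C.map (Int.cast : ℤ → ℂ)).det := by
    have h : g.C.map (Int.cast : ℤ → ℂ) = (Int.castRingHom ℂ).mapMatrix g.C := rfl
    rw [isUnit_iff_ne_zero, h, ← RingHom.map_det, eq_intCast, Int.cast_ne_zero]
    exact hg.det_ne_zero
  have hC := Matrix.nonsing_inv_mul _ hdet
  simp only [Finset.mul_sum]
  rw [Finset.sum_comm]
  have e : ∀ k, ∑ i, (g.C i j : ℂ) * ((g.C.map (Int.cast : ℤ → ℂ))⁻¹ k i * f k) =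
      (if k = j then 1 else 0) * f k := by
    intro k
    have := congrFun (congrFun hC k) j
    rw [Matrix.mul_apply, Matrix.one_apply] at this
    rw [← this, Finset.sum_mul]
    refine Finset.sum_congr rfl fun i _ => ?_
    rw [Matrix.map_apply]
    ring
  rw [Finset.sum_congr rfl fun k _ => e k]
  simp

theorem zeta_root (hg : g.IsFinite) (j : I) (a : Spec) :
    zeta g (root g j a) 0 = vF (qt (-2 * g.r j) 2) := by
  have e : ∀ i, zeroMode g i 0 = Polynomial.C (2 * rhoCheckOmega g i) * Polynomial.X -
      Polynomial.C (2 * rhoOmega g i) := by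
    intro i
    rw [zeroMode, Pi.zero_apply, zero_mul, mul_zero, add_zero]
  have h : zeroWeight g (root g j a) 0 = ∑ i, g.C i j • zeroMode g i 0 := by
    rw [root, rootMono, zeroWeight_sub, zeroWeight_add, zeroWeight_single, zeroWeight_single,
      zeroWeight_sum, ← Finset.add_sum_erase _ _ (Finset.mem_univ j), hg.diag, sub_eq_add_neg,
      ← Finset.sum_neg_distrib, two_smul]
    congr 1
    refine Finset.sum_congr rfl fun i hi => ?_
    rw [zeroWeight_sum]
    simp only [zeroWeight_single]
    rw [Finset.sum_const, Finset.card_range, ← natCast_zsmul, ← neg_smul, Int.toNat_of_nonneg, neg_neg]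
    have := hg.C_nonpos (Finset.ne_of_mem_erase hi)
    omega
  have h1 : ∑ i, (g.C i j : ℂ) * (2 * rhoCheckOmega g i) = 2 := by
    refine (Finset.sum_congr rfl fun i _ => ?_).trans (sum_cartan_mul_inv hg j fun _ => 2)
    rw [rhoCheckOmega, mul_comm 2, Finset.sum_mul]
  have h2 : ∑ i, (g.C i j : ℂ) * (2 * rhoOmega g i) = 2 * g.r j := by
    refine (Finset.sum_congr rfl fun i _ => ?_).trans (sum_cartan_mul_inv hg j fun k => 2 * g.r k)
    rw [rhoOmega, Finset.mul_sum]
    congr 1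
    exact Finset.sum_congr rfl fun k _ => by ring
  have h3 : zeroWeight g (root g j a) 0 =
      Polynomial.C ((-2 * g.r j : ℤ) : ℂ) + Polynomial.C ((2 : ℤ) : ℂ) * Polynomial.X := by
    have e' : ∀ i, g.C i j • zeroMode g i 0 =
        Polynomial.C ((g.C i j : ℂ) * (2 * rhoCheckOmega g i)) * Polynomial.X -
          Polynomial.C ((g.C i j : ℂ) * (2 * rhoOmega g i)) := by
      intro i
      rw [e, zsmul_eq_mul, mul_sub, ← mul_assoc, Polynomial.C_mul, Polynomial.C_mul (a := (g.C i j : ℂ))]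
      simp
    rw [h, Finset.sum_congr rfl fun i _ => e' i, Finset.sum_sub_distrib, ← Finset.sum_mul,
      ← map_sum, ← map_sum, h1, h2]
    simp only [Int.cast_mul, Int.cast_neg, Int.cast_ofNat, Int.cast_natCast, neg_mul, map_neg]
    ring
  rw [zeta, h3, qpow_coe_val, coe_vF]

end DeformedW

end

noncomputable section

namespace DeformedW

/-! ### Commutators of monomials with screening operators -/

variable {I : Type*} [Fintype I] [DecidableEq I] {g : CartanData I} {j : I} {τ p : Spec}
  {σ : ℤ → I → F}

theorem coeff_pairing_coeffs_left (M : Mono I) (n : ℕ) :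
    PowerSeries.coeff n (pairing g (coeffs g M) σ) = M.sum fun u e =>
      (e * ((vF u.2 ^ (-n : ℤ) : Fˣ) : F)) *
        ∑ k, ∑ l, yVec g u.1 n k * σ (-n) l * kappa g k l n := by
  have e : ∀ k l, coeffs g M n k * σ (-n) l * kappa g k l n = ∑ u ∈ M.support,
      (M u * ((vF u.2 ^ (-n : ℤ) : Fˣ) : F)) * (yVec g u.1 n k * σ (-n) l * kappa g k l n) := by
    intro k l
    rw [coeffs, Finsupp.sum, Finset.sum_apply, Finset.sum_mul, Finset.sum_mul]
    refine Finset.sum_congr rfl fun u _ => ?_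
    rw [Pi.smul_apply, smul_eq_mul, ← map_zpow, coe_vF]
    ring
  rw [pairing, PowerSeries.coeff_mk, Finsupp.sum]
  simp only [e, Finset.mul_sum]
  rw [Finset.sum_congr rfl fun k _ => Finset.sum_comm, Finset.sum_comm]

theorem coeff_pairing_coeffs_right (M : Mono I) (n : ℕ) :
    PowerSeries.coeff n (pairing g σ (coeffs g M)) = M.sum fun u e =>
      (e * ((vF u.2 ^ (n : ℤ) : Fˣ) : F)) *
        ∑ k, ∑ l, σ n k * yVec g u.1 (-n) l * kappa g k l n := by
  have e : ∀ k l, σ n k * coeffs g M (-n) l * kappa g k l n = ∑ u ∈ M.support,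
      (M u * ((vF u.2 ^ (n : ℤ) : Fˣ) : F)) * (σ n k * yVec g u.1 (-n) l * kappa g k l n) := by
    intro k l
    rw [coeffs, Finsupp.sum, Finset.sum_apply, Finset.mul_sum, Finset.sum_mul]
    refine Finset.sum_congr rfl fun u _ => ?_
    rw [Pi.smul_apply, smul_eq_mul, ← map_zpow, coe_vF, neg_neg]
    ring
  rw [pairing, PowerSeries.coeff_mk, Finsupp.sum]
  simp only [e, Finset.mul_sum]
  rw [Finset.sum_congr rfl fun k _ => Finset.sum_comm, Finset.sum_comm]

theorem Screening.coeff_pairing_left (h : Screening g j τ p σ) (M : Mono I) (n : ℕ) :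
    PowerSeries.coeff n (pairing g (coeffs g M) σ) =
      ∑ a ∈ descentSupport (column M j) (τ ^ 2), (descent (column M j) (τ ^ 2) a : F) *
        (((vF (τ * a))⁻¹ : Fˣ) ^ n / n : F) := by
  rw [coeff_pairing_coeffs_left, sum_descent_mul (column M j) (τ ^ 2)
    (fun a => (((vF (τ * a))⁻¹ : Fˣ) ^ n / n : F)), ← sum_column M j fun b e => (e : F) *
      (((vF (τ * b))⁻¹ : Fˣ) ^ n / n - ((vF (τ * (b * (τ ^ 2)⁻¹)))⁻¹ : Fˣ) ^ n / n : F)]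
  refine Finsupp.sum_congr fun u _ => ?_
  rcases Nat.eq_zero_or_pos n with rfl | hn
  · simp [kappa]
  rw [h.contract_left n hn u.1, mul_ite, mul_zero]
  refine if_congr Iff.rfl ?_ rfl
  rw [mul_assoc, show τ * (u.2 * (τ ^ 2)⁻¹) = τ⁻¹ * u.2 by
    rw [mul_left_comm, pow_two, mul_inv, mul_inv_cancel_left, mul_comm], map_mul, map_mul,
    map_inv, mul_inv, mul_inv, inv_inv, ← sub_div, ← mul_div_assoc, ← Units.val_pow_eq_pow_val,
    ← Units.val_pow_eq_pow_val, mul_pow, mul_pow, Units.val_mul, Units.val_mul, zpow_neg, zpow_neg,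
    zpow_natCast, zpow_natCast, inv_pow, inv_pow]
  congr 2
  ring

theorem Screening.coeff_pairing_right (h : Screening g j τ p σ) (M : Mono I) (n : ℕ) :
    PowerSeries.coeff n (pairing g σ (coeffs g M)) =
      ∑ a ∈ descentSupport (column M j) (τ ^ 2), (descent (column M j) (τ ^ 2) a : F) *
        ((((vF (τ * a))⁻¹ : Fˣ) : F)⁻¹ ^ n / n) := by
  rw [coeff_pairing_coeffs_right, sum_descent_mul (column M j) (τ ^ 2)
    (fun a => ((((vF (τ * a))⁻¹ : Fˣ) : F)⁻¹ ^ n / n)), ← sum_column M j fun b e => (e : F) *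
      ((((vF (τ * b))⁻¹ : Fˣ) : F)⁻¹ ^ n / n - (((vF (τ * (b * (τ ^ 2)⁻¹)))⁻¹ : Fˣ) : F)⁻¹ ^ n / n)]
  refine Finsupp.sum_congr fun u _ => ?_
  rcases Nat.eq_zero_or_pos n with rfl | hn
  · simp [kappa]
  rw [h.contract_right n hn u.1, mul_ite, mul_zero]
  refine if_congr Iff.rfl ?_ rfl
  rw [mul_assoc, show τ * (u.2 * (τ ^ 2)⁻¹) = τ⁻¹ * u.2 by
    rw [mul_left_comm, pow_two, mul_inv, mul_inv_cancel_left, mul_comm], map_mul, map_mul,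
    map_inv, ← Units.val_inv_eq_inv_val, ← Units.val_inv_eq_inv_val, inv_inv, inv_inv, ← sub_div,
    ← mul_div_assoc, ← Units.val_pow_eq_pow_val, ← Units.val_pow_eq_pow_val, mul_pow, mul_pow,
    Units.val_mul, Units.val_mul, zpow_neg, zpow_natCast, zpow_natCast, inv_pow]
  congr 2
  ring

/-- The powers of `q` with polynomial exponents. -/
def qF : Multiplicative (Polynomial ℂ) →* Fˣ := MonoidHom.toHomUnits
  { toFun := fun x => algebraMap K F (qpow ((Multiplicative.toAdd x : Polynomial ℂ) : PowerSeries ℂ))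
    map_one' := by rw [toAdd_one, Polynomial.coe_zero, qpow_zero, map_one]
    map_mul' := fun x y => by rw [toAdd_mul, Polynomial.coe_add, qpow_add, map_mul] }

theorem zeta_eq_qF (M : Mono I) (ν : Weight I) :
    zeta g M ν = qF (Multiplicative.ofAdd (zeroWeight g M ν)) := rfl

/-- The shift of weights by `ξ` in the direction of `r α_j` multiplies the factor `q^{2 y_j[0]}` by
`τ^{-2}`. -/
def ShiftBy (g : CartanData I) (j : I) (τ : Spec) (ξ : Polynomial ℂ) : Prop :=
  qF (Multiplicative.ofAdd (2 * (ξ * (g.r j : Polynomial ℂ)))) = vF τ ^ (-2 : ℤ)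

theorem ShiftBy.zeta_eq {ξ : Polynomial ℂ} (h : ShiftBy g j τ ξ) (M : Mono I) (ν : Weight I) :
    zeta g M (ν + Pi.single j ξ) =
      zeta g M ν * ((vF τ ^ (-2 : ℤ) : Fˣ) ^ ((column M j).sum fun _ e => e) : Fˣ) := by
  rw [zeta_eq_qF, zeroWeight_add_single, ofAdd_add, map_mul, ofAdd_zsmul, map_zpow, h, Units.val_mul]
  rfl

/-- The residue of the contraction of a monomial with a screening current at a simple pole. -/
def poleResidue (M : Mono I) (j : I) (τ a : Spec) : F :=
  open scoped Classical in
  residue (descentSupport (column M j) (τ ^ 2)) (descent (column M j) (τ ^ 2))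
    (fun a => (((vF (τ * a))⁻¹ : Fˣ) : F)) a

theorem prod_vF_descent (c : Spec →₀ ℤ) (τ : Spec) :
    ∏ a ∈ descentSupport c (τ ^ 2), (((vF (τ * a))⁻¹ : Fˣ) : F) ^ (-descent c (τ ^ 2) a) =
      ((vF τ ^ (-2 : ℤ) : Fˣ) ^ (c.sum fun _ e => e) : Fˣ)⁻¹ := by
  have h1 := prod_zpow_descent c (τ ^ 2) fun a => vF (τ * a)
  have h2 : (c.prod fun b e => (vF (τ * b) / vF (τ * (b * (τ ^ 2)⁻¹))) ^ e) =
      (vF τ ^ (2 : ℤ)) ^ (c.sum fun _ e => e) := by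
    have h3 : ∀ b : Spec, vF (τ * b) / vF (τ * (b * (τ ^ 2)⁻¹)) = vF τ ^ (2 : ℤ) := by
      intro b
      rw [← map_div, show τ * b / (τ * (b * (τ ^ 2)⁻¹)) = τ ^ 2 by
        rw [← mul_assoc, div_mul_eq_div_div, div_self', one_div, inv_inv], map_pow, zpow_ofNat]
    simp only [h3]
    rw [Finsupp.prod, Finsupp.sum]
    induction c.support using Finset.induction_on with
    | empty => simp
    | insert b t hb ih => rw [Finset.prod_insert hb, Finset.sum_insert hb, ih, zpow_add]
  rw [h2] at h1
  rw [zpow_neg, inv_zpow, inv_inv, ← h1, Units.coe_prod]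
  refine Finset.prod_congr rfl fun a _ => ?_
  rw [← Units.val_zpow_eq_zpow_val, inv_zpow, zpow_neg, inv_inv]

theorem Screening.commutator (h : Screening g j τ p σ) {ξ : Polynomial ℂ} (hξ : ShiftBy g j τ ξ)
    (M : Mono I) (hM : ∀ a, descent (column M j) (τ ^ 2) a ≤ 1) (k : ℤ) (f : FockPoly I) :
    zeta g M (0 + Pi.single j ξ) • vertexCoeff g (coeffs g M) k (vertexCoeff g σ (-1) f) -
        zeta g M 0 • vertexCoeff g σ (-1) (vertexCoeff g (coeffs g M) k f) =
      ∑ a ∈ descentSupport (column M j) (τ ^ 2) with descent (column M j) (τ ^ 2) a = 1,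
        (zeta g M (0 + Pi.single j ξ) * poleResidue M j τ a * vF (τ * a)) •
          vertexCoeff g (coeffs g M + dilate (((vF (τ * a))⁻¹ : Fˣ) : F) σ) (k - 1) f := by
  classical
  have hinj : Set.InjOn (fun a => (((vF (τ * a))⁻¹ : Fˣ) : F))
      (descentSupport (column M j) (τ ^ 2)) := by
    intro a _ b _ hab
    exact mul_left_cancel (vF_injective (inv_injective (Units.ext hab)))
  have h1 := expCoeff_sub_expCoeff (fun a _ => hM a) (sum_descent (column M j) (τ ^ 2))
    (x := fun a => (((vF (τ * a))⁻¹ : Fˣ) : F)) (fun a _ => Units.ne_zero _) hinj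
    (h.coeff_pairing_left M) (h.coeff_pairing_right M)
  rw [prod_vF_descent] at h1
  have h2 := vertexCoeff_commutator g (coeffs g M) σ (zeta g M (0 + Pi.single j ξ)) (zeta g M 0)
    ((descentSupport (column M j) (τ ^ 2)).filter fun a => descent (column M j) (τ ^ 2) a = 1)
    (fun a => zeta g M (0 + Pi.single j ξ) * poleResidue M j τ a)
    (fun a => (((vF (τ * a))⁻¹ : Fˣ) : F)) (fun a _ => Units.ne_zero _) (fun μ => ?_) k (-1) f
  · rw [h2]
    refine Finset.sum_congr (by congr) fun a _ => ?_
    rw [zpow_neg_one, Units.val_inv_eq_inv_val, inv_inv]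
    rfl
  · have h3 : zeta g M 0 = zeta g M (0 + Pi.single j ξ) *
        (((vF τ ^ (-2 : ℤ) : Fˣ) ^ ((column M j).sum fun _ e => e) : Fˣ)⁻¹ : Fˣ) := by
      rw [hξ.zeta_eq, mul_assoc, ← Units.val_mul, mul_inv_cancel, Units.val_one, mul_one]
    have h4 := congrArg (fun y => zeta g M (0 + Pi.single j ξ) * y) (h1 μ)
    simp only [mul_sub, Finset.mul_sum] at h4
    rw [h3, mul_assoc]
    refine h4.trans (Finset.sum_congr (by congr) fun a _ => ?_)
    rw [poleResidue, mul_assoc]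

end DeformedW

end

noncomputable section

namespace DeformedW

/-! ### Residues along strips -/

variable {I : Type*} [Fintype I] [DecidableEq I] {g : CartanData I} {j : I} {τ p s : Spec}

/-- The product of the values of `φ` over the factors of colour `j` of a monomial. -/
def colourProd (j : I) (φ : Spec → Fˣ) (M : Mono I) : Fˣ :=
  M.prod fun u e => if u.1 = j then φ u.2 ^ e else 1

theorem stepFactor_eq_colourProd (j : I) (a : Spec) (M : Mono I) :
    stepFactor g (j, a) M = colourProd j (fun b => blockRatio (g.r j) (a / b)) M := rfl

theorem colourProd_add (j : I) (φ : Spec → Fˣ) (M N : Mono I) :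
    colourProd j φ (M + N) = colourProd j φ M * colourProd j φ N := by
  refine Finsupp.prod_add_index' (fun p => ?_) fun p e e' => ?_
  · simp
  · split_ifs
    · exact zpow_add _ _ _
    · rw [one_mul]

theorem colourProd_sub (j : I) (φ : Spec → Fˣ) (M N : Mono I) :
    colourProd j φ (M - N) = colourProd j φ M / colourProd j φ N := by
  rw [eq_div_iff_mul_eq', ← colourProd_add, sub_add_cancel]

theorem colourProd_sum {ι : Type*} (φ : Spec → Fˣ) (t : Finset ι) (f : ι → Mono I) :
    colourProd j φ (∑ x ∈ t, f x) = ∏ x ∈ t, colourProd j φ (f x) := by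
  classical
  induction t using Finset.induction_on with
  | empty => exact Finsupp.prod_zero_index
  | insert x t hx ih => rw [Finset.sum_insert hx, Finset.prod_insert hx, colourProd_add, ih]

theorem colourProd_single (φ : Spec → Fˣ) (i : I) (b : Spec) :
    colourProd j φ (Finsupp.single (i, b) 1) = if i = j then φ b else 1 := by
  rw [colourProd, Finsupp.prod_single_index (by simp), zpow_one]

theorem colourProd_root (φ : Spec → Fˣ) (a : Spec) :
    colourProd j φ (root g j a) = φ a * φ (a * qt (-2 * g.r j) 2) := by
  have h1 : a * qt (-(g.r j)) 1 * qt (g.r j) (-1) = a := by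
    rw [mul_assoc, qt_mul, neg_add_cancel, show (1 : ℤ) + -1 = 0 by norm_num, qt_zero, mul_one]
  have h2 : a * qt (-(g.r j)) 1 * qt (-(g.r j)) 1 = a * qt (-2 * g.r j) 2 := by
    rw [mul_assoc, qt_mul]
    congr 2
    ring
  rw [root, rootMono, colourProd_sub, colourProd_add, colourProd_single, colourProd_single,
    if_pos rfl, if_pos rfl, h1, h2, colourProd_sum, Finset.prod_eq_one, div_one]
  intro i hi
  rw [colourProd_sum, Finset.prod_eq_one]
  intro s _
  rw [colourProd_single, if_neg (Finset.ne_of_mem_erase hi)]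

theorem colourProd_mul (φ ψ : Spec → Fˣ) (M : Mono I) :
    colourProd j (fun b => φ b * ψ b) M = colourProd j φ M * colourProd j ψ M := by
  rw [colourProd, colourProd, colourProd, Finsupp.prod, Finsupp.prod, Finsupp.prod,
    ← Finset.prod_mul_distrib]
  refine Finset.prod_congr rfl fun u _ => ?_
  split_ifs
  · exact mul_zpow _ _ _
  · rw [one_mul]

open scoped Classical in
theorem colourProd_ite (ε : Fˣ) (a : Spec) (M : Mono I) :
    colourProd j (fun b => if b = a then ε else 1) M = ε ^ M (j, a) := by
  rw [colourProd, Finsupp.prod, Finset.prod_eq_single (j, a)]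
  · rw [if_pos rfl, if_pos rfl]
  · rintro ⟨i, b⟩ _ hne
    by_cases hi : i = j
    · rw [if_pos hi, if_neg fun hb => hne (Prod.ext hi hb), one_zpow]
    · rw [if_neg hi]
  · intro h
    rw [Finsupp.notMem_support_iff.1 h, zpow_zero, if_pos rfl]

theorem colourProd_eq_column (φ : Spec → Fˣ) (M : Mono I) :
    colourProd j φ M = (column M j).prod fun b e => φ b ^ e := by
  rw [colourProd, Finsupp.prod, Finsupp.prod, ← Finset.prod_filter]
  symm
  refine Finset.prod_bij (fun a _ => (j, a)) ?_ ?_ ?_ ?_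
  · intro a ha
    rw [Finsupp.mem_support_iff, column_apply] at ha
    exact Finset.mem_filter.2 ⟨Finsupp.mem_support_iff.2 ha, rfl⟩
  · intro a _ b _ h
    exact (Prod.mk.inj h).2
  · rintro ⟨i, a⟩ h
    obtain ⟨h1, rfl⟩ := Finset.mem_filter.1 h
    exact ⟨a, Finsupp.mem_support_iff.2 (by rwa [column_apply, ← Finsupp.mem_support_iff]), rfl⟩
  · intro a _
    rfl

/-- The residue of the contraction, up to a sign, as a homomorphism in the monomial. -/
def formalResidue (j : I) (s : Spec) (M : Mono I) (a : Spec) : Fˣ :=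
  colourProd j (fun b => regTwo (s * (a / b)) / regOne (a / b)) M

open scoped Classical in
theorem regOne_eq (x : Spec) : regOne x = regTwo x * if x = 1 then -1 else 1 := by
  split_ifs with h
  · rw [h, regOne_one, regTwo_one, neg_one_mul, neg_neg]
  · rw [mul_one]
    ext
    rw [coe_regOne h, coe_regTwo h]

theorem poleResidue_eq (M : Mono I) (j : I) (τ a : Spec) :
    poleResidue M j τ a = (formalResidue j (τ ^ 2) M a * (-1) ^ M (j, a * τ ^ 2) : Fˣ) := by
  classical
  have h1 : poleResidue M j τ a = ((∏ b ∈ descentSupport (column M j) (τ ^ 2),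
      (regOne (a / b))⁻¹ ^ descent (column M j) (τ ^ 2) b : Fˣ) : F) := by
    have h2 : ∀ b, b ≠ a → (1 - (((vF (τ * b))⁻¹ : Fˣ) : F) * (((vF (τ * a))⁻¹ : Fˣ) : F)⁻¹) ^
        (-descent (column M j) (τ ^ 2) b) =
          (((regOne (a / b))⁻¹ ^ descent (column M j) (τ ^ 2) b : Fˣ) : F) := by
      intro b hb
      rw [← Units.val_inv_eq_inv_val, inv_inv, ← Units.val_mul, ← map_inv, ← map_mul,
        show (τ * b)⁻¹ * (τ * a) = a / b by rw [mul_inv_rev, mul_assoc, inv_mul_cancel_left,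
          mul_comm, div_eq_mul_inv], ← coe_regOne (by rwa [Ne, div_eq_one, eq_comm]),
        ← Units.val_zpow_eq_zpow_val, inv_zpow, zpow_neg]
    have h3 : ((regOne (a / a))⁻¹ ^ descent (column M j) (τ ^ 2) a : Fˣ) = 1 := by
      rw [div_self', regOne_one, inv_one, one_zpow]
    rw [← Finset.prod_erase (f := fun b => (regOne (a / b))⁻¹ ^ descent (column M j) (τ ^ 2) b) _ h3,
      Units.coe_prod, poleResidue, residue]
    refine Finset.prod_congr (by congr) fun b hb => ?_
    exact h2 b (Finset.ne_of_mem_erase hb)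
  rw [h1, prod_zpow_descent _ _ fun b => (regOne (a / b))⁻¹, Units.val_inj,
    ← colourProd_eq_column fun b => (regOne (a / b))⁻¹ / (regOne (a / (b * (τ ^ 2)⁻¹)))⁻¹,
    ← colourProd_ite (-1) (a * τ ^ 2) M, formalResidue, ← colourProd_mul]
  congr 1
  ext1 b
  have h4 : a / (b * (τ ^ 2)⁻¹) = τ ^ 2 * (a / b) := by
    rw [div_mul_eq_div_div, div_inv_eq_mul, mul_comm]
  have h5 : τ ^ 2 * (a / b) = 1 ↔ b = a * τ ^ 2 := by
    rw [← mul_div_assoc, div_eq_one, mul_comm, eq_comm]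
  rw [h4, regOne_eq (τ ^ 2 * (a / b)), if_congr h5 rfl rfl, inv_div_inv, mul_div_right_comm]

open scoped Classical in
theorem Directions.exists_blockRatio (d : Directions g j p s) :
    ∃ ε : Fˣ, ∀ x : Spec, blockRatio (g.r j) x * (regTwo (s * (p * x)) / regOne (p * x)) =
      (regTwo (s * x) / regOne x) * ((if s * x = 1 then ε else 1) * if p * x = 1 then ε else 1) := by
  have hm : ∀ x : Spec, s * (p * x) = qt (-2 * g.r j) 2 * x := fun x => by
    rw [← mul_assoc, mul_comm s, d.mul_eq]
  rcases d with ⟨rfl, rfl⟩ | ⟨rfl, rfl⟩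
  · refine ⟨1, fun x => ?_⟩
    rw [hm, blockRatio, ite_self, ite_self, mul_one, mul_one, div_mul_div_comm, div_eq_div_iff_mul_eq_mul]
    ac_rfl
  · refine ⟨-1, fun x => ?_⟩
    have h1 := regOne_eq (qt (-2 * g.r j) 0 * x)
    have h2 := regOne_eq (qt 0 2 * x)
    have h3 : (if qt 0 2 * x = 1 then (-1 : Fˣ) else 1) * (if qt 0 2 * x = 1 then -1 else 1) = 1 := by
      split_ifs <;> simp
    rw [hm, blockRatio, h1, h2, div_mul_div_comm, div_mul_eq_mul_div, div_eq_div_iff_mul_eq_mul]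
    have key : ∀ A B C D u v : Fˣ, v * v = 1 → A * u * B * C * D = A * (u * v) * (D * C * (B * v)) := by
      intro A B C D u v h
      calc A * u * B * C * D = A * u * B * C * D * (v * v) := by rw [h, mul_one]
        _ = _ := by ac_rfl
    rw [key _ _ _ _ _ _ h3]

theorem Directions.step_residue (d : Directions g j p s) (hr : 0 < g.r j) :
    ∃ ε : Fˣ, ∀ (M : Mono I) (a : Spec), (blockRatio (g.r j) 1)⁻¹ * stepFactor g (j, a) M *
      formalResidue j s (M - root g j a) (a * p) =
        (vF s)⁻¹ * formalResidue j s M a * (ε ^ M (j, a * s) * ε ^ M (j, a * p)) := by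
  classical
  obtain ⟨ε, hε⟩ := d.exists_blockRatio
  refine ⟨ε, fun M a => ?_⟩
  have hinj := fun {i c i' c' : ℤ} => d.inj hr (a := 1) (i := i) (c := c) (i' := i') (c' := c')
  have hs : s ≠ 1 := by
    have := hinj (i := 0) (c := 1) (i' := 0) (c' := 0)
    simpa using this
  have hp : p ≠ 1 := by
    have := hinj (i := 1) (c := 0) (i' := 0) (c' := 0)
    simpa using this
  have h1 : stepFactor g (j, a) M * formalResidue j s M (a * p) =
      formalResidue j s M a * (ε ^ M (j, a * s) * ε ^ M (j, a * p)) := by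
    rw [stepFactor_eq_colourProd, formalResidue, formalResidue, ← colourProd_ite, ← colourProd_ite,
      ← colourProd_mul, ← colourProd_mul, ← colourProd_mul]
    congr 1
    ext1 b
    have e : ∀ y : Spec, y * (a / b) = 1 ↔ b = a * y := fun y => by
      rw [← mul_div_assoc, div_eq_one, mul_comm, eq_comm]
    have := hε (a / b)
    rw [if_congr (e s) rfl rfl, if_congr (e p) rfl rfl] at this
    rw [show a * p / b = p * (a / b) by rw [mul_comm, mul_div_assoc], this]
  have h2 : blockRatio (g.r j) 1 * formalResidue j s (root g j a) (a * p) = vF s := by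
    have h3 := hε 1
    rw [mul_one, mul_one, if_neg hs, if_neg hp, mul_one, regOne_one, div_one, mul_one] at h3
    have h4 : a * p / (a * qt (-2 * g.r j) 2) = s⁻¹ := by
      rw [← d.mul_eq, mul_div_mul_left_eq_div, div_mul_cancel_left]
    rw [formalResidue, colourProd_root, h4, mul_div_cancel_left, ← mul_assoc, h3, mul_inv_cancel,
      regTwo_one, regOne_inv, neg_div_neg_eq, one_div, mul_inv, inv_inv, mul_comm (vF s),
      mul_inv_cancel_left]
  rw [show formalResidue j s (M - root g j a) (a * p) =
    formalResidue j s M (a * p) / formalResidue j s (root g j a) (a * p) from colourProd_sub _ _ _ _,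
    ← h2, mul_inv, mul_assoc _ (formalResidue j s M a), ← h1, div_eq_mul_inv]
  have key : ∀ A B C R : Fˣ, A * B * (C * R) = A * R * (B * C) := fun A B C R => by ac_rfl
  exact key _ _ _ _

theorem pathCoeff_strip_mul_formalResidue (hg : g.IsFinite) (d : Directions g j p s) :
    ∃ ε : Fˣ, ∀ (n : ℕ) (M : Mono I) (a : Spec),
      (∀ i : ℤ, 1 ≤ i → i < n + 1 → dcell j p s a M i 0 = 1) → dcell j p s a M (n + 1) 0 = 0 →
      (∀ i : ℤ, 1 ≤ i → i < n + 1 → dcell j p s a M i 1 = 0) →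
      pathCoeff g M (strip j p a (n + 1)) *
        formalResidue j s (M - rootSum g (strip j p a (n + 1))) (a * p ^ (n + 1)) =
          (vF s ^ (n + 1))⁻¹ * formalResidue j s M a * ε ^ dcell j p s a M 0 1 := by
  have hr := hg.r_pos j
  obtain ⟨ε, hε⟩ := d.step_residue hr
  refine ⟨ε, fun n => ?_⟩
  have hcell : ∀ (M : Mono I) (a : Spec), M (j, a * s) = dcell j p s a M 0 1 ∧
      M (j, a * p) = dcell j p s a M 1 0 := by
    intro M a
    rw [dcell, dcell, zpow_zero, zpow_zero, zpow_one, zpow_one, one_mul, mul_one]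
    exact ⟨rfl, rfl⟩
  have hstep : ∀ (M : Mono I) (a : Spec), pathCoeff g M [(j, a)] =
      (blockRatio (g.r j) 1)⁻¹ * stepFactor g (j, a) M := by
    intro M a
    rw [pathCoeff, pathCoeff, one_mul, rootSum_nil, sub_zero]
  induction n with
  | zero =>
    intro M a _ h2 _
    have := hε M a
    rw [(hcell M a).1, (hcell M a).2, show dcell j p s a M 1 0 = 0 by simpa using h2, zpow_zero,
      mul_one] at this
    rw [zero_add, pow_one, pow_one, strip, strip, hstep, rootSum_cons, rootSum_nil, add_zero]
    exact this
  | succ n ih =>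
    intro M a h1 h2 h3
    have e : ∀ i c, dcell j p s (a * p) (M - root g j a) i c = dcell j p s a M (i + 1) c -
        ((if i + 1 = 0 ∧ c = 0 then 1 else 0) + (if i + 1 = 1 ∧ c = 1 then 1 else 0)) := by
      intro i c
      rw [dcell_shift, dcell_sub, dcell_root d hr]
    have ih' := ih (M - root g j a) (a * p) ?_ ?_ ?_
    · have hM := hε M a
      rw [(hcell M a).1, (hcell M a).2, h1 1 le_rfl (by push_cast; omega), zpow_one] at hM
      rw [e, h3 (0 + 1) (by omega) (by push_cast; omega)] at ih'
      have hperm : pathCoeff g M (strip j p a (n + 1 + 1)) =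
          pathCoeff g (M - root g j a) (strip j p (a * p) (n + 1)) * pathCoeff g M [(j, a)] := by
        have h4 : (strip j p a (n + 1 + 1)).Perm (strip j p (a * p) (n + 1) ++ [(j, a)]) := by
          rw [strip]
          exact (List.perm_append_singleton _ _).symm
        rw [pathCoeff_perm hg M h4, pathCoeff_append, rootSum_cons, rootSum_nil, add_zero]
      have hsum : M - rootSum g (strip j p a (n + 1 + 1)) =
          M - root g j a - rootSum g (strip j p (a * p) (n + 1)) := by
        rw [strip, rootSum_cons, sub_sub]
      rw [hperm, hsum, hstep, mul_right_comm, show a * p ^ (n + 1 + 1) = a * p * p ^ (n + 1) by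
        rw [pow_succ' p (n + 1), mul_assoc], ih']
      have h5 : ε ^ ((0 : ℤ) - ((if (0 : ℤ) + 1 = 0 ∧ (1 : ℤ) = 0 then 1 else 0) +
          (if (0 : ℤ) + 1 = 1 ∧ (1 : ℤ) = 1 then 1 else 0))) = ε⁻¹ := by
        simp
      rw [h5]
      have key : ∀ A B C D R y u : Fˣ, B * C = R⁻¹ * D * (y * u) →
          A⁻¹ * C * u⁻¹ * B = (A * R)⁻¹ * D * y := by
        intro A B C D R y u h
        calc A⁻¹ * C * u⁻¹ * B = A⁻¹ * (B * C) * u⁻¹ := by ac_rfl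
          _ = A⁻¹ * (R⁻¹ * D) * y * (u * u⁻¹) := by rw [h]; simp only [mul_assoc]
          _ = (A * R)⁻¹ * D * y := by rw [mul_inv_cancel, mul_one, mul_inv, mul_assoc A⁻¹ R⁻¹]
      rw [pow_succ _ (n + 1)]
      exact key _ _ _ _ _ _ _ hM
    · intro i hi hi'
      rw [e, if_neg (by omega), if_neg (by omega), add_zero, sub_zero]
      exact h1 _ (by omega) (by push_cast; omega)
    · rw [e, if_neg (by omega), if_neg (by omega), add_zero, sub_zero]
      exact_mod_cast h2
    · intro i hi hi'
      rw [e, if_neg (by omega), if_neg (by omega), add_zero, sub_zero]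
      exact h3 _ (by omega) (by push_cast; omega)

/-- Expanding a strip moves the pole at its beginning to its end, with the opposite residue. -/
theorem Expandable.poleResidue_eq (hg : g.IsFinite) (d : Directions g j p (τ ^ 2)) {M : Mono I}
    {a : Spec} {n : ℕ} (hn : 0 < n) (h : Expandable j p (τ ^ 2) M a n) :
    pathCoeff g M (strip j p a n) *
        poleResidue (M - rootSum g (strip j p a n)) j τ (a * p ^ n) =
      -(((vF (τ ^ 2) ^ n)⁻¹ : Fˣ) * poleResidue M j τ a) := by
  obtain ⟨n, rfl⟩ := Nat.exists_eq_add_of_le' hn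
  obtain ⟨ε, hε⟩ := pathCoeff_strip_mul_formalResidue hg d
  have h' := (expanded_iff d (hg.r_pos j)).2 h
  have h1 := hε n M a (fun i hi hi' => h.1 i (by omega) (by push_cast; omega))
    (by exact_mod_cast h.2.1) (fun i hi hi' => h.2.2 i (by omega) (by push_cast; omega))
  have e1 : M (j, a * τ ^ 2) = 0 := by
    have := h.2.2 0 le_rfl (by omega)
    rwa [dcell, zpow_zero, zpow_one, one_mul] at this
  have e2 : (M - rootSum g (strip j p a (n + 1))) (j, a * p ^ (n + 1) * τ ^ 2) = -1 := by
    have := h'.2.2 (n + 1 : ℕ) (by push_cast; omega) le_rfl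
    rwa [dcell, zpow_natCast, zpow_one, ← mul_assoc] at this
  rw [h.2.2 0 le_rfl (by omega), zpow_zero, mul_one] at h1
  rw [DeformedW.poleResidue_eq, DeformedW.poleResidue_eq, e1, e2, zpow_zero, mul_one, ← Units.val_mul,
    ← Units.val_mul, ← Units.val_neg, Units.val_inj, ← mul_assoc, h1, zpow_neg_one]
  simp

end DeformedW

end

noncomputable section

namespace DeformedW

/-! ### Vertex operators along strips -/

variable {I : Type*} [Fintype I] [DecidableEq I] {g : CartanData I} {j : I} {τ p : Spec}
  {σ : ℤ → I → F} {ξ : Polynomial ℂ}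

theorem vertexCoeff_congr {c c' : ℤ → I → F} (h : ∀ n ≠ 0, c n = c' n) (k : ℤ) :
    vertexCoeff g c k = vertexCoeff g c' k := by
  have h1 : ∀ n : ℤ, mode g (c n) n = mode g (c' n) n := fun n => by
    rcases eq_or_ne n 0 with rfl | hn
    · rw [mode_zero, mode_zero]
    · rw [h n hn]
  have h2 : creation g c = creation g c' := by
    funext l
    simp only [creation, h1]
  have h3 : annihilation g c = annihilation g c' := by
    funext l
    simp only [annihilation, h1]
  refine LinearMap.ext fun f => ?_
  simp only [vertexCoeff, h2, h3]

theorem Screening.coeffs_sub_root (hg : g.IsFinite) (h : Screening g j τ p σ) (M : Mono I)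
    (b : Spec) {n : ℤ} (hn : n ≠ 0) :
    (coeffs g (M - root g j b) + dilate (((vF (τ * (b * p)))⁻¹ : Fˣ) : F) σ) n =
      (coeffs g M + dilate (((vF (τ * b))⁻¹ : Fˣ) : F) σ) n := by
  have e : coeffs g (root g j b) n =
      dilate (((vF (τ * (b * p)))⁻¹ : Fˣ) : F) σ n - dilate (((vF (τ * b))⁻¹ : Fˣ) : F) σ n := by
    rw [coeffs_root hg j b hn, map_mul, mul_zpow, Units.val_mul, mul_smul, h.aVec_eq n hn, smul_smul,
      mul_sub, ← Units.val_mul, ← Units.val_mul, ← mul_zpow, ← mul_zpow, ← map_mul, ← map_mul,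
      sub_smul, dilate, dilate, ← Units.val_zpow_eq_zpow_val, ← Units.val_zpow_eq_zpow_val,
      inv_zpow', inv_zpow', show b * (τ * p) = τ * (b * p) by ac_rfl, mul_comm b τ]
  rw [coeffs_sub, Pi.add_apply, Pi.add_apply, Pi.sub_apply, e]
  abel

theorem Screening.vertexCoeff_strip (hg : g.IsFinite) (h : Screening g j τ p σ) (k : ℤ) (n : ℕ) :
    ∀ (M : Mono I) (a : Spec),
      vertexCoeff g (coeffs g (M - rootSum g (strip j p a n)) +
        dilate (((vF (τ * (a * p ^ n)))⁻¹ : Fˣ) : F) σ) k =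
      vertexCoeff g (coeffs g M + dilate (((vF (τ * a))⁻¹ : Fˣ) : F) σ) k := by
  induction n with
  | zero =>
    intro M a
    rw [strip, rootSum_nil, sub_zero, pow_zero, mul_one]
  | succ n ih =>
    intro M a
    rw [← vertexCoeff_congr (c := coeffs g (M - root g j a) + _)
      (fun n hn => h.coeffs_sub_root hg M a hn) k, ← ih (M - root g j a) (a * p), strip, rootSum_cons,
      sub_sub, pow_succ', mul_assoc a p]

theorem prod_zpow_eq {ι G : Type*} [CommGroup G] (c : ι →₀ ℤ) (y : G) :
    (c.prod fun _ e => y ^ e) = y ^ (c.sum fun _ e => e) := by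
  classical
  rw [Finsupp.prod, Finsupp.sum]
  induction c.support using Finset.induction_on with
  | empty => simp
  | insert b t hb ih => rw [Finset.prod_insert hb, Finset.sum_insert hb, ih, zpow_add]

theorem Screening.zeta_root_shift (hg : g.IsFinite) (h : Screening g j τ p σ)
    (hξ : ShiftBy g j τ ξ) (a : Spec) :
    zeta g (root g j a) (0 + Pi.single j ξ) = vF (p * (τ ^ 2)⁻¹) := by
  have h1 := colourProd_root (g := g) (fun _ => vF τ ^ (-2 : ℤ)) (j := j) a
  rw [colourProd_eq_column, prod_zpow_eq] at h1
  rw [hξ.zeta_eq, zeta_root hg, ← Units.val_mul, h1, ← h.directions.mul_eq, map_mul, map_mul, map_inv,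
    map_pow, ← zpow_add, ← zpow_natCast, ← zpow_neg, mul_assoc, ← zpow_add]
  norm_num

theorem Screening.zeta_strip (hg : g.IsFinite) (h : Screening g j τ p σ)
    (hξ : ShiftBy g j τ ξ) (n : ℕ) : ∀ (M : Mono I) (a : Spec),
    zeta g (M - rootSum g (strip j p a n)) (0 + Pi.single j ξ) * (vF (p * (τ ^ 2)⁻¹) : F) ^ n =
      zeta g M (0 + Pi.single j ξ) := by
  induction n with
  | zero =>
    intro M a
    rw [strip, rootSum_nil, sub_zero, pow_zero, mul_one]
  | succ n ih =>
    intro M a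
    rw [← zeta_sub_mul M (root g j a), ← ih (M - root g j a) (a * p), h.zeta_root_shift hg hξ,
      strip, rootSum_cons, sub_sub, pow_succ, mul_assoc]

theorem mul_residue_eq_neg {k : Type*} [Field k] {Z Z' P P' R R' t p s : k} {n : ℕ}
    (h1 : Z' * (p * s⁻¹) ^ n = Z) (h2 : P' * R' = -((s ^ n)⁻¹ * R)) :
    P' * P * (Z' * R' * (t * p ^ n)) = -(P * (Z * R * t)) := by
  rw [← h1, mul_pow, inv_pow]
  linear_combination (P * Z' * t * p ^ n) * h2

variable (g) in
/-- The contribution of the pole at `a` to the commutator of a monomial, with the coefficient of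
the path `l`, and a screening operator. -/
def poleTerm (j : I) (τ : Spec) (σ : ℤ → I → F) (ξ : Polynomial ℂ) (k : ℤ) (f : FockPoly I) (x : F)
    (M : Mono I) (a : Spec) : FockPoly I :=
  (x * (zeta g M (0 + Pi.single j ξ) * poleResidue M j τ a * vF (τ * a))) •
    vertexCoeff g (coeffs g M + dilate (((vF (τ * a))⁻¹ : Fˣ) : F) σ) k f

theorem Screening.poleTerm_strip (hg : g.IsFinite) (h : Screening g j τ p σ)
    (hξ : ShiftBy g j τ ξ) {M : Mono I} {a : Spec} {n : ℕ} (hn : 0 < n)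
    (hM : Expandable j p (τ ^ 2) M a n) (k : ℤ) (f : FockPoly I) (x : F) :
    poleTerm g j τ σ ξ k f (pathCoeff g M (strip j p a n) * x) (M - rootSum g (strip j p a n))
      (a * p ^ n) = -poleTerm g j τ σ ξ k f x M a := by
  have h1 := h.zeta_strip hg hξ n M a
  have h2 := hM.poleResidue_eq hg h.directions hn
  rw [poleTerm, poleTerm, h.vertexCoeff_strip hg, ← neg_smul]
  congr 1
  rw [← mul_assoc τ a, map_mul vF (τ * a), map_pow, Units.val_mul, Units.val_pow_eq_pow_val]
  rw [map_mul, map_inv, Units.val_mul, Units.val_inv_eq_inv_val] at h1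
  rw [Units.val_inv_eq_inv_val, Units.val_pow_eq_pow_val] at h2
  exact mul_residue_eq_neg h1 h2

theorem shiftBy_plus (hg : g.IsFinite) (j : I) :
    ShiftBy g j (qt 0 1) (Polynomial.C (-(g.r j : ℂ)⁻¹) * Polynomial.X) := by
  have hr : (g.r j : ℂ) ≠ 0 := Nat.cast_ne_zero.2 (hg.r_pos j).ne'
  have e : 2 * (Polynomial.C (-(g.r j : ℂ)⁻¹) * Polynomial.X * (g.r j : Polynomial ℂ)) =
      Polynomial.C ((0 : ℤ) : ℂ) + Polynomial.C ((-2 : ℤ) : ℂ) * Polynomial.X := by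
    have h2 : Polynomial.C (g.r j : ℂ)⁻¹ * (g.r j : Polynomial ℂ) = 1 := by
      rw [← map_natCast (Polynomial.C : ℂ →+* Polynomial ℂ), ← Polynomial.C_mul,
        inv_mul_cancel₀ hr, Polynomial.C_1]
    rw [Polynomial.C_neg]
    push_cast
    rw [Polynomial.C_0, Polynomial.C_neg, Polynomial.C_ofNat]
    linear_combination (-2 * Polynomial.X) * h2
  rw [ShiftBy, ← map_zpow, qt_zpow, e]
  refine Units.ext ((congrArg (algebraMap K F) (qpow_coe_val 0 (-2))).trans ?_)
  rw [coe_vF]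
  norm_num

theorem shiftBy_minus (j : I) : ShiftBy g j (qt (-g.r j) 0) 1 := by
  have e : 2 * (1 * (g.r j : Polynomial ℂ)) =
      Polynomial.C ((2 * g.r j : ℤ) : ℂ) + Polynomial.C ((0 : ℤ) : ℂ) * Polynomial.X := by
    push_cast
    rw [Polynomial.C_0, Polynomial.C_mul, Polynomial.C_ofNat, zero_mul, add_zero, one_mul,
      map_natCast]
  rw [ShiftBy, ← map_zpow, qt_zpow, e]
  refine Units.ext ((congrArg (algebraMap K F) (qpow_coe_val (2 * g.r j) 0)).trans ?_)
  rw [coe_vF]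
  norm_num

end DeformedW

end

noncomputable section

namespace DeformedW

/-! ### Commutators with the screening operators -/

variable {I : Type*} [Fintype I] [DecidableEq I] {g : CartanData I} {j : I} {τ p : Spec}
  {σ : ℤ → I → F} {ξ : Polynomial ℂ} {m : Mono I}

theorem sum_add_sum_eq_zero_of_rel {ι κ V : Type*} [AddCommGroup V] {A : Finset ι} {B : Finset κ}
    (R : ι → κ → Prop) (f : ι → V) (f' : κ → V) (h1 : ∀ x ∈ A, ∃ y ∈ B, R x y)
    (h2 : ∀ y ∈ B, ∃ x ∈ A, R x y) (h3 : ∀ x x' y, R x y → R x' y → x = x')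
    (h4 : ∀ x y y', R x y → R x y' → y = y') (h5 : ∀ x ∈ A, ∀ y, R x y → f' y = -f x) :
    ∑ x ∈ A, f x + ∑ y ∈ B, f' y = 0 := by
  choose φ hφ hφ' using h1
  have e : ∑ x ∈ A, f x = ∑ y ∈ B, -f' y := by
    refine Finset.sum_bij φ hφ (fun x hx x' hx' h => ?_) (fun y hy => ?_)
      fun x hx => ?_
    · exact h3 _ _ _ (hφ' x hx) (h ▸ hφ' x' hx')
    · obtain ⟨x, hx, hxy⟩ := h2 y hy
      exact ⟨x, hx, h4 _ _ _ (hφ' x hx) hxy⟩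
    · rw [h5 x hx _ (hφ' x hx), neg_neg]
  rw [e, Finset.sum_neg_distrib, neg_add_cancel]

/-- A row starting at `x.2` in `x.1` is expanded to one in `y.1`, ending at `y.2`. -/
def ExpandsTo (g : CartanData I) (j : I) (p s : Spec) (x y : Mono I × Spec) : Prop :=
  ∃ n : ℕ, 0 < n ∧ Expandable j p s x.1 x.2 n ∧ y = (x.1 - rootSum g (strip j p x.2 n), x.2 * p ^ n)

theorem ExpandsTo.right_unique {s : Spec} {x y y' : Mono I × Spec} (h : ExpandsTo g j p s x y)
    (h' : ExpandsTo g j p s x y') : y = y' := by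
  obtain ⟨n, -, hn, rfl⟩ := h
  obtain ⟨n', -, hn', rfl⟩ := h'
  rw [hn.unique hn']

theorem ExpandsTo.left_unique (d : Directions g j p s) (hr : 0 < g.r j) {x x' y : Mono I × Spec}
    (h : ExpandsTo g j p s x y) (h' : ExpandsTo g j p s x' y) : x = x' := by
  obtain ⟨M, a⟩ := x
  obtain ⟨M', a'⟩ := x'
  obtain ⟨n, -, hn, rfl⟩ := h
  obtain ⟨n', -, hn', hy⟩ := h'
  obtain ⟨h1, h2⟩ := Prod.mk.inj hy
  simp only at hn hn' h1 h2
  have e1 := (expanded_iff d hr).2 hn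
  have e2 := (expanded_iff d hr).2 hn'
  have e3 : a = a * p ^ n * p ^ (-(n : ℤ)) := by
    rw [zpow_neg, zpow_natCast, mul_inv_cancel_right]
  have e4 : a' = a * p ^ n * p ^ (-(n' : ℤ)) := by
    rw [h2, zpow_neg, zpow_natCast, mul_inv_cancel_right]
  rw [← h1] at e2
  obtain rfl := Expanded.unique (a := a * p ^ n) (by rwa [← e3]) (by rwa [← e4])
  obtain rfl : a = a' := e3.trans e4.symm
  rw [sub_left_inj] at h1
  rw [h1]

theorem Reversible.eq_zero (hm : NeverFails g m) {N : ℕ} {M : Mono I} (hM : Reach g m N M)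
    {a : Spec} (h : Reversible g M j a) : M (j, a) = 0 := by
  have := Reversible.cell_eq_zero (c := a) (k := 0) (l := 0) hm hM (by rwa [qt_zero, mul_one])
  rwa [cell, qt_zero, mul_one] at this

theorem descent_eq_one_iff (d : Directions g j p s) {M : Mono I} (hM : Regular g M)
    (hM' : Generic M) (a : Spec) : descent (column M j) s a ≤ 1 ∧ (descent (column M j) s a = 1 ↔
      M (j, a) = 1 ∧ M (j, a * s) = 0 ∨ M (j, a) = 0 ∧ M (j, a * s) = -1) := by
  have h1 := (d.regular hM a 0 0).1
  simp only [dcell, zero_add, zpow_zero, zpow_one, mul_one, one_mul] at h1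
  have h2 := hM' j a
  have h3 := hM' j (a * s)
  rw [descent, column_apply, column_apply]
  omega

/-- The commutators of the monomials created by the algorithm with a screening operator cancel. -/
theorem Screening.sum_poleTerm (hg : g.IsFinite) (h : Screening g j τ p σ) (hξ : ShiftBy g j τ ξ)
    (hm : NeverFails g m) (hdom : Dominant m) {C : Finset (Mono I)}
    (hC : ∀ M, M ∈ C ↔ ∃ N, Reach g m N M) {coeff : Mono I → F}
    (hcoeff : ∀ l, IsPath g m l → coeff (m - rootSum g l) = pathCoeff g m l) (k : ℤ)
    (f : FockPoly I) :
    ∑ M ∈ C, ∑ a ∈ descentSupport (column M j) (τ ^ 2) with descent (column M j) (τ ^ 2) a = 1,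
      poleTerm g j τ σ ξ k f (coeff M) M a = 0 := by
  classical
  have d := h.directions
  have hr := hg.r_pos j
  set D : Finset (Mono I × Spec) := C.biUnion fun M =>
    ((descentSupport (column M j) (τ ^ 2)).filter fun a =>
      descent (column M j) (τ ^ 2) a = 1).image fun a => (M, a) with hD
  have memD : ∀ M a, (M, a) ∈ D ↔ (∃ N, Reach g m N M) ∧ descent (column M j) (τ ^ 2) a = 1 := by
    intro M a
    simp only [hD, Finset.mem_biUnion, Finset.mem_image, Finset.mem_filter, Prod.mk.injEq, hC]
    constructor
    · rintro ⟨M, hM, a, ha, rfl, rfl⟩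
      exact ⟨hM, ha.2⟩
    · rintro ⟨hM, ha⟩
      exact ⟨M, hM, a, ⟨mem_descentSupport (by rw [ha]; exact one_ne_zero), ha⟩, rfl, rfl⟩
  have sumD : ∑ M ∈ C, ∑ a ∈ descentSupport (column M j) (τ ^ 2) with
      descent (column M j) (τ ^ 2) a = 1, poleTerm g j τ σ ξ k f (coeff M) M a =
        ∑ x ∈ D, poleTerm g j τ σ ξ k f (coeff x.1) x.1 x.2 := by
    rw [hD, Finset.sum_biUnion]
    · refine Finset.sum_congr rfl fun M _ => ?_
      rw [Finset.sum_image fun a _ a' _ h => (Prod.mk.inj h).2]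
    · intro M _ M' _ hne
      refine Finset.disjoint_left.2 fun x hx hx' => hne ?_
      obtain ⟨a, -, rfl⟩ := Finset.mem_image.1 hx
      obtain ⟨a', -, h'⟩ := Finset.mem_image.1 hx'
      exact (Prod.mk.inj h').1.symm
  rw [sumD, ← Finset.sum_filter_add_sum_filter_not D fun x => x.1 (j, x.2) = 1]
  refine sum_add_sum_eq_zero_of_rel (ExpandsTo g j p (τ ^ 2)) _ _ ?_ ?_
    (fun _ _ _ => ExpandsTo.left_unique d hr) (fun _ _ _ => ExpandsTo.right_unique) ?_
  · rintro ⟨M, a⟩ hx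
    obtain ⟨hx, h1 : M (j, a) = 1⟩ := Finset.mem_filter.1 hx
    obtain ⟨⟨N, hN⟩, hx⟩ := (memD M a).1 hx
    obtain ⟨hM, hM'⟩ := hm N M hN
    have h2 := (descent_eq_one_iff d hM hM' a).2.1 hx
    obtain ⟨n, hn, hE⟩ := exists_expandable d hr (a := a) hM hM'
      (fun b hb => (hm _ _ (hN.step hb)).2) (by simpa [dcell] using h1)
      (by simp only [dcell, zpow_zero, zpow_one, one_mul]; omega)
    obtain ⟨l, hl, -, rfl⟩ := hN.exists_path
    have hl' := (hE.isPath d hr hl n a).reach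
    rw [rootSum_append, add_comm, ← sub_sub] at hl'
    have hE' := (expanded_iff d hr).2 hE
    obtain ⟨hM1, hM1'⟩ := hm _ _ hl'
    have e1 := hE'.1 n (by omega) le_rfl
    have e2 := hE'.2.2 n (by omega) le_rfl
    rw [dcell, zpow_natCast, zpow_zero, mul_one] at e1
    rw [dcell, zpow_natCast, zpow_one, ← mul_assoc] at e2
    refine ⟨_, Finset.mem_filter.2 ⟨(memD _ _).2 ⟨⟨_, hl'⟩, ?_⟩, ?_⟩, n, hn, hE, rfl⟩
    · exact (descent_eq_one_iff d hM1 hM1' _).2.2 (.inr ⟨e1, e2⟩)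
    · simp only [e1]
      norm_num
  · rintro ⟨M, a⟩ hx
    obtain ⟨hx, h1 : ¬M (j, a) = 1⟩ := Finset.mem_filter.1 hx
    obtain ⟨⟨N, hN⟩, hx⟩ := (memD M a).1 hx
    obtain ⟨hM, hM'⟩ := hm N M hN
    have h2 := (descent_eq_one_iff d hM hM' a).2.1 hx
    obtain ⟨n, hn, hE⟩ := exists_expanded d hr (a := a) hM hM'
      (fun b hb => hb.eq_zero hm hN) (by simp only [dcell, zpow_zero, mul_one]; omega)
      (by simp only [dcell, zpow_zero, zpow_one, one_mul]; omega)
    obtain ⟨N', hN'⟩ := hE.reach d hr (contracts hg hm hdom) n N M _ hN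
    set a' := a * p ^ (-(n : ℤ)) with ha'
    have e : a = a' * p ^ n := by
      rw [ha', zpow_neg, zpow_natCast, inv_mul_cancel_right]
    have hE' : Expandable j p (τ ^ 2) (M + rootSum g (strip j p a' n)) a' n := by
      rw [← expanded_iff d hr, add_sub_cancel_right]
      exact hE
    obtain ⟨hM1, hM1'⟩ := hm _ _ hN'
    have e1 := hE'.1 0 le_rfl (by omega)
    have e2 := hE'.2.2 0 le_rfl (by omega)
    rw [dcell, zpow_zero, zpow_zero, mul_one, mul_one] at e1
    rw [dcell, zpow_zero, zpow_one, one_mul] at e2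
    refine ⟨(M + rootSum g (strip j p a' n), a'), Finset.mem_filter.2
      ⟨(memD _ _).2 ⟨⟨_, hN'⟩, ?_⟩, e1⟩, n, hn, hE', ?_⟩
    · exact (descent_eq_one_iff d hM1 hM1' _).2.2 (.inl ⟨e1, e2⟩)
    · rw [add_sub_cancel_right, ← e]
  · rintro ⟨M, a⟩ hx _ ⟨n, hn, hE, rfl⟩
    obtain ⟨⟨N, hN⟩, -⟩ := (memD M a).1 (Finset.mem_filter.1 hx).1
    obtain ⟨l, hl, -, rfl⟩ := hN.exists_path
    simp only at hE ⊢
    rw [← h.poleTerm_strip hg hξ hn hE, hcoeff l hl, ← Units.val_mul, ← pathCoeff_append,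
      ← hcoeff _ (hE.isPath d hr hl n a), rootSum_append, add_comm, ← sub_sub]

/-! ### The fields of the monomials -/

variable (g) in
/-- The screening operator with the current `e^{ξ}:exp (∑ σ_n w^{-n}):`. -/
def screen (j : I) (σ : ℤ → I → F) (ξ : Polynomial ℂ) : Module.End F (Fock I) :=
  Finsupp.lsum F fun ν : Weight I =>
    Finsupp.lsingle (ν + Pi.single j ξ) ∘ₗ vertexCoeff g σ (-1)

theorem screen_single (ν : Weight I) (f : FockPoly I) : screen g j σ ξ (Finsupp.single ν f) =
    Finsupp.single (ν + Pi.single j ξ) (vertexCoeff g σ (-1) f) := by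
  rw [screen, Finsupp.lsum_single]
  rfl

theorem monoField_single (M : Mono I) (k : ℤ) (ν : Weight I) (f : FockPoly I) :
    monoField g M k (Finsupp.single ν f) =
      Finsupp.single ν (zeta g M ν • vertexCoeff g (coeffs g M) k f) := by
  rw [monoField, Finsupp.lsum_single]
  rfl

theorem Screening.monoField_commutator (h : Screening g j τ p σ) (hξ : ShiftBy g j τ ξ) {M : Mono I}
    (hM : ∀ a, descent (column M j) (τ ^ 2) a ≤ 1) (x : F) (k : ℤ) (f : FockPoly I) :
    x • monoField g M k (screen g j σ ξ (Finsupp.single 0 f)) -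
        x • screen g j σ ξ (monoField g M k (Finsupp.single 0 f)) =
      Finsupp.single (0 + Pi.single j ξ) (∑ a ∈ descentSupport (column M j) (τ ^ 2) with
        descent (column M j) (τ ^ 2) a = 1, poleTerm g j τ σ ξ (k - 1) f x M a) := by
  rw [screen_single, monoField_single, monoField_single, screen_single, map_smul,
    Finsupp.smul_single, Finsupp.smul_single, ← Finsupp.single_sub, ← smul_sub,
    h.commutator hξ M hM k f, Finset.smul_sum]
  simp only [smul_smul]
  rfl

theorem isField_add {Φ Ψ : Series I} (h : IsField Φ) (h' : IsField Ψ) : IsField (Φ + Ψ) := by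
  intro x
  obtain ⟨N, hN⟩ := h x
  obtain ⟨N', hN'⟩ := h' x
  refine ⟨min N N', fun n hn => ?_⟩
  rw [Pi.add_apply, LinearMap.add_apply, hN n (by omega), hN' n (by omega), add_zero]

theorem isField_smul (c : K) {Φ : Series I} (h : IsField Φ) : IsField (c • Φ) := by
  intro x
  obtain ⟨N, hN⟩ := h x
  exact ⟨N, fun n hn => by rw [Pi.smul_apply, LinearMap.smul_apply, hN n hn, smul_zero]⟩

theorem isField_zero : IsField (0 : Series I) := fun _ => ⟨0, fun _ _ => rfl⟩

theorem isField_monoField (M : Mono I) : IsField (monoField g M) := by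
  intro x
  induction x using Finsupp.induction_linear with
  | zero => exact ⟨0, fun _ _ => map_zero _⟩
  | add x y hx hy =>
    obtain ⟨N, hN⟩ := hx
    obtain ⟨N', hN'⟩ := hy
    exact ⟨min N N', fun n hn => by rw [map_add, hN n (by omega), hN' n (by omega), add_zero]⟩
  | single ν f =>
    obtain ⟨d, hd⟩ := exists_mem_lowWeight f
    refine ⟨-d - 1, fun n hn => ?_⟩
    rw [monoField_single, vertexCoeff_eq_sum g _ _ hd le_rfl, Finset.sum_eq_zero, smul_zero,
      Finsupp.single_zero]
    intro l hl
    rw [Finset.mem_range] at hl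
    rw [creationInt_of_neg g _ (by omega), LinearMap.zero_apply]

end DeformedW

end

noncomputable section

namespace DeformedW

/-! ### The output of the algorithm -/

variable {I : Type*} [Fintype I] [DecidableEq I] {g : CartanData I} {j : I} {τ p : Spec}
  {σ : ℤ → I → F} {ξ : Polynomial ℂ} {m : Mono I}

theorem finite_created (m : Mono I) (n : ℕ) : (created g m n).Finite := by
  induction n with
  | zero => exact Set.finite_singleton m
  | succ n ih =>
    refine ih.union ((ih.biUnion fun M _ => (M.support.finite_toSet.image
      fun u => expand g M u.1 u.2)).subset ?_)
    rintro _ ⟨M, hM, j, a, hadm, rfl⟩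
    exact Set.mem_biUnion hM ⟨(j, a), Finset.mem_coe.2 (Finsupp.mem_support_iff.2 hadm.1.ne'), rfl⟩

theorem created_of_le {n : ℕ} (h : created g m (n + 1) = created g m n) {k : ℕ} (hk : n ≤ k) :
    created g m k = created g m n := by
  induction k, hk using Nat.le_induction with
  | base => rfl
  | succ k hk ih => rw [created, ih]; exact h

theorem Works.exists_finset (h : Works g m) : ∃ C : Finset (Mono I),
    (⋃ n, created g m n) = C ∧ ∀ M, M ∈ C ↔ ∃ N, Reach g m N M := by
  obtain ⟨n, hn⟩ := h.2
  have e : (⋃ n, created g m n) = created g m n := by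
    refine Set.Subset.antisymm (Set.iUnion_subset fun k => ?_) (Set.subset_iUnion _ n)
    rcases le_total n k with hk | hk
    · rw [created_of_le hn hk]
    · intro M hM
      obtain ⟨l, hl, hM⟩ := mem_created_iff.1 hM
      exact mem_created_iff.2 ⟨l, hl.trans hk, hM⟩
  refine ⟨(finite_created m n).toFinset, by rw [e, Set.Finite.coe_toFinset], fun M => ?_⟩
  rw [Set.Finite.mem_toFinset, ← e, Set.mem_iUnion]
  constructor
  · rintro ⟨k, hk⟩
    obtain ⟨l, -, hM⟩ := mem_created_iff.1 hk
    exact ⟨l, hM⟩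
  · rintro ⟨k, hk⟩
    exact ⟨k, mem_created_iff.2 ⟨k, le_rfl, hk⟩⟩

theorem Works.neverFails (h : Works g m) : NeverFails g m := fun n M hM =>
  h.1 n M (mem_created_iff.2 ⟨n, le_rfl, hM⟩)

theorem algebraMap_algCoeff (hg : g.IsFinite) (hm : NeverFails g m) {l : List (I × Spec)}
    (hl : IsPath g m l) : algebraMap K F (algCoeff g m (m - rootSum g l)) = pathCoeff g m l := by
  have hn : ∀ k ≤ l.length, ∀ M, Reach g m k M → Regular g M ∧ Generic M := fun k _ => hm k
  obtain ⟨⟨c, -, hc⟩, hc'⟩ := hl.coeff hg.r_pos hn le_rfl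
  have hex : ∃ c : K, IsPathCoeff g m (m - rootSum g l) (algebraMap K F c) :=
    ⟨c, by rw [hc]; exact hc'⟩
  rw [algCoeff, dif_pos hex, ← isPathCoeff_iff hg hn hl le_rfl]
  exact hex.choose_spec

theorem algCoeff_self (hg : g.IsFinite) (hm : NeverFails g m) : algCoeff g m m = 1 := by
  have h := algebraMap_algCoeff hg hm (l := []) trivial
  rw [rootSum_nil, sub_zero, pathCoeff, Units.val_one, ← map_one (algebraMap K F)] at h
  exact IsFractionRing.injective K F h

theorem algOutput_eq {C : Finset (Mono I)} (hC : (⋃ n, created g m n) = C) :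
    algOutput g m = ∑ M ∈ C, Finsupp.single M (algCoeff g m M) := by
  rw [algOutput, hC, finsum_mem_coe_finset]

theorem realize_sum (C : Finset (Mono I)) (c : Mono I → K) :
    realize g (∑ M ∈ C, Finsupp.single M (c M)) = ∑ M ∈ C, c M • monoField g M := by
  refine (Finsupp.sum_finsetSum_index (h := fun M c => c • monoField g M) (fun _ => zero_smul _ _)
    fun _ _ _ => add_smul _ _ _).symm.trans ?_
  exact Finset.sum_congr rfl fun M _ => Finsupp.sum_single_index (zero_smul _ _)

theorem Dominant.eq_of_reach (hr : ∀ i, 0 < g.r i) (hm : NeverFails g m) {N : ℕ} {M : Mono I}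
    (hM : Reach g m N M) (hdom : Dominant M) : M = m := by
  cases hM with
  | start => rfl
  | @step n M j a hM hadm =>
    have h1 := hadm.opposite_eq_zero (hm _ _ hM).1 (hr j) (hm _ _ (hM.step hadm)).2
    have h2 := hdom j (a * qt (-2 * g.r j) 2)
    have h3 : a ≠ a * qt (-2 * g.r j) 2 := by
      rw [Ne, left_eq_mul, ← qt_zero, qt_inj]
      omega
    rw [Finsupp.sub_apply, h1, root_apply_same, if_neg h3, if_pos rfl] at h2
    omega

theorem Screening.commutesWith (hg : g.IsFinite) (h : Screening g j τ p σ) (hξ : ShiftBy g j τ ξ)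
    (hm : NeverFails g m) (hdom : Dominant m) {C : Finset (Mono I)}
    (hC : ∀ M, M ∈ C ↔ ∃ N, Reach g m N M) :
    CommutesWith (∑ M ∈ C, algCoeff g m M • monoField g M) (screen g j σ ξ) := by
  intro n f
  have e : ∀ x : Fock I, (∑ M ∈ C, algCoeff g m M • monoField g M) n x =
      ∑ M ∈ C, algebraMap K F (algCoeff g m M) • monoField g M n x := by
    intro x
    rw [Finset.sum_apply, LinearMap.sum_apply]
    refine Finset.sum_congr rfl fun M _ => ?_
    rw [Pi.smul_apply, LinearMap.smul_apply, algebraMap_smul]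
  rw [← sub_eq_zero, e, e, map_sum]
  refine (Finset.sum_sub_distrib (G := Fock I) _ _).symm.trans ?_
  have e' : ∀ M ∈ C, algebraMap K F (algCoeff g m M) •
        monoField g M n (screen g j σ ξ (Finsupp.single 0 f)) -
      screen g j σ ξ (algebraMap K F (algCoeff g m M) • monoField g M n (Finsupp.single 0 f)) =
      Finsupp.single (0 + Pi.single j ξ) (∑ a ∈ descentSupport (column M j) (τ ^ 2) with
        descent (column M j) (τ ^ 2) a = 1,
          poleTerm g j τ σ ξ (n - 1) f (algebraMap K F (algCoeff g m M)) M a) := by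
    intro M hM
    obtain ⟨N, hN⟩ := (hC M).1 hM
    obtain ⟨h1, h2⟩ := hm N M hN
    rw [map_smul, h.monoField_commutator hξ fun a => (descent_eq_one_iff h.directions h1 h2 a).1]
  rw [Finset.sum_congr rfl e', ← Finsupp.single_finsetSum,
    h.sum_poleTerm hg hξ hm hdom hC (fun l hl => algebraMap_algCoeff hg hm hl), Finsupp.single_zero]

theorem realize_algOutput_mem (hg : g.IsFinite) (hdom : Dominant m) (h : Works g m) :
    realize g (algOutput g m) ∈ WAlgebra g := by
  obtain ⟨C, hC, hC'⟩ := h.exists_finset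
  rw [algOutput_eq hC, realize_sum]
  refine ⟨?_, ?_, fun j => ⟨?_, ?_⟩⟩
  · exact Submodule.sum_mem _ fun M _ => Submodule.smul_mem _ _ (Submodule.subset_span ⟨M, rfl⟩)
  · exact Finset.sum_induction _ IsField (fun _ _ => isField_add) isField_zero
      fun M _ => isField_smul _ (isField_monoField M)
  · exact (screening_plus hg j).commutesWith hg (shiftBy_plus hg j) h.neverFails hdom hC'
  · exact (screening_minus hg j).commutesWith hg (shiftBy_minus j) h.neverFails hdom hC'

theorem algOutput_self (hg : g.IsFinite) (h : Works g m) : algOutput g m m = 1 := by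
  obtain ⟨C, hC, hC'⟩ := h.exists_finset
  rw [algOutput_eq hC, Finsupp.finsetSum_apply, Finset.sum_eq_single m, Finsupp.single_eq_same,
    algCoeff_self hg h.neverFails]
  · intro M _ hM
    exact Finsupp.single_eq_of_ne hM.symm
  · exact fun hm => absurd ((hC' m).2 ⟨0, .start⟩) hm

theorem eq_of_dominant (hg : g.IsFinite) (h : Works g m) {M : Mono I} (hM : algOutput g m M ≠ 0)
    (hdom : Dominant M) : M = m := by
  obtain ⟨C, hC, hC'⟩ := h.exists_finset
  rw [algOutput_eq hC, Finsupp.finsetSum_apply] at hM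
  obtain ⟨M', hM', hne⟩ := Finset.exists_ne_zero_of_sum_ne_zero hM
  obtain rfl : M' = M := by
    by_contra hMM
    exact hne (Finsupp.single_eq_of_ne (Ne.symm hMM))
  obtain ⟨N, hN⟩ := (hC' M').1 hM'
  exact hdom.eq_of_reach hg.r_pos h.neverFails hN

end DeformedW

end

theorem mainTheorem2 {L : Type*} [LieRing L] [LieAlgebra ℂ L] [FiniteDimensional ℂ L]
    [LieAlgebra.IsSimple ℂ L] (H : LieSubalgebra ℂ L) [H.IsCartanSubalgebra]
    (b : (LieAlgebra.IsKilling.rootSystem H).Base) [DecidableEq b.support] (m : DeformedW.Mono b.support)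
    (hdom : DeformedW.Dominant m) (hreg : DeformedW.Regular (DeformedW.cartanData b) m)
    (hgen : DeformedW.Generic m) :
    (∀ n, DeformedW.NotFailed (DeformedW.cartanData b) m n →
      ∀ M ∈ DeformedW.created (DeformedW.cartanData b) m n,
        (∀ j a, DeformedW.Admissible (DeformedW.cartanData b) M j a →
          DeformedW.stepDen (DeformedW.cartanData b) M j a ≠ 0) ∧
        ∃ c : DeformedW.K, c ≠ 0 ∧
          ∀ x : DeformedW.F, DeformedW.IsPathCoeff (DeformedW.cartanData b) m M x ↔
            x = algebraMap DeformedW.K DeformedW.F c) ∧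
    (DeformedW.Works (DeformedW.cartanData b) m →
      DeformedW.realize (DeformedW.cartanData b) (DeformedW.algOutput (DeformedW.cartanData b) m) ∈
        DeformedW.WAlgebra (DeformedW.cartanData b) ∧
      DeformedW.algOutput (DeformedW.cartanData b) m m = 1 ∧
      ∀ M, DeformedW.algOutput (DeformedW.cartanData b) m M ≠ 0 → DeformedW.Dominant M →
        M = m) := by
  have hg := DeformedW.cartanData_isFinite b
  exact ⟨fun _ hn _ hM => DeformedW.coefficients_wellDefined hg hn hM, fun h =>
    ⟨DeformedW.realize_algOutput_mem hg hdom h, DeformedW.algOutput_self hg h,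
      fun _ hM hM' => DeformedW.eq_of_dominant hg h hM hM'⟩⟩
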